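/- \textbf{Setting.} Let $D\subseteq\mathbb R^n$ be a domain (open and connected), let $f_1,\dots,f_m:D\times\mathbb R^+\to\mathbb R^n$, and consider $$\dot x=\sum_{k=1}^m f_k(x,t)u_k,\qquad x\in D,\ u\in\mathbb R^m. \tag{1}$$ Let $x^*:\mathbb R^+\to D$ be a continuous curve and $P:D\times\mathbb R^+\to\mathbb R$. Write $L_gh(x)=\frac{\partial h(x)}{\partial x}g(x)$, $[f,g]=L_fg-L_gf$ (in the space variable), and $\mathcal L^{P,c}_t=\{x\in D:P(x,t)\le c\}$. A \emph{compact family} is a family $\{\mathcal K_t\}_{t\ge0}$ of compact subsets of $D$ for which there are $R\in\mathbb R$ and $\delta>0$ such that, for all $t\ge 0$, $\mathcal K_t$ lies in the closed ball of radius $R$ about $x^*(t)$ and the open $\delta$-neighbourhood of $\mathcal K_t$ lies in $D$. Assume: \textbf{(A1)} Each $f_k(\cdot,t)$ is $C^2$ on $D$, and $f_k(x,\cdot)$ and $L_{f_j}f_k(x,\cdot)$ are $C^1$ on $\mathbb R^+$. For every compact family there are constants $M_f,L_{fx},L_{2f}>0$ and $L_{ft},H_{fx},H_{ft}\ge0$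 such that $\|f_k(x,t)\|\le M_f$, $\|f_k(x,t)-f_k(y,t)\|\le L_{fx}\|x-y\|$, $\|\partial_tf_k(x,t)\|\le L_{ft}$, $\|L_{f_j}f_k(x,t)\|\le L_{2f}$, $\|L_{f_l}L_{f_j}f_k(x,t)\|\le H_{fx}$ and $\|\partial_t(L_{f_j}f_k)(x,t)\|\le H_{ft}$ for all $t\ge0$, $x,y\in\mathcal K_t$ and all $j,k,l$. \textbf{(A2)} There are $S_1\subseteq\{1,\dots,m\}$ and $S_2\subseteq\{1,\dots,m\}^2$ with $|S_1|+|S_2|=n$ such that the vectors $f_i(x,t)$, $i\in S_1$, and $[f_{j_1},f_{j_2}](x,t)$, $(j_1,j_2)\in S_2$, span $\mathbb R^n$ for all $t\ge0$, $x\in D$. Let $\mathcal F(x,t)$ be the matrix with these columns. For every compact family there is an $M_F>0$ with $\|\mathcal F^{-1}(x,t)\|\le M_F$ for all $t\ge0$, $x\in\mathcal K_t$. \textbf{(A3)} $P(\cdot,t)$ is $C^2$ on $D$ for every $t\ge 0$. For every compact family there are a constant $m\in\mathbb R$ and constants $L_{Px}>0$, $L_{2Px},L_{2Pt},L_{Pt},H_{Px}\ge0$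 such that $m\le P(x,t)$, $\|\nabla_xP(x,t)\|\le L_{Px}$, $|P(x,t)-P(y,\tau)|\le L_{Px}\|x-y\|+L_{Pt}|t-\tau|$, $\|\nabla_xP(x,t)-\nabla_xP(y,\tau)\|\le L_{2Px}\|x-y\|+L_{2Pt}|t-\tau|$ and $\sum_{i,j}|\partial^2P(x,t)/\partial x_i\partial x_j|\le H_{Px}$ for all $t,\tau\ge0$, $x\in\mathcal K_t$, $y\in\mathcal K_\tau$. \textbf{(A4)} For every $x^0\in D$ there are $\lambda,r>0$ such that, for all $t\ge t_0\ge0$, the set $\mathcal L^{P,P(x^0,t_0)+\lambda}_t$ is non-empty, compact and convex and contains $\{x\in D:\|\nabla_xP(x,t)\|\le r\}$. \textbf{(A5)} There are $m_P\in\mathbb R$, $\omega_{11},\omega_{12},v_1,v_2,\mu_1,\mu_2>0$ and $\nu_1,\nu_2\ge1$ such that, for all $t\ge0$, $x\in D$, $$\omega_{11}\|x-x^*(t)\|^{v_1}\le P(x,t)-m_P\le\omega_{12}\|x-x^*(t)\|^{v_2},$$ $$\mu_1(P(x,t)-m_P)^{\nu_1}\le\|\nabla_xP(x,t)\|^2\le\mu_2(P(x,t)-m_P)^{\nu_2}.$$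 \textbf{Controls and solutions.} Let $\kappa_{j_1j_2}$, $(j_1,j_2)\in S_2$, be pairwise distinct positive integers. For $\gamma,\varepsilon>0$ put $a(x,t)=-\gamma\mathcal F^{-1}(x,t)\nabla_xP(x,t)$, with entries $a_i$ ($i\in S_1$) and $a_{j_1j_2}$ ($(j_1,j_2)\in S_2$), and $$u_k^\varepsilon(a,t)=\sum_{i\in S_1}a_i\delta_{ki}+\varepsilon^{-\frac12}\sum_{(j_1,j_2)\in S_2}2\sqrt{\pi\kappa_{j_1j_2}|a_{j_1j_2}|}\Big(\delta_{kj_1}\,\mathrm{sign}(a_{j_1j_2})\cos\tfrac{2\pi\kappa_{j_1j_2}t}{\varepsilon}+\delta_{kj_2}\sin\tfrac{2\pi\kappa_{j_1j_2}t}{\varepsilon}\Big).$$ The $\pi_\varepsilon$-solution with $x_\pi(t_0)=x^0$ is the (locally) absolutely continuous $x_\pi:[t_0,\infty)\to D$ with this initial value and, with $t_j=t_0+j\varepsilon$, $$\dot x_\pi(t)=\sum_{k=1}^m u_k^\varepsilon\big(a(x_\pi(t_j),t_j),t\big)f_k(x_\pi(t),t),\qquad t\in[t_j,t_{j+1}),\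 j=0,1,2,\dots;$$ it is \emph{well-defined} if it exists on all of $[t_0,\infty)$ and is unique. \textbf{Theorem.} Assume (A1)--(A5). Let $\mathcal L^\rho_t=\{x\in D:\|x-x^*(t)\|\le\rho\}$, where $\rho>0$ is any number for which some $\lambda>0$ makes $\mathcal L_t^{P,P(x^0,t_0)+\lambda}$ compact for all $t\ge t_0\ge0$ and all $x^0\in\mathcal L^\rho_{t_0}$ simultaneously. Then there exist $\Delta>0$, $\bar\gamma>0$ and $\bar\varepsilon:[\bar\gamma,\infty)\to(0,\infty)$ such that the following hold. (i) (The family $\{\mathcal L^\rho_t\}_{t\ge0}$ is attracting.) For all $t_0\ge0$, all $x^0\in D$ in the open $\Delta$-neighbourhood of $\mathcal L^\rho_{t_0}$, all $\gamma\ge\bar\gamma$ and $\varepsilon\in(0,\bar\varepsilon(\gamma)]$, the $\pi_\varepsilon$-solution with $x_\pi(t_0)=x^0$ is well-defined and $\mathrm{dist}(x_\pi(t),\mathcal L^\rho_t)\to0$ as $t\to+\infty$. (ii) For the same $t_0$, $x^0$, all $\gamma>\gamma^*\ge\bar\gamma$, all $\varepsilon\in(0,\bar\varepsilon(\gamma)]$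 and all $t\ge t_0$: if $\nu_1=1$, then $$\|x_\pi(t)-x^*(t)\|\le\Big(\frac{\omega_{12}}{\omega_{11}}\Big)^{\frac1{v_1}}\|x^0-x^*(t_0)\|^{\frac{v_2}{v_1}}e^{-\frac{\mu_1\gamma^*}{v_1}(t-t_0-\varepsilon)}+\rho;$$ if $\nu_1>1$ and $x^0\ne x^*(t_0)$, then, with $\beta_1=(\omega_{12}/\omega_{11})^{1-\nu_1}$ and $\beta_2=\mu_1\gamma^*(\nu_1-1)/\omega_{11}^{1-\nu_1}$, the bracket below is positive and $$\|x_\pi(t)-x^*(t)\|\le\Big(\beta_1\|x^0-x^*(t_0)\|^{v_2(1-\nu_1)}+\beta_2(t-t_0-\varepsilon)\Big)^{\frac1{v_1(1-\nu_1)}}+\rho;$$ if $\nu_1>1$ and $x^0=x^*(t_0)$ (where the power term is read as $0$), then $\|x_\pi(t)-x^*(t)\|\le\rho$. -/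

import Mathlib

open Set Filter Topology

noncomputable section

namespace NonholonomicTracking

/-- The ambient space `ℝⁿ` with the Euclidean norm. -/
abbrev E (n : ℕ) := EuclideanSpace ℝ (Fin n)

/-- The Lie derivative `L_g h (x) = (∂h/∂x)(x) g(x)` of the vector field `h` along `g`. -/
def lieDeriv {n : ℕ} (g h : E n → E n) (x : E n) : E n := fderiv ℝ h x (g x)

/-- The Lie bracket `[f_i, f_j](x, t) = L_{f_i} f_j - L_{f_j} f_i` at frozen time `t`. -/
def bracket {n m : ℕ} (f : Fin m → E n → ℝ → E n) (i j : Fin m) (x : E n) (t : ℝ) : E n :=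
  lieDeriv (fun y => f i y t) (fun y => f j y t) x
    - lieDeriv (fun y => f j y t) (fun y => f i y t) x

/-- `{𝒦_t}_{t ≥ 0}` is a family of compact subsets of `D` which stays at a bounded distance from
the curve `xs(t)` and keeps a positive distance to the complement of `D`, uniformly in `t`. -/
def IsCompactFamily {n : ℕ} (D : Set (E n)) (xs : ℝ → E n) (𝒦 : ℝ → Set (E n)) : Prop :=
  (∀ t, 0 ≤ t → IsCompact (𝒦 t) ∧ 𝒦 t ⊆ D) ∧
  ∃ R δ : ℝ, 0 < δ ∧
    ∀ t, 0 ≤ t → 𝒦 t ⊆ Metric.closedBall (xs t) R ∧ Metric.thickening δ (𝒦 t) ⊆ D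

/-- Regularity of the vector fields and uniform bounds on compact families
(time derivatives are taken on `[0, ∞)`, one-sided at `t = 0`). -/
structure FieldRegularity {n m : ℕ} (D : Set (E n)) (xs : ℝ → E n)
    (f : Fin m → E n → ℝ → E n) : Prop where
  contDiff_space : ∀ k, ∀ t, 0 ≤ t → ContDiffOn ℝ 2 (fun x => f k x t) D
  contDiff_time : ∀ k, ∀ x ∈ D, ContDiffOn ℝ 1 (fun t => f k x t) (Ici 0)
  contDiff_time_lie : ∀ j k, ∀ x ∈ D,
    ContDiffOn ℝ 1 (fun t => lieDeriv (fun y => f j y t) (fun y => f k y t) x) (Ici 0)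
  bounds : ∀ 𝒦 : ℝ → Set (E n), IsCompactFamily D xs 𝒦 →
    ∃ Mf Lfx L2f Lft Hfx Hft : ℝ,
      0 < Mf ∧ 0 < Lfx ∧ 0 < L2f ∧ 0 ≤ Lft ∧ 0 ≤ Hfx ∧ 0 ≤ Hft ∧
      ∀ t, 0 ≤ t → ∀ x ∈ 𝒦 t, ∀ y ∈ 𝒦 t, ∀ j k l : Fin m,
        ‖f k x t‖ ≤ Mf ∧
        ‖f k x t - f k y t‖ ≤ Lfx * ‖x - y‖ ∧
        ‖derivWithin (fun s => f k x s) (Ici 0) t‖ ≤ Lft ∧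
        ‖lieDeriv (fun z => f j z t) (fun z => f k z t) x‖ ≤ L2f ∧
        ‖lieDeriv (fun z => f l z t)
            (fun w => lieDeriv (fun z => f j z t) (fun z => f k z t) w) x‖ ≤ Hfx ∧
        ‖derivWithin (fun s => lieDeriv (fun z => f j z s) (fun z => f k z s) x) (Ici 0) t‖ ≤ Hft

/-- Index set of the columns of the matrix `ℱ(x, t)`: `S₁` followed by `S₂`. -/
abbrev Idx {m : ℕ} (S₁ : Finset (Fin m)) (S₂ : Finset (Fin m × Fin m)) := ↥S₁ ⊕ ↥S₂

/-- The matrix `ℱ(x, t)` with columns `f_i(x, t)`, `i ∈ S₁`, and `[f_{j₁}, f_{j₂}](x, t)`,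
`(j₁, j₂) ∈ S₂`, as a linear map from coefficient vectors to `ℝⁿ`. -/
def frame {n m : ℕ} (f : Fin m → E n → ℝ → E n) (S₁ : Finset (Fin m))
    (S₂ : Finset (Fin m × Fin m)) (x : E n) (t : ℝ) :
    EuclideanSpace ℝ (Idx S₁ S₂) →L[ℝ] E n :=
  ∑ i : S₁, (EuclideanSpace.proj (𝕜 := ℝ) (Sum.inl i : Idx S₁ S₂)).smulRight (f i x t)
    + ∑ p : S₂, (EuclideanSpace.proj (𝕜 := ℝ) (Sum.inr p : Idx S₁ S₂)).smulRight
        (bracket f p.1.1 p.1.2 x t)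

/-- Bracket-generating condition of degree 2 with index sets `S₁`, `S₂`, and boundedness of
`ℱ⁻¹` on compact families. -/
structure BracketGenerating {n m : ℕ} (D : Set (E n)) (xs : ℝ → E n)
    (f : Fin m → E n → ℝ → E n) (S₁ : Finset (Fin m)) (S₂ : Finset (Fin m × Fin m)) : Prop where
  card : S₁.card + S₂.card = n
  span : ∀ t, 0 ≤ t → ∀ x ∈ D,
    Submodule.span ℝ ({v | ∃ i ∈ S₁, v = f i x t} ∪ {v | ∃ p ∈ S₂, v = bracket f p.1 p.2 x t}) = ⊤
  inverse_bound : ∀ 𝒦 : ℝ → Set (E n), IsCompactFamily D xs 𝒦 →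
    ∃ MF : ℝ, 0 < MF ∧ ∀ t, 0 ≤ t → ∀ x ∈ 𝒦 t, ‖(frame f S₁ S₂ x t).inverse‖ ≤ MF

/-- The gradient `∇_x P(x, t)` with respect to the space variable. -/
def gradX {n : ℕ} (P : E n → ℝ → ℝ) (x : E n) (t : ℝ) : E n := gradient (fun y => P y t) x

/-- Regularity of the potential and uniform bounds on compact families. -/
structure PotentialRegularity {n : ℕ} (D : Set (E n)) (xs : ℝ → E n) (P : E n → ℝ → ℝ) :
    Prop where
  contDiff_space : ∀ t, 0 ≤ t → ContDiffOn ℝ 2 (fun x => P x t) D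
  bounds : ∀ 𝒦 : ℝ → Set (E n), IsCompactFamily D xs 𝒦 →
    ∃ mP LPx L2Px L2Pt LPt HPx : ℝ,
      0 < LPx ∧ 0 ≤ L2Px ∧ 0 ≤ L2Pt ∧ 0 ≤ LPt ∧ 0 ≤ HPx ∧
      ∀ t, 0 ≤ t → ∀ τ, 0 ≤ τ → ∀ x ∈ 𝒦 t, ∀ y ∈ 𝒦 τ,
        mP ≤ P x t ∧
        ‖gradX P x t‖ ≤ LPx ∧
        |P x t - P y τ| ≤ LPx * ‖x - y‖ + LPt * |t - τ| ∧
        ‖gradX P x t - gradX P y τ‖ ≤ L2Px * ‖x - y‖ + L2Pt * |t - τ| ∧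
        ∑ i : Fin n, ∑ j : Fin n,
          |iteratedFDeriv ℝ 2 (fun z => P z t) x
            ![EuclideanSpace.single i (1 : ℝ), EuclideanSpace.single j (1 : ℝ)]| ≤ HPx

/-- The sublevel set `{x ∈ D : P(x, t) ≤ c}`. -/
def sublevel {n : ℕ} (D : Set (E n)) (P : E n → ℝ → ℝ) (t c : ℝ) : Set (E n) :=
  {x | x ∈ D ∧ P x t ≤ c}

/-- The gradient sublevel set `{x ∈ D : ‖∇_x P(x, t)‖ ≤ c}`. -/
def gradSublevel {n : ℕ} (D : Set (E n)) (P : E n → ℝ → ℝ) (t c : ℝ) : Set (E n) :=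
  {x | x ∈ D ∧ ‖gradX P x t‖ ≤ c}

/-- The assumption on the level sets of the potential. -/
def LevelSetAssumption {n : ℕ} (D : Set (E n)) (P : E n → ℝ → ℝ) : Prop :=
  ∀ x0 ∈ D, ∃ lam r : ℝ, 0 < lam ∧ 0 < r ∧ ∀ t0 t, 0 ≤ t0 → t0 ≤ t →
    (sublevel D P t (P x0 t0 + lam)).Nonempty ∧
    IsCompact (sublevel D P t (P x0 t0 + lam)) ∧
    Convex ℝ (sublevel D P t (P x0 t0 + lam)) ∧
    gradSublevel D P t r ⊆ sublevel D P t (P x0 t0 + lam)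

/-- The `π_ε`-solution on `[t₀, ∞)` of `ẋ = F(x, u, t)`, `x ∈ D`, with `x(t₀) = x⁰` under the sampled
feedback `u = h(a(x(t_j), t_j), t)` for `t ∈ [t_j, t_{j+1})`, `t_j = t₀ + ε j`. -/
structure IsPiSolution {n : ℕ} {U A : Type*} (D : Set (E n)) (F : E n → U → ℝ → E n)
    (a : E n → ℝ → A) (h : A → ℝ → U) (ε t0 : ℝ) (x0 : E n) (x : ℝ → E n) : Prop where
  mem : ∀ t, t0 ≤ t → x t ∈ D
  init : x t0 = x0
  absCont : ∀ T, t0 ≤ T → AbsolutelyContinuousOnInterval x t0 T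
  ode : ∀ j : ℕ, ∀ t ∈ Ico (t0 + ε * j) (t0 + ε * (j + 1)),
    HasDerivWithinAt x (F (x t) (h (a (x (t0 + ε * j)) (t0 + ε * j)) t) t)
      (Ico (t0 + ε * j) (t0 + ε * (j + 1))) t

/-- Right-hand side `∑ₖ uₖ f_k(x, t)` of the driftless control-affine system. -/
def controlSystem {n m : ℕ} (f : Fin m → E n → ℝ → E n) (x : E n) (u : Fin m → ℝ) (t : ℝ) : E n :=
  ∑ k, u k • f k x t

/-- The coefficient vector `a(x, t) = -γ ℱ⁻¹(x, t) ∇_x P(x, t)`. -/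
def coeff {n m : ℕ} (f : Fin m → E n → ℝ → E n) (S₁ : Finset (Fin m))
    (S₂ : Finset (Fin m × Fin m)) (P : E n → ℝ → ℝ) (γ : ℝ) (x : E n) (t : ℝ) :
    EuclideanSpace ℝ (Idx S₁ S₂) :=
  -(γ • (frame f S₁ S₂ x t).inverse (gradX P x t))

/-- The oscillating component `φ^{(k,ε)}_{j₁j₂}(t)`, where `p = (j₁, j₂)` and `ap = a_{j₁j₂}`. -/
def dither {m : ℕ} (κ : Fin m × Fin m → ℕ) (ε ap : ℝ) (p : Fin m × Fin m) (k : Fin m) (t : ℝ) : ℝ :=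
  2 * √(Real.pi * κ p) *
    ((if k = p.1 then 1 else 0) * Real.sign ap * Real.cos (2 * Real.pi * κ p / ε * t)
      + (if k = p.2 then 1 else 0) * Real.sin (2 * Real.pi * κ p / ε * t))

/-- The controls `u_k^ε(a, t)`. -/
def control {m : ℕ} (S₁ : Finset (Fin m)) (S₂ : Finset (Fin m × Fin m))
    (κ : Fin m × Fin m → ℕ) (ε : ℝ) (a : EuclideanSpace ℝ (Idx S₁ S₂)) (t : ℝ) (k : Fin m) : ℝ :=
  ∑ i : S₁, a (Sum.inl i) * (if k = (i : Fin m) then 1 else 0)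
    + ε ^ (-(1 / 2) : ℝ) * ∑ p : S₂, √|a (Sum.inr p)| * dither κ ε (a (Sum.inr p)) p k t

/-- `x` is a `π_ε`-solution of the closed-loop system with gain `γ`, starting from `x0` at `t0`. -/
def IsClosedLoopSolution {n m : ℕ} (D : Set (E n)) (f : Fin m → E n → ℝ → E n)
    (S₁ : Finset (Fin m)) (S₂ : Finset (Fin m × Fin m)) (κ : Fin m × Fin m → ℕ)
    (P : E n → ℝ → ℝ) (γ ε t0 : ℝ) (x0 : E n) (x : ℝ → E n) : Prop :=
  IsPiSolution D (controlSystem f) (coeff f S₁ S₂ P γ) (control S₁ S₂ κ ε) ε t0 x0 x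

/-- The tube `{x ∈ D : ‖x - xs(t)‖ ≤ ρ}` at time `t`. -/
def tube {n : ℕ} (D : Set (E n)) (xs : ℝ → E n) (ρ t : ℝ) : Set (E n) :=
  {x | x ∈ D ∧ ‖x - xs t‖ ≤ ρ}

/-- The family of tubes is attracting in the sense of `π_ε`-solutions, with the constants
`Δ`, `γbar` and the function `εbar : [γbar, ∞) → (0, ∞)`. The `π_ε`-solution is well-defined:
it exists and is unique on `[t₀, ∞)`. -/
structure IsAttractingWith {n m : ℕ} (D : Set (E n)) (f : Fin m → E n → ℝ → E n)
    (S₁ : Finset (Fin m)) (S₂ : Finset (Fin m × Fin m)) (κ : Fin m × Fin m → ℕ)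
    (P : E n → ℝ → ℝ) (xs : ℝ → E n) (ρ Δ γbar : ℝ) (εbar : ℝ → ℝ) : Prop where
  Δ_pos : 0 < Δ
  γbar_pos : 0 < γbar
  εbar_pos : ∀ γ, γbar ≤ γ → 0 < εbar γ
  exists_solution : ∀ t0, 0 ≤ t0 → ∀ x0 ∈ Metric.thickening Δ (tube D xs ρ t0) ∩ D,
    ∀ γ, γbar ≤ γ → ∀ ε ∈ Ioc 0 (εbar γ),
      ∃ x, IsClosedLoopSolution D f S₁ S₂ κ P γ ε t0 x0 x
  unique_solution : ∀ t0, 0 ≤ t0 → ∀ x0 ∈ Metric.thickening Δ (tube D xs ρ t0) ∩ D,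
    ∀ γ, γbar ≤ γ → ∀ ε ∈ Ioc 0 (εbar γ), ∀ x y,
      IsClosedLoopSolution D f S₁ S₂ κ P γ ε t0 x0 x →
      IsClosedLoopSolution D f S₁ S₂ κ P γ ε t0 x0 y → EqOn x y (Ici t0)
  attracts : ∀ t0, 0 ≤ t0 → ∀ x0 ∈ Metric.thickening Δ (tube D xs ρ t0) ∩ D,
    ∀ γ, γbar ≤ γ → ∀ ε ∈ Ioc 0 (εbar γ), ∀ x,
      IsClosedLoopSolution D f S₁ S₂ κ P γ ε t0 x0 x →
      Tendsto (fun t => Metric.infDist (x t) (tube D xs ρ t)) atTop (𝓝 0)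

end NonholonomicTracking

end

open Set Filter Topology

noncomputable section

namespace NonholonomicTracking

/-! On one sampling period the controls are a constant part plus terms of size `ε ^ (-1/2)`, which
are derivatives of periodic functions of size `√ε`. A second order expansion over the period
(`norm_expansion_le`) leaves the constant part and the integrals of products of the oscillating
terms. Since the frequencies are distinct on `S₂`, these integrals produce exactly the brackets in
`ℱ` (`sum_integral_smul_lieDeriv`). Hence a period starting at `ξ` moves the state by `-εγ ∇P(ξ) +
O(ε ^ (3/2))`, a gradient step.

Consequently `V = P - mP` satisfies `V' ≤ V - εγμ₁ V ^ ν₁ + ε(C + 1)` from one sampling time to the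
next. Here `C` pays for the explicit time dependence of `P` and does not depend on `γ`, whereas the
`1` pays for the expansion error, made small by taking `ε` small after `γ`. Once `γsμ₁ η ^ ν₁ ≥ C +
1` for some `γs ≤ γ`, the perturbation is absorbed by a margin `η`: superadditivity of `s ↦ s ^ ν₁`
keeps `V` below `y + η`, where `y' = -γsμ₁ y ^ ν₁` (`comparison_step`, `decay_step`). Motion inside
a period costs one more `η`. The bounds of `V` by powers of the distance turn this into the decay
estimates, and `3η ≤ ω₁₁ ρ ^ v₁` forces the state into the tube after finite time.

The constants must be uniform in time although the sets move. The sets used are the sublevels at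
`peak t + lam / 2`, `peak t` being the supremum of `P` over all tubes up to time `t`. They contain
the tubes, are compact because some earlier tube value almost attains `peak t`, and stay uniformly
away from the complement of `D` because the gradient is bounded on slightly larger sublevels
(`isCompactFamily_sublevel`). The target curve is uniformly continuous (`exists_target_modulus`), so
this family can be enlarged to cover whole periods. The comparison also shows that the sampled
states never leave the family, and this gives global existence and uniqueness period by period. -/

/-! ### Differential inequalities along curves -/

/-- Growth of a function `s ↦ g (x s) s` which is only separately regular, compared with `w`. -/
lemma norm_comp_sub_sub_le {E F : Type*} [NormedAddCommGroup E] [NormedSpace ℝ E]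
    [NormedAddCommGroup F] [NormedSpace ℝ F] {B : Set E} {g : E → ℝ → F} {g' : ℝ → E →L[ℝ] F}
    {x v : ℝ → E} {w w' : ℝ → F} {T T' C Lt : ℝ}
    (hx : ContinuousOn x (Icc T T')) (hxB : ∀ s ∈ Icc T T', x s ∈ B)
    (hx' : ∀ s ∈ Ico T T', HasDerivWithinAt x (v s) (Ici s) s)
    (hg : ∀ s ∈ Icc T T', HasFDerivAt (fun y => g y s) (g' s) (x s))
    (hgt : ∀ y ∈ B, ∀ s ∈ Icc T T', ∀ s' ∈ Icc T T', ‖g y s - g y s'‖ ≤ Lt * |s - s'|)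
    (hw : ContinuousOn w (Icc T T'))
    (hw' : ∀ s ∈ Ico T T', HasDerivWithinAt w (w' s) (Ici s) s) (hwT : w T = 0)
    (hC : ∀ s ∈ Ico T T', ‖g' s (v s) - w' s‖ + Lt ≤ C) :
    ∀ s ∈ Icc T T', ‖g (x s) s - g (x T) T - w s‖ ≤ C * (s - T) := by
  intro s₁ hs₁
  refine le_of_forall_pos_le_add fun e he => ?_
  have hTT : 0 ≤ T' - T := by linarith [hs₁.1, hs₁.2]
  -- The slack makes the comparison of slopes strict; its total effect over the interval is at most
  -- `e`.
  set e' := e / (T' - T + 1) with he'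
  have he'0 : 0 < e' := by positivity
  have hcont : ContinuousOn (fun s => g (x s) s) (Icc T T') := by
    intro s hs
    have h1 : ContinuousWithinAt (fun z => g (x z) s) (Icc T T') s :=
      ContinuousAt.comp_continuousWithinAt (f := x) (g := fun y => g y s)
        (hg s hs).continuousAt (hx s hs)
    have h2 : Tendsto (fun z => g (x z) z - g (x z) s) (𝓝[Icc T T'] s) (𝓝 0) := by
      refine squeeze_zero_norm' (a := fun z => Lt * |z - s|) ?_ ?_
      · filter_upwards [self_mem_nhdsWithin] with z hz
        exact hgt _ (hxB z hz) z hz s hs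
      · have : Continuous fun z : ℝ => Lt * |z - s| := by fun_prop
        have h3 := (this.tendsto s).mono_left (nhdsWithin_le_nhds (s := Icc T T'))
        simpa using h3
    have h4 := h2.add h1
    simpa [ContinuousWithinAt] using h4
  have hmain := image_norm_le_of_liminf_right_slope_norm_lt_deriv_boundary
    (f := fun s => g (x s) s - g (x T) T - w s) (f' := fun _ => C) (a := T) (b := T')
    (B := fun s => (C + e') * (s - T)) (B' := fun _ => C + e')
    ((hcont.sub continuousOn_const).sub hw) ?_ (by simp [hwT]) (by fun_prop) ?_
    (fun _ _ _ => by linarith) hs₁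
  · refine hmain.trans ?_
    have : e' * (s₁ - T) ≤ e := by
      have h5 : s₁ - T ≤ T' - T + 1 := by linarith [hs₁.2]
      calc e' * (s₁ - T) ≤ e' * (T' - T + 1) := by gcongr
        _ = e := by rw [he']; field_simp
    linarith
  · intro s hs r hr
    apply Eventually.frequently
    have hs' : s ∈ Icc T T' := ⟨hs.1, hs.2.le⟩
    have hψ : HasDerivWithinAt (fun z => g (x z) s - w z) (g' s (v s) - w' s) (Ici s) s :=
      ((hg s hs').comp_hasDerivWithinAt s (hx' s hs)).sub (hw' s hs)
    have hlt : ‖g' s (v s) - w' s‖ < r - Lt := by linarith [hC s hs]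
    have h6 := (hψ.mono Ioi_subset_Ici_self).limsup_norm_slope_le hlt
    have h7 : ∀ᶠ z in 𝓝[>] s, z ∈ Ioc s T' := Ioc_mem_nhdsGT hs.2
    filter_upwards [h6, h7] with z hz hzT
    have hz0 : 0 < z - s := sub_pos.2 hzT.1
    have hzI : z ∈ Icc T T' := ⟨hs.1.trans hzT.1.le, hzT.2⟩
    rw [slope_def_field, div_lt_iff₀ hz0]
    rw [Real.norm_of_nonneg hz0.le, inv_mul_lt_iff₀ hz0] at hz
    have h8 := hgt _ (hxB z hzI) z hzI s hs'
    rw [abs_of_pos hz0] at h8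
    simp only [Function.comp]
    have h9 := norm_sub_norm_le (g (x z) z - g (x T) T - w z) (g (x s) s - g (x T) T - w s)
    -- Time is moved first at the fixed position `x z`, then position at the fixed time `s`; no
    -- joint differentiability of `g` is needed.
    have h10 : (g (x z) z - g (x T) T - w z) - (g (x s) s - g (x T) T - w s)
        = (g (x z) z - g (x z) s) + (g (x z) s - w z - (g (x s) s - w s)) := by abel
    rw [h10] at h9
    have h11 := norm_add_le (g (x z) z - g (x z) s) (g (x z) s - w z - (g (x s) s - w s))
    nlinarith
  · intro s _
    simpa using ((hasDerivWithinAt_id s (Ici s)).sub_const T).const_mul (C + e')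

/-- A curve whose speed is at most `M` inside a ball leaves it no earlier than expected. -/
lemma norm_sub_le_of_speed_le {E : Type*} [NormedAddCommGroup E] [NormedSpace ℝ E]
    {x v : ℝ → E} {T T' M r : ℝ} (hMr : M * (T' - T) < r) (hM : 0 ≤ M)
    (hx : ContinuousOn x (Icc T T'))
    (hx' : ∀ s ∈ Ico T T', HasDerivWithinAt x (v s) (Ici s) s)
    (hv : ∀ s ∈ Ico T T', ‖x s - x T‖ < r → ‖v s‖ ≤ M) :
    ∀ s ∈ Icc T T', ‖x s - x T‖ ≤ M * (s - T) := by
  -- A slightly larger speed gives the strict inequality required at a first contact, where `‖x s -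
  -- x T‖` is still below `r`; afterwards `M'` tends to `M`.
  have key : ∀ M', M < M' → M' * (T' - T) < r → ∀ s ∈ Icc T T', ‖x s - x T‖ ≤ M' * (s - T) := by
    intro M' hM' hr'
    refine image_norm_le_of_norm_deriv_right_lt_deriv_boundary' (f := fun s => x s - x T)
      (f' := v) (B' := fun _ => M') (hx.sub continuousOn_const)
      (fun s hs => (hx' s hs).sub_const _) (by simp) (by fun_prop) ?_ ?_
    · intro s _
      simpa using ((hasDerivWithinAt_id s (Ici s)).sub_const T).const_mul M'
    · intro s hs h
      refine (hv s hs ?_).trans_lt hM'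
      rw [h]
      refine lt_of_le_of_lt ?_ hr'
      have := hs.2.le
      have : 0 ≤ M' := by linarith
      gcongr
  have hlt : ∀ᶠ M' in 𝓝[>] M, M' * (T' - T) < r := by
    have : Continuous fun M' : ℝ => M' * (T' - T) := by fun_prop
    exact ((this.tendsto M).eventually (gt_mem_nhds hMr)).filter_mono nhdsWithin_le_nhds
  intro s hs
  have h1 : Tendsto (fun M' : ℝ => M' * (s - T)) (𝓝[>] M) (𝓝 (M * (s - T))) := by
    have : Continuous fun M' : ℝ => M' * (s - T) := by fun_prop
    exact (this.tendsto M).mono_left nhdsWithin_le_nhds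
  refine ge_of_tendsto h1 ?_
  filter_upwards [hlt, self_mem_nhdsWithin] with M' h2 h3
  exact key M' h3 h2 s hs

/-! ### Orthogonality of harmonics -/

open Real in
/-- Integrals of products of harmonics over a full period. -/
lemma integral_harmonics {ε : ℝ} (hε : 0 < ε) (T : ℝ) {p q : ℕ} (hp : 0 < p) (hq : 0 < q)
    (A B C D : ℝ) :
    ∫ s in T..T + ε, (A * cos (2 * π * p / ε * s) + B * sin (2 * π * p / ε * s)) *
      (C * sin (2 * π * q / ε * s) - D * cos (2 * π * q / ε * s))
      = if p = q then ε / 2 * (B * C - A * D) else 0 := by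
  have hsin : ∀ N : ℤ, N ≠ 0 → ∫ s in T..T + ε, sin (2 * π * N / ε * s) = 0 := by
    intro N hN
    have hN' : (N : ℝ) ≠ 0 := by exact_mod_cast hN
    have hc : 2 * π * N / ε ≠ 0 := by positivity
    rw [intervalIntegral.integral_comp_mul_left (fun s => sin s) hc, integral_sin]
    have : 2 * π * N / ε * (T + ε) = 2 * π * N / ε * T + N * (2 * π) := by field_simp
    rw [this, cos_add_int_mul_two_pi]; simp
  have hcos : ∀ N : ℤ, N ≠ 0 → ∫ s in T..T + ε, cos (2 * π * N / ε * s) = 0 := by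
    intro N hN
    have hN' : (N : ℝ) ≠ 0 := by exact_mod_cast hN
    have hc : 2 * π * N / ε ≠ 0 := by positivity
    rw [intervalIntegral.integral_comp_mul_left (fun s => cos s) hc, integral_cos]
    have : 2 * π * N / ε * (T + ε) = 2 * π * N / ε * T + N * (2 * π) := by field_simp
    rw [this, sin_add_int_mul_two_pi]; simp
  -- In product-to-sum form the frequencies are `p + q`, never zero, and `p - q`, zero exactly when
  -- `p = q`; only the last cosine can have a nonzero mean.
  have hpt : ∀ s : ℝ, (A * cos (2 * π * p / ε * s) + B * sin (2 * π * p / ε * s)) *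
      (C * sin (2 * π * q / ε * s) - D * cos (2 * π * q / ε * s))
      = ((A * C - B * D) / 2) * sin (2 * π * ((p + q : ℤ) : ℝ) / ε * s)
        + (-(A * C + B * D) / 2) * sin (2 * π * ((p - q : ℤ) : ℝ) / ε * s)
        + (-(A * D + B * C) / 2) * cos (2 * π * ((p + q : ℤ) : ℝ) / ε * s)
        + ((B * C - A * D) / 2) * cos (2 * π * ((p - q : ℤ) : ℝ) / ε * s) := by
    intro s
    have h1 : 2 * π * ((p + q : ℤ) : ℝ) / ε * s = 2 * π * p / ε * s + 2 * π * q / ε * s := by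
      push_cast; ring
    have h2 : 2 * π * ((p - q : ℤ) : ℝ) / ε * s = 2 * π * p / ε * s - 2 * π * q / ε * s := by
      push_cast; ring
    rw [h1, h2, sin_add, sin_sub, cos_add, cos_sub]
    ring
  simp_rw [hpt]
  have hI : ∀ f : ℝ → ℝ, Continuous f → IntervalIntegrable f MeasureTheory.volume T (T + ε) :=
    fun f hf => hf.intervalIntegrable _ _
  rw [intervalIntegral.integral_add (hI _ (by fun_prop)) (hI _ (by fun_prop)),
    intervalIntegral.integral_add (hI _ (by fun_prop)) (hI _ (by fun_prop)),
    intervalIntegral.integral_add (hI _ (by fun_prop)) (hI _ (by fun_prop)),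
    intervalIntegral.integral_const_mul, intervalIntegral.integral_const_mul,
    intervalIntegral.integral_const_mul, intervalIntegral.integral_const_mul,
    hsin (p + q) (by omega), hcos (p + q) (by omega)]
  split_ifs with h
  · subst h
    simp
    ring
  · rw [hsin (p - q) (by omega), hcos (p - q) (by omega)]; ring

/-! ### The scalar decay equation and its discrete comparison -/

/-- The solution of `y' = -c y ^ ν`, `y 0 = Y`. -/
def decay (ν c Y s : ℝ) : ℝ :=
  if ν = 1 then Y * Real.exp (-(c * s))
  else if Y = 0 then 0 else (Y ^ (1 - ν) + c * (ν - 1) * s) ^ (1 / (1 - ν))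

lemma decay_zero {ν c Y : ℝ} (hY : 0 ≤ Y) : decay ν c Y 0 = Y := by
  unfold decay
  split_ifs with h1 h2
  · simp
  · exact h2.symm
  · have : 1 - ν ≠ 0 := sub_ne_zero.2 (Ne.symm h1)
    rw [mul_zero, add_zero, ← Real.rpow_mul hY, mul_one_div_cancel this, Real.rpow_one]

lemma decay_nonneg {ν c Y s : ℝ} (hν : 1 ≤ ν) (hc : 0 ≤ c) (hY : 0 ≤ Y) (hs : 0 ≤ s) :
    0 ≤ decay ν c Y s := by
  unfold decay
  split_ifs with h1 h2
  · positivity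
  · exact le_rfl
  · have : 0 ≤ ν - 1 := by linarith
    positivity

/-- The time `s` may be negative, since the final estimates evaluate at `t - t0 - ε`. Positivity of
the bracket at the earlier time is therefore assumed. -/
lemma decay_antitone {ν c Y s s' : ℝ} (hν : 1 ≤ ν) (hc : 0 ≤ c) (hY : 0 ≤ Y)
    (hpos : ν ≠ 1 → Y ≠ 0 → 0 < Y ^ (1 - ν) + c * (ν - 1) * s) (hs : s ≤ s') :
    decay ν c Y s' ≤ decay ν c Y s := by
  unfold decay
  split_ifs with h1 h2
  · gcongr
  · exact le_rfl
  · have h3 : 0 ≤ ν - 1 := by linarith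
    have h4 : ν - 1 ≠ 0 := sub_ne_zero.2 h1
    refine Real.rpow_le_rpow_of_nonpos (hpos h1 h2) (by gcongr) ?_
    rw [one_div]
    exact inv_nonpos.2 (by linarith)

/-- The solution is convex in time and so lies above its tangents: an explicit Euler step
undershoots it. -/
lemma decay_step {ν c Y s e : ℝ} (hν : 1 ≤ ν) (hc : 0 ≤ c) (hY : 0 ≤ Y) (hs : 0 ≤ s)
    (he : 0 ≤ e) :
    decay ν c Y s - e * c * decay ν c Y s ^ ν ≤ decay ν c Y (s + e) := by
  unfold decay
  split_ifs with h1 h2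
  · rw [h1, Real.rpow_one]
    have : Real.exp (-(c * (s + e))) = Real.exp (-(c * s)) * Real.exp (-(c * e)) := by
      rw [← Real.exp_add]; ring_nf
    rw [this]
    have h3 := Real.add_one_le_exp (-(c * e))
    have h4 : 0 ≤ Y * Real.exp (-(c * s)) := by positivity
    nlinarith
  · have : ν ≠ 0 := by linarith
    simp [Real.zero_rpow this]
  · have h3 : 0 < ν - 1 := lt_of_le_of_ne (by linarith) (sub_ne_zero.2 h1).symm
    have hY' : 0 < Y := lt_of_le_of_ne hY (Ne.symm h2)
    set b := Y ^ (1 - ν) + c * (ν - 1) * s with hb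
    have hb0 : 0 < b := by positivity
    have hz : b ^ (1 / (1 - ν)) = b ^ (-(1 / (ν - 1))) := by
      congr 1; rw [← neg_sub, one_div_neg_eq_neg_one_div]
    have h5 : Y ^ (1 - ν) + c * (ν - 1) * (s + e) = b * (1 + c * (ν - 1) * e / b) := by
      field_simp; rw [hb]; ring
    set θ := c * (ν - 1) * e / b with hθ
    have hθ0 : 0 ≤ θ := by positivity
    rw [h5, Real.mul_rpow hb0.le (by positivity)]
    -- Tangent bound for the negative power `-1 / (ν - 1)` at `1`, from `log (1 + θ) ≤ θ` and `1 + z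
    -- ≤ exp z`.
    have h6 : 1 - e * c / b ≤ (1 + θ) ^ (1 / (1 - ν)) := by
      have h7 : (1 + θ) ^ (1 / (1 - ν)) = Real.exp (-(1 / (ν - 1) * Real.log (1 + θ))) := by
        rw [Real.rpow_def_of_pos (by positivity)]; congr 1
        rw [← neg_sub, one_div_neg_eq_neg_one_div]; ring
      have h8 : Real.log (1 + θ) ≤ θ := by
        have := Real.log_le_sub_one_of_pos (show 0 < 1 + θ by positivity); linarith
      have h9 : 1 / (ν - 1) * Real.log (1 + θ) ≤ 1 / (ν - 1) * θ := by gcongr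
      have h10 : 1 / (ν - 1) * θ = e * c / b := by rw [hθ]; field_simp
      rw [h7]
      have := Real.add_one_le_exp (-(1 / (ν - 1) * Real.log (1 + θ)))
      linarith
    have h11 : (b ^ (1 / (1 - ν))) ^ ν = b ^ (1 / (1 - ν)) / b := by
      have h4 : 1 - ν ≠ 0 := by linarith
      rw [← Real.rpow_mul hb0.le, eq_div_iff hb0.ne']
      nth_rw 2 [← Real.rpow_one b]
      rw [← Real.rpow_add hb0]
      congr 1
      field_simp
      ring
    rw [h11]
    have h12 : 0 ≤ b ^ (1 / (1 - ν)) := by positivity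
    calc b ^ (1 / (1 - ν)) - e * c * (b ^ (1 / (1 - ν)) / b)
        = b ^ (1 / (1 - ν)) * (1 - e * c / b) := by ring
      _ ≤ _ := by gcongr

lemma tendsto_decay {ν c Y : ℝ} (hν : 1 ≤ ν) (hc : 0 < c) :
    Tendsto (decay ν c Y) atTop (𝓝 0) := by
  unfold decay
  split_ifs with h1 h2
  · have : Tendsto (fun s : ℝ => Real.exp (-(c * s))) atTop (𝓝 0) :=
      Real.tendsto_exp_neg_atTop_nhds_zero.comp (tendsto_id.const_mul_atTop hc)
    simpa using this.const_mul Y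
  · exact tendsto_const_nhds
  · have h3 : 0 < ν - 1 := lt_of_le_of_ne (by linarith) (sub_ne_zero.2 h1).symm
    have h4 : Tendsto (fun s : ℝ => Y ^ (1 - ν) + c * (ν - 1) * s) atTop atTop :=
      tendsto_atTop_add_const_left _ _ (tendsto_id.const_mul_atTop (by positivity))
    have h5 : (1 : ℝ) / (1 - ν) = -(1 / (ν - 1)) := by
      rw [← neg_sub, one_div_neg_eq_neg_one_div]
    rw [h5]
    exact (tendsto_rpow_neg_atTop (by positivity)).comp h4

/-- `V ↦ V - k V ^ ν` is monotone on `[0, Vmax]` when `k` is small. -/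
lemma sub_mul_rpow_mono {ν k a b Vmax : ℝ} (hν : 1 ≤ ν) (hk : 0 ≤ k) (ha : 0 ≤ a) (hab : a ≤ b)
    (hb : b ≤ Vmax) (hsmall : k * (ν * Vmax ^ (ν - 1)) ≤ 1) :
    a - k * a ^ ν ≤ b - k * b ^ ν := by
  rcases (ha.trans hab).eq_or_lt with hb0 | hb0
  · have : a = b := le_antisymm hab (hb0 ▸ ha)
    rw [this]
  have h1 : -1 ≤ a / b - 1 := by have := div_nonneg ha hb0.le; linarith
  -- Bernoulli's inequality at `a / b` is the tangent estimate `b ^ ν - a ^ ν ≤ ν b ^ (ν - 1) (b -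
  -- a)`.
  have h2 := one_add_mul_self_le_rpow_one_add h1 hν
  rw [add_sub_cancel, Real.div_rpow ha hb0.le, le_div_iff₀ (by positivity)] at h2
  have h3 : b ^ ν = b * b ^ (ν - 1) := by
    rw [← Real.rpow_one_add' hb0.le (by linarith)]; ring_nf
  have h4 : (1 + ν * (a / b - 1)) * b ^ ν = b ^ ν - ν * b ^ (ν - 1) * (b - a) := by
    rw [h3]; field_simp; ring
  have h5 : b ^ (ν - 1) ≤ Vmax ^ (ν - 1) := by
    apply Real.rpow_le_rpow hb0.le hb; linarith
  have h6 : k * (ν * b ^ (ν - 1)) ≤ 1 := le_trans (by gcongr) hsmall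
  have h7 : k * (b ^ ν - a ^ ν) ≤ k * (ν * b ^ (ν - 1)) * (b - a) := by
    rw [mul_assoc]
    gcongr
    linarith
  have h8 : k * (ν * b ^ (ν - 1)) * (b - a) ≤ 1 * (b - a) := by
    apply mul_le_mul_of_nonneg_right h6; linarith
  linarith

/-- Comparison step for the discrete Lyapunov inequality. -/
lemma comparison_step {ν k B η V V' y y' Vmax ε : ℝ} (hν : 1 ≤ ν) (hk : 0 ≤ k) (hε : 0 ≤ ε)
    (hη : 0 ≤ η) (hV : 0 ≤ V) (hy : 0 ≤ y) (hymax : y + η ≤ Vmax)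
    (hsmall : ε * k * (ν * Vmax ^ (ν - 1)) ≤ 1) (hB : B ≤ k * η ^ ν)
    (hstep : V' ≤ V - ε * k * V ^ ν + ε * B) (hVy : V ≤ y + η)
    (hy' : y - ε * k * y ^ ν ≤ y') : V' ≤ y' + η := by
  -- `V` is replaced by `y + η` through monotonicity of the step map; then `(y + η) ^ ν ≥ y ^ ν + η
  -- ^ ν` separates a term `k η ^ ν` that pays for `B`.
  have h1 := sub_mul_rpow_mono hν (mul_nonneg hε hk) hV hVy hymax hsmall
  have h2 := Real.add_rpow_le_rpow_add hy hη hν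
  have h3 : ε * k * (y ^ ν + η ^ ν) ≤ ε * k * (y + η) ^ ν := by gcongr
  have h4 : ε * B ≤ ε * (k * η ^ ν) := by gcongr
  nlinarith

/-! ### Second order expansion over one period -/

/-- Bounds on the fields, uniform on a set `O` of positions during a time window. -/
structure LocalFieldBounds {n m : ℕ} (f : Fin m → E n → ℝ → E n) (O : Set (E n)) (T T' C : ℝ) :
    Prop where
  diff : ∀ k, ∀ s ∈ Icc T T', ∀ x ∈ O, DifferentiableAt ℝ (fun y => f k y s) x
  diff_lie : ∀ j k, ∀ s ∈ Icc T T', ∀ x ∈ O,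
    DifferentiableAt ℝ (lieDeriv (fun y => f j y s) (fun y => f k y s)) x
  norm_le : ∀ k, ∀ s ∈ Icc T T', ∀ x ∈ O, ‖f k x s‖ ≤ C
  lip : ∀ k, ∀ s ∈ Icc T T', ∀ x ∈ O, ∀ y ∈ O, ‖f k x s - f k y s‖ ≤ C * ‖x - y‖
  lie_le : ∀ j k, ∀ s ∈ Icc T T', ∀ x ∈ O,
    ‖lieDeriv (fun y => f j y s) (fun y => f k y s) x‖ ≤ C
  lie_lie_le : ∀ l j k, ∀ s ∈ Icc T T', ∀ x ∈ O,
    ‖lieDeriv (fun y => f l y s) (lieDeriv (fun y => f j y s) (fun y => f k y s)) x‖ ≤ C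
  time : ∀ k, ∀ x ∈ O, ∀ s ∈ Icc T T', ∀ s' ∈ Icc T T', ‖f k x s - f k x s'‖ ≤ C * |s - s'|
  time_lie : ∀ j k, ∀ x ∈ O, ∀ s ∈ Icc T T', ∀ s' ∈ Icc T T',
    ‖lieDeriv (fun y => f j y s) (fun y => f k y s) x
      - lieDeriv (fun y => f j y s') (fun y => f k y s') x‖ ≤ C * |s - s'|

/-- The constant of the remainder in the second order expansion over one period. -/
def expansionConst (m : ℕ) (C Q : ℝ) : ℝ :=
  m * (2 * Q * (m * (2 * Q * (C * (2 * m * Q + 1)) + Q * C) + C) + 2 * m * Q ^ 2 * C)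

lemma norm_sum_fin_le {F : Type*} [SeminormedAddCommGroup F] {m : ℕ} {g : Fin m → F} {c : ℝ}
    (h : ∀ k, ‖g k‖ ≤ c) : ‖∑ k, g k‖ ≤ m * c := by
  simpa using norm_sum_le_of_le Finset.univ (fun k _ => h k)

/-- Second order expansion over one period of the solutions of a driftless system whose controls
are the sum of a constant part and the derivative of a small periodic function. -/
lemma norm_expansion_le {n m : ℕ} {f : Fin m → E n → ℝ → E n} {O : Set (E n)} {T ε C Q : ℝ}
    (hε : 0 < ε) (hε1 : ε ≤ 1) (hC : 0 ≤ C) (hQ : 0 ≤ Q)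
    (hf : LocalFieldBounds f O T (T + ε) C)
    {b : Fin m → ℝ} {W W' : Fin m → ℝ → ℝ} (hW : ∀ l s, HasDerivAt (W l) (W' l s) s)
    (hW'c : ∀ l, Continuous (W' l)) (hb : ∀ l, |b l| ≤ Q) (hW'b : ∀ l s, |W' l s| ≤ Q / √ε)
    (hWb : ∀ l s, |W l s| ≤ Q * √ε) (hper : ∀ l, W l (T + ε) = W l T)
    {x : ℝ → E n} (hx : ContinuousOn x (Icc T (T + ε))) (hxO : ∀ s ∈ Icc T (T + ε), x s ∈ O)
    (hx' : ∀ s ∈ Ico T (T + ε),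
      HasDerivWithinAt x (∑ k, (b k + W' k s) • f k (x s) s) (Ici s) s) :
    ‖x (T + ε) - x T - ε • ∑ k, b k • f k (x T) T
      - ∑ k, ∑ l, (∫ s in T..T + ε, W' k s * W l s) •
          lieDeriv (fun y => f l y T) (fun y => f k y T) (x T)‖
      ≤ expansionConst m C Q * (ε * √ε) := by
  set α := √ε with hα
  have hα0 : 0 < α := Real.sqrt_pos.2 hε
  have hα1 : α ≤ 1 := by rw [hα]; exact Real.sqrt_le_one.2 hε1
  have hαε : α * α = ε := Real.mul_self_sqrt hε.le
  set T' := T + ε with hT'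
  have hTT' : T ∈ Icc T T' := ⟨le_rfl, by linarith⟩
  have hTT'' : T' ∈ Icc T T' := ⟨by linarith, le_rfl⟩
  have hsub : ∀ s ∈ Ico T T', s ∈ Icc T T' := fun s hs => ⟨hs.1, hs.2.le⟩
  have hu : ∀ k s, |b k + W' k s| ≤ 2 * Q / α := by
    intro k s
    have h1 := abs_add_le (b k) (W' k s)
    have h2 : Q ≤ Q / α := le_div_self hQ hα0 hα1
    have h3 : 2 * Q / α = Q / α + Q / α := by ring
    linarith [hb k, hW'b k s]
  have hWsub : ∀ l s, |W l s - W l T| ≤ 2 * Q * α := by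
    intro l s
    have h1 := abs_sub (W l s) (W l T)
    linarith [hWb l s, hWb l T]
  set h : Fin m → Fin m → E n → ℝ → E n := fun l k y s =>
    lieDeriv (fun y => f l y s) (fun y => f k y s) y with hh
  set C1 := C * (2 * m * Q + 1) with hC1
  have hC10 : 0 ≤ C1 := by positivity
  -- The speed is `O(ε ^ (-1/2))` over a time `ε`, so the Lie derivatives vary by `O(√ε)`.
  have step1 : ∀ l k, ∀ s ∈ Icc T T', ‖h l k (x s) s - h l k (x T) T‖ ≤ C1 * α := by
    intro l k s hs
    have h1 := norm_comp_sub_sub_le (B := O) (g := h l k)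
      (g' := fun s => fderiv ℝ (fun y => h l k y s) (x s)) (w := fun _ => 0) (w' := fun _ => 0)
      (C := m * (2 * Q / α * C) + C) hx hxO hx'
      (fun s hs => (hf.diff_lie l k s hs (x s) (hxO s hs)).hasFDerivAt)
      (hf.time_lie l k) continuousOn_const (fun s _ => hasDerivWithinAt_const _ _ _) rfl ?_ s hs
    · rw [sub_zero] at h1
      refine h1.trans ?_
      calc (m * (2 * Q / α * C) + C) * (s - T) ≤ (m * (2 * Q / α * C) + C) * ε := by
            have : s - T ≤ ε := by linarith [hs.2]
            gcongr
        _ = C * (2 * m * Q + α) * α := by rw [← hαε]; field_simp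
        _ ≤ C1 * α := by rw [hC1]; gcongr
    · intro s hs
      have hs' := hsub s hs
      gcongr
      rw [sub_zero, map_sum]
      refine norm_sum_fin_le fun k' => ?_
      rw [map_smul, norm_smul]
      gcongr
      · exact hu k' s
      · exact hf.lie_lie_le k' l k s hs' (x s) (hxO s hs')
  set C2 := m * (2 * Q * C1 + Q * C) + C with hC2
  have hC20 : 0 ≤ C2 := by positivity
  -- Subtracting the first order oscillation leaves a bounded derivative: the factor `ε ^ (-1/2)` of
  -- the controls meets the `√ε` of `step1`. Integration gives `O(ε)`.
  have step2 : ∀ k, ∀ s ∈ Icc T T',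
      ‖f k (x s) s - f k (x T) T - ∑ l, (W l s - W l T) • h l k (x T) T‖ ≤ C2 * ε := by
    intro k s hs
    have h1 := norm_comp_sub_sub_le (B := O) (g := f k)
      (g' := fun s => fderiv ℝ (fun y => f k y s) (x s))
      (w := fun s => ∑ l, (W l s - W l T) • h l k (x T) T)
      (w' := fun s => ∑ l, W' l s • h l k (x T) T)
      (C := C2) hx hxO hx'
      (fun s hs => (hf.diff k s hs (x s) (hxO s hs)).hasFDerivAt)
      (hf.time k) ?_ ?_ (by simp) ?_ s hs
    · refine h1.trans ?_
      have : s - T ≤ ε := by linarith [hs.2]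
      gcongr
    · refine continuousOn_finsetSum _ fun l _ => ?_
      have : Continuous (W l) := continuous_iff_continuousAt.2 fun s => (hW l s).continuousAt
      fun_prop
    · intro s _
      refine HasDerivWithinAt.fun_sum fun l _ => ?_
      exact (((hW l s).sub_const _).smul_const _).hasDerivWithinAt
    · intro s hs
      have hs' := hsub s hs
      rw [hC2]
      gcongr
      have h2 : fderiv ℝ (fun y => f k y s) (x s) (∑ k, (b k + W' k s) • f k (x s) s)
          - ∑ l, W' l s • h l k (x T) T
          = ∑ l, ((b l + W' l s) • (h l k (x s) s - h l k (x T) T) + b l • h l k (x T) T) := by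
        rw [map_sum, ← Finset.sum_sub_distrib]
        refine Finset.sum_congr rfl fun l _ => ?_
        rw [map_smul]
        change (b l + W' l s) • h l k (x s) s - _ = _
        module
      rw [h2]
      refine norm_sum_fin_le fun l => (norm_add_le _ _).trans ?_
      rw [norm_smul, norm_smul]
      have h3 : ‖b l + W' l s‖ * ‖h l k (x s) s - h l k (x T) T‖ ≤ 2 * Q / α * (C1 * α) := by
        gcongr
        · exact hu l s
        · exact step1 l k s hs'
      have h4 : ‖b l‖ * ‖h l k (x T) T‖ ≤ Q * C := by
        gcongr
        · exact hb l
        · exact hf.lie_le l k T hTT' _ (hxO T hTT')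
      have h5 : 2 * Q / α * (C1 * α) = 2 * Q * C1 := by field_simp
      linarith
  have hWc : ∀ l, Continuous (W l) := fun l =>
    continuous_iff_continuousAt.2 fun s => (hW l s).continuousAt
  have hJ : ∀ k l s, HasDerivAt (fun s => ∫ τ in T..s, W' k τ * (W l τ - W l T))
      (W' k s * (W l s - W l T)) s := by
    intro k l s
    have hc : Continuous fun τ => W' k τ * (W l τ - W l T) :=
      (hW'c k).mul ((hWc l).sub continuous_const)
    exact (hc.integral_hasStrictDerivAt T s).hasDerivAt
  -- The derivative of the remainder is a control of size `ε ^ (-1/2)` times the `O(ε)` of `step2`,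
  -- plus the bounded part `b` times `W`, which is `O(√ε)`. Both are `O(√ε)`, hence `O(ε ^ (3/2))`
  -- after integration.
  have step3 := norm_image_sub_le_of_norm_deriv_right_le_segment (a := T) (b := T')
    (f := fun s => x s - ∑ k, ((b k * (s - T) + (W k s - W k T)) • f k (x T) T
      + ∑ l, (∫ τ in T..s, W' k τ * (W l τ - W l T)) • h l k (x T) T))
    (f' := fun s => ∑ k, (b k + W' k s) • f k (x s) s - ∑ k, ((b k + W' k s) • f k (x T) T
      + ∑ l, (W' k s * (W l s - W l T)) • h l k (x T) T))
    (C := m * (2 * Q * C2 + 2 * m * Q ^ 2 * C) * α) ?_ ?_ ?_ T' hTT''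
  · have e1 : ∀ k l, ∫ τ in T..T', W' k τ * (W l τ - W l T) = ∫ τ in T..T', W' k τ * W l τ := by
      intro k l
      have h1 : ∫ τ in T..T', W' k τ = 0 := by
        rw [intervalIntegral.integral_eq_sub_of_hasDerivAt (fun s _ => hW k s)
          ((hW'c k).intervalIntegrable _ _), hper k, sub_self]
      have i1 : Continuous fun τ => W' k τ * W l τ := (hW'c k).mul (hWc l)
      have i2 : Continuous fun τ => W' k τ * W l T := (hW'c k).mul continuous_const
      simp_rw [mul_sub]
      rw [intervalIntegral.integral_sub (i1.intervalIntegrable _ _) (i2.intervalIntegrable _ _),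
        intervalIntegral.integral_mul_const, h1, zero_mul, sub_zero]
    have e2 : T' - T = ε := by rw [hT']; ring
    have e3 : expansionConst m C Q = m * (2 * Q * C2 + 2 * m * Q ^ 2 * C) := rfl
    rw [e2] at step3
    have e4 : ∀ k, W k T' - W k T = 0 := fun k => sub_eq_zero.2 (hper k)
    simp only [e1, e4, sub_self, mul_zero, add_zero, zero_smul, Finset.sum_const_zero,
      intervalIntegral.integral_same, Finset.sum_add_distrib, sub_zero] at step3
    rw [e3]
    have e5 : ∑ k, (b k * ε) • f k (x T) T = ε • ∑ k, b k • f k (x T) T := by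
      rw [Finset.smul_sum]; exact Finset.sum_congr rfl fun k _ => by rw [smul_smul, mul_comm]
    rw [e5] at step3
    calc _ = _ := by congr 1; abel
      _ ≤ _ := step3
      _ = _ := by ring
  · refine hx.sub (continuousOn_finsetSum _ fun k _ => ContinuousOn.add ?_ ?_)
    · have := hWc k
      fun_prop
    · refine continuousOn_finsetSum _ fun l _ => ?_
      have : Continuous fun s => ∫ τ in T..s, W' k τ * (W l τ - W l T) :=
        continuous_iff_continuousAt.2 fun s => (hJ k l s).continuousAt
      fun_prop
  · intro s hs
    refine (hx' s hs).sub (HasDerivWithinAt.fun_sum fun k _ => HasDerivWithinAt.add ?_ ?_)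
    · have h1 : HasDerivAt (fun s => b k * (s - T) + (W k s - W k T)) (b k + W' k s) s := by
        simpa using (((hasDerivAt_id' s).sub_const T).const_mul (b k)).fun_add
          ((hW k s).sub_const (W k T))
      exact (h1.smul_const _).hasDerivWithinAt
    · exact HasDerivWithinAt.fun_sum fun l _ => ((hJ k l s).smul_const _).hasDerivWithinAt
  · intro s hs
    have hs' := hsub s hs
    have h2 : ∑ k, (b k + W' k s) • f k (x s) s - ∑ k, ((b k + W' k s) • f k (x T) T
        + ∑ l, (W' k s * (W l s - W l T)) • h l k (x T) T)
        = ∑ k, ((b k + W' k s) • (f k (x s) s - f k (x T) T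
            - ∑ l, (W l s - W l T) • h l k (x T) T)
          + b k • ∑ l, (W l s - W l T) • h l k (x T) T) := by
      rw [← Finset.sum_sub_distrib]
      refine Finset.sum_congr rfl fun k _ => ?_
      have : ∑ l, (W' k s * (W l s - W l T)) • h l k (x T) T
          = W' k s • ∑ l, (W l s - W l T) • h l k (x T) T := by
        rw [Finset.smul_sum]; exact Finset.sum_congr rfl fun l _ => by rw [smul_smul]
      rw [this]
      module
    rw [h2, mul_assoc]
    refine norm_sum_fin_le fun k => (norm_add_le _ _).trans ?_
    rw [norm_smul, norm_smul]
    have h3 : ‖b k + W' k s‖ * ‖f k (x s) s - f k (x T) T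
        - ∑ l, (W l s - W l T) • h l k (x T) T‖ ≤ 2 * Q / α * (C2 * ε) := by
      gcongr
      · exact hu k s
      · exact step2 k s hs'
    have h4 : ‖b k‖ * ‖∑ l, (W l s - W l T) • h l k (x T) T‖ ≤ Q * (m * (2 * Q * α * C)) := by
      gcongr
      · exact hb k
      · refine norm_sum_fin_le fun l => ?_
        rw [norm_smul]
        gcongr
        · exact hWsub l s
        · exact hf.lie_le l k T hTT' _ (hxO T hTT')
    have h5 : 2 * Q / α * (C2 * ε) = 2 * Q * C2 * α := by rw [← hαε]; field_simp
    nlinarith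

/-! ### The oscillating controls generate motion along the brackets -/

section Controls

variable {n m : ℕ} {S₁ : Finset (Fin m)} {S₂ : Finset (Fin m × Fin m)} {κ : Fin m × Fin m → ℕ}

/-- The non-oscillating part of the controls. -/
def steadyControl (a : EuclideanSpace ℝ (Idx S₁ S₂)) (k : Fin m) : ℝ :=
  ∑ i : S₁, a (Sum.inl i) * (if k = (i : Fin m) then 1 else 0)

/-- The oscillating part of the controls. -/
def oscControl (κ : Fin m × Fin m → ℕ) (ε : ℝ) (a : EuclideanSpace ℝ (Idx S₁ S₂)) (k : Fin m)
    (t : ℝ) : ℝ :=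
  ε ^ (-(1 / 2) : ℝ) * ∑ p : S₂, √|a (Sum.inr p)| * dither κ ε (a (Sum.inr p)) p k t

/-- The periodic antiderivative of the oscillating part of the controls. -/
def oscPrimitive (κ : Fin m × Fin m → ℕ) (ε : ℝ) (a : EuclideanSpace ℝ (Idx S₁ S₂)) (k : Fin m)
    (t : ℝ) : ℝ :=
  ε ^ (-(1 / 2) : ℝ) * ∑ p : S₂, √|a (Sum.inr p)| * (2 * √(Real.pi * κ p) *
    (ε / (2 * Real.pi * κ p) *
    ((if k = (p : Fin m × Fin m).1 then 1 else 0) * Real.sign (a (Sum.inr p)) *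
        Real.sin (2 * Real.pi * κ p / ε * t)
      - (if k = (p : Fin m × Fin m).2 then 1 else 0) * Real.cos (2 * Real.pi * κ p / ε * t))))

/-- A bound for the amplitudes of the controls whose coefficients have norm at most `A`. -/
def controlConst (S₁ : Finset (Fin m)) (S₂ : Finset (Fin m × Fin m)) (κ : Fin m × Fin m → ℕ)
    (A : ℝ) : ℝ :=
  S₁.card * A + ∑ p : S₂, √A * (4 * √(Real.pi * κ p))

lemma controlConst_nonneg {A : ℝ} (hA : 0 ≤ A) : 0 ≤ controlConst S₁ S₂ κ A := by
  unfold controlConst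
  positivity

lemma control_eq (ε : ℝ) (a : EuclideanSpace ℝ (Idx S₁ S₂)) (t : ℝ) (k : Fin m) :
    control S₁ S₂ κ ε a t k = steadyControl a k + oscControl κ ε a k t := rfl

lemma rpow_neg_half {ε : ℝ} (hε : 0 < ε) : ε ^ (-(1 / 2) : ℝ) = 1 / √ε := by
  rw [Real.rpow_neg hε.le, Real.sqrt_eq_rpow, one_div (ε ^ _)]

lemma continuous_dither (ε ap : ℝ) (p : Fin m × Fin m) (k : Fin m) :
    Continuous (dither κ ε ap p k) := by
  unfold dither
  fun_prop

lemma continuous_oscControl (ε : ℝ) (a : EuclideanSpace ℝ (Idx S₁ S₂)) (k : Fin m) :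
    Continuous (oscControl κ ε a k) := by
  unfold oscControl
  have := fun (p : S₂) => continuous_dither (κ := κ) ε (a (Sum.inr p)) p k
  fun_prop

lemma hasDerivAt_oscPrimitive (hκ : ∀ p ∈ S₂, 0 < κ p) {ε : ℝ} (hε : 0 < ε)
    (a : EuclideanSpace ℝ (Idx S₁ S₂)) (k : Fin m) (t : ℝ) :
    HasDerivAt (oscPrimitive κ ε a k) (oscControl κ ε a k t) t := by
  unfold oscPrimitive oscControl dither
  refine (HasDerivAt.fun_sum fun p _ => ?_).const_mul _
  refine HasDerivAt.const_mul _ (HasDerivAt.const_mul _ ?_)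
  have hp : (0 : ℝ) < κ p := by exact_mod_cast hκ p p.2
  set c := 2 * Real.pi * κ p / ε with hc
  have hlin : HasDerivAt (fun t : ℝ => c * t) c t := by
    simpa using (hasDerivAt_id' t).const_mul c
  have h1 := (hlin.sin.const_mul
    ((if k = (p : Fin m × Fin m).1 then 1 else 0) * Real.sign (a (Sum.inr p)))).fun_sub
    (hlin.cos.const_mul (if k = (p : Fin m × Fin m).2 then (1 : ℝ) else 0))
  convert h1.const_mul (ε / (2 * Real.pi * κ p)) using 1
  have : ε / (2 * Real.pi * κ p) * c = 1 := by
    rw [hc]; field_simp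
  linear_combination (-((if k = (p : Fin m × Fin m).1 then 1 else 0) * Real.sign (a (Sum.inr p)) *
    Real.cos (c * t) + (if k = (p : Fin m × Fin m).2 then 1 else 0) * Real.sin (c * t))) * this

lemma oscPrimitive_periodic {ε : ℝ} (hε : 0 < ε)
    (a : EuclideanSpace ℝ (Idx S₁ S₂)) (k : Fin m) (T : ℝ) :
    oscPrimitive κ ε a k (T + ε) = oscPrimitive κ ε a k T := by
  unfold oscPrimitive
  congr 1
  refine Finset.sum_congr rfl fun p _ => ?_
  have : 2 * Real.pi * κ p / ε * (T + ε)
      = 2 * Real.pi * κ p / ε * T + κ p * (2 * Real.pi) := by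
    field_simp
  rw [this, Real.sin_add_nat_mul_two_pi, Real.cos_add_nat_mul_two_pi]

lemma abs_sign_le (x : ℝ) : |Real.sign x| ≤ 1 := by
  rcases Real.sign_apply_eq x with h | h | h <;> simp [h]

lemma abs_coord_le {ι : Type*} [Fintype ι] (a : EuclideanSpace ℝ ι) (i : ι) : |a i| ≤ ‖a‖ := by
  simpa using PiLp.norm_apply_le a i

lemma abs_steadyControl_le {a : EuclideanSpace ℝ (Idx S₁ S₂)} {A : ℝ} (ha : ‖a‖ ≤ A)
    (k : Fin m) : |steadyControl a k| ≤ controlConst S₁ S₂ κ A := by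
  have hA : 0 ≤ A := (norm_nonneg _).trans ha
  have h1 : |steadyControl a k| ≤ S₁.card * A := by
    unfold steadyControl
    refine (Finset.abs_sum_le_sum_abs _ _).trans ?_
    refine (Finset.sum_le_sum (g := fun _ => A) fun i _ => ?_).trans (by simp)
    split_ifs
    · rw [mul_one]; exact (abs_coord_le a _).trans ha
    · simpa using hA
  have h2 : 0 ≤ ∑ p : S₂, √A * (4 * √(Real.pi * κ p)) := by positivity
  unfold controlConst
  linarith

lemma abs_harmonic_le {k i j : Fin m} {s c d : ℝ} (hs : |s| ≤ 1) (hc : |c| ≤ 1) (hd : |d| ≤ 1) :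
    |(if k = i then 1 else 0) * s * c + (if k = j then 1 else 0) * d| ≤ 2 := by
  refine (abs_add_le _ _).trans ?_
  have h1 : |(if k = i then (1 : ℝ) else 0) * s * c| ≤ 1 := by
    split_ifs
    · rw [one_mul, abs_mul]; exact mul_le_one₀ hs (abs_nonneg _) hc
    · simp
  have h2 : |(if k = j then (1 : ℝ) else 0) * d| ≤ 1 := by
    split_ifs
    · simpa using hd
    · simp
  linarith

lemma abs_oscControl_le {a : EuclideanSpace ℝ (Idx S₁ S₂)} {A : ℝ} (ha : ‖a‖ ≤ A)
    {ε : ℝ} (hε : 0 < ε) (k : Fin m) (t : ℝ) :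
    |oscControl κ ε a k t| ≤ controlConst S₁ S₂ κ A / √ε := by
  have hA : 0 ≤ A := (norm_nonneg _).trans ha
  have h1 : |∑ p : S₂, √|a (Sum.inr p)| * dither κ ε (a (Sum.inr p)) p k t|
      ≤ ∑ p : S₂, √A * (4 * √(Real.pi * κ p)) := by
    refine (Finset.abs_sum_le_sum_abs _ _).trans (Finset.sum_le_sum fun p _ => ?_)
    rw [abs_mul, abs_of_nonneg (Real.sqrt_nonneg _)]
    gcongr
    · exact (abs_coord_le a _).trans ha
    · unfold dither
      rw [abs_mul, abs_of_nonneg (by positivity)]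
      have := abs_harmonic_le (k := k) (i := (p : Fin m × Fin m).1) (j := (p : Fin m × Fin m).2)
        (abs_sign_le (a (Sum.inr p))) (Real.abs_cos_le_one (2 * Real.pi * κ p / ε * t))
        (Real.abs_sin_le_one (2 * Real.pi * κ p / ε * t))
      have h2 : 0 ≤ √(Real.pi * κ p) := Real.sqrt_nonneg _
      nlinarith
  unfold oscControl
  rw [rpow_neg_half hε, abs_mul, abs_of_nonneg (by positivity), one_div, inv_mul_eq_div]
  unfold controlConst
  gcongr
  have : 0 ≤ (S₁.card : ℝ) * A := by positivity
  linarith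

lemma abs_oscPrimitive_le (hκ : ∀ p ∈ S₂, 0 < κ p) {a : EuclideanSpace ℝ (Idx S₁ S₂)} {A : ℝ}
    (ha : ‖a‖ ≤ A) {ε : ℝ} (hε : 0 < ε) (k : Fin m) (t : ℝ) :
    |oscPrimitive κ ε a k t| ≤ controlConst S₁ S₂ κ A * √ε := by
  have hA : 0 ≤ A := (norm_nonneg _).trans ha
  have h1 : ∀ p : S₂, |√|a (Sum.inr p)| * (2 * √(Real.pi * κ p) *
    (ε / (2 * Real.pi * κ p) *
    ((if k = (p : Fin m × Fin m).1 then 1 else 0) * Real.sign (a (Sum.inr p)) *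
        Real.sin (2 * Real.pi * κ p / ε * t)
      - (if k = (p : Fin m × Fin m).2 then 1 else 0) * Real.cos (2 * Real.pi * κ p / ε * t))))|
      ≤ √A * (4 * √(Real.pi * κ p)) * ε := by
    intro p
    have hp : (1 : ℝ) ≤ κ p := by exact_mod_cast hκ p p.2
    rw [abs_mul, abs_of_nonneg (Real.sqrt_nonneg _), mul_assoc (√A)]
    gcongr
    · exact (abs_coord_le a _).trans ha
    · rw [abs_mul, abs_mul (ε / _), abs_of_nonneg (by positivity),
        abs_of_nonneg (show 0 ≤ ε / (2 * Real.pi * κ p) by positivity)]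
      have h2 := abs_harmonic_le (k := k) (i := (p : Fin m × Fin m).1)
        (j := (p : Fin m × Fin m).2) (d := -Real.cos (2 * Real.pi * κ p / ε * t))
        (abs_sign_le (a (Sum.inr p))) (Real.abs_sin_le_one (2 * Real.pi * κ p / ε * t))
        (by rw [abs_neg]; exact Real.abs_cos_le_one (2 * Real.pi * κ p / ε * t))
      rw [mul_neg, ← sub_eq_add_neg] at h2
      have h3 : ε / (2 * Real.pi * κ p) ≤ ε := by
        apply div_le_self hε.le
        nlinarith [Real.two_le_pi]
      calc _ ≤ 2 * √(Real.pi * κ p) * (ε * 2) := by gcongr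
        _ = _ := by ring
  have h4 : |oscPrimitive κ ε a k t| ≤ 1 / √ε * ∑ p : S₂, √A * (4 * √(Real.pi * κ p)) * ε := by
    unfold oscPrimitive
    rw [rpow_neg_half hε, abs_mul, abs_of_nonneg (by positivity : 0 ≤ 1 / √ε)]
    gcongr
    exact (Finset.abs_sum_le_sum_abs _ _).trans (Finset.sum_le_sum fun p _ => h1 p)
  refine h4.trans ?_
  rw [← Finset.sum_mul]
  have h5 : 1 / √ε * ((∑ p : S₂, √A * (4 * √(Real.pi * κ p))) * ε)
      = (∑ p : S₂, √A * (4 * √(Real.pi * κ p))) * √ε := by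
    have h6 : √ε ≠ 0 := (Real.sqrt_pos.2 hε).ne'
    nth_rw 2 [← Real.mul_self_sqrt hε.le]
    field_simp
  rw [h5]
  unfold controlConst
  gcongr
  have : 0 ≤ (S₁.card : ℝ) * A := by positivity
  linarith

lemma abs_control_le {a : EuclideanSpace ℝ (Idx S₁ S₂)} {A : ℝ} (ha : ‖a‖ ≤ A)
    {ε : ℝ} (hε : 0 < ε) (hε1 : ε ≤ 1) (k : Fin m) (t : ℝ) :
    |control S₁ S₂ κ ε a t k| ≤ 2 * controlConst S₁ S₂ κ A / √ε := by
  have hQ : 0 ≤ controlConst S₁ S₂ κ A := controlConst_nonneg ((norm_nonneg _).trans ha)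
  rw [control_eq]
  refine (abs_add_le _ _).trans ?_
  have h1 := abs_steadyControl_le (κ := κ) ha k
  have h2 := abs_oscControl_le (κ := κ) ha hε k t
  have h3 := le_div_self hQ (Real.sqrt_pos.2 hε) (Real.sqrt_le_one.2 hε1)
  rw [two_mul, add_div]
  linarith

/-- Injectivity of `κ` on `S₂` removes the cross terms of the double sum. In a diagonal term only
the products of one cosine and one sine amplitude survive. This is antisymmetric in `k` and `l`, and
the sign carried by the cosine restores `a` from `|a|`. -/
lemma integral_oscControl_mul_oscPrimitive (hκ : ∀ p ∈ S₂, 0 < κ p)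
    (hκi : Set.InjOn κ (S₂ : Set (Fin m × Fin m))) {ε : ℝ} (hε : 0 < ε)
    (a : EuclideanSpace ℝ (Idx S₁ S₂)) (k l : Fin m) (T : ℝ) :
    ∫ s in T..T + ε, oscControl κ ε a k s * oscPrimitive κ ε a l s
      = ε * ∑ p : S₂, a (Sum.inr p) *
        ((if k = (p : Fin m × Fin m).2 then 1 else 0) * (if l = (p : Fin m × Fin m).1 then 1 else 0)
        - (if k = (p : Fin m × Fin m).1 then 1 else 0)
          * (if l = (p : Fin m × Fin m).2 then 1 else 0)) := by
  set A : Fin m → S₂ → ℝ := fun k p =>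
    (if k = (p : Fin m × Fin m).1 then 1 else 0) * Real.sign (a (Sum.inr p)) with hA
  set B : Fin m → S₂ → ℝ := fun k p => (if k = (p : Fin m × Fin m).2 then 1 else 0) with hB
  set c : S₂ → ℝ := fun p => √|a (Sum.inr p)| * (2 * √(Real.pi * κ p)) with hc
  set d : S₂ → ℝ := fun p => c p * (ε / (2 * Real.pi * κ p)) with hd
  have hprod : ∀ s, oscControl κ ε a k s * oscPrimitive κ ε a l s
      = ∑ p : S₂, ∑ q : S₂, (1 / ε * (c p * d q)) *
        ((A k p * Real.cos (2 * Real.pi * κ p / ε * s)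
          + B k p * Real.sin (2 * Real.pi * κ p / ε * s)) *
        (A l q * Real.sin (2 * Real.pi * κ q / ε * s)
          - B l q * Real.cos (2 * Real.pi * κ q / ε * s))) := by
    intro s
    unfold oscControl oscPrimitive dither
    rw [rpow_neg_half hε, mul_mul_mul_comm, Finset.sum_mul_sum, div_mul_div_comm,
      Real.mul_self_sqrt hε.le, one_mul, Finset.mul_sum]
    refine Finset.sum_congr rfl fun p _ => ?_
    rw [Finset.mul_sum]
    refine Finset.sum_congr rfl fun q _ => ?_
    simp only [hA, hB, hc, hd]
    ring
  simp_rw [hprod]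
  rw [intervalIntegral.integral_finsetSum
    (fun p _ => Continuous.intervalIntegrable (by fun_prop) _ _), Finset.mul_sum]
  refine Finset.sum_congr rfl fun p _ => ?_
  rw [intervalIntegral.integral_finsetSum
    (fun p _ => Continuous.intervalIntegrable (by fun_prop) _ _)]
  have hpos : ∀ p : S₂, 0 < κ p := fun p => hκ p p.2
  simp_rw [intervalIntegral.integral_const_mul, integral_harmonics hε T (hpos _) (hpos _)]
  rw [Finset.sum_eq_single p]
  · rw [if_pos rfl]
    have hp : (0 : ℝ) < κ p := by exact_mod_cast hpos p
    -- The amplitude `2√(πκ|a|)` is normalised so that `κ` and `π` cancel here.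
    have hcd : c p * d p = 2 * ε * |a (Sum.inr p)| := by
      have h1 : √|a (Sum.inr p)| * √|a (Sum.inr p)| = |a (Sum.inr p)| :=
        Real.mul_self_sqrt (abs_nonneg _)
      have h2 : √(Real.pi * κ p) * √(Real.pi * κ p) = Real.pi * κ p :=
        Real.mul_self_sqrt (by positivity)
      calc c p * d p = (√|a (Sum.inr p)| * √|a (Sum.inr p)|) *
            (√(Real.pi * κ p) * √(Real.pi * κ p)) * 4 * (ε / (2 * Real.pi * κ p)) := by
              simp only [hd, hc]; ring
        _ = _ := by rw [h1, h2]; field_simp; ring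
    have hs : |a (Sum.inr p)| * Real.sign (a (Sum.inr p)) = a (Sum.inr p) := by
      rcases lt_trichotomy (a (Sum.inr p)) 0 with h | h | h
      · rw [Real.sign_of_neg h, abs_of_neg h]; ring
      · rw [h]; simp
      · rw [Real.sign_of_pos h, abs_of_pos h, mul_one]
    have h3 : 1 / ε * (2 * ε * |a (Sum.inr p)|) = 2 * |a (Sum.inr p)| := by field_simp
    rw [hcd, h3]
    simp only [hA, hB]
    linear_combination ε * ((if k = (p : Fin m × Fin m).2 then 1 else 0) *
      (if l = (p : Fin m × Fin m).1 then 1 else 0) - (if k = (p : Fin m × Fin m).1 then 1 else 0)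
          * (if l = (p : Fin m × Fin m).2 then 1 else 0)) * hs
  · intro q _ hqp
    rw [if_neg, mul_zero]
    intro h
    exact hqp (Subtype.ext (hκi q.2 p.2 h.symm))
  · simp

lemma frame_apply (f : Fin m → E n → ℝ → E n) (x : E n) (t : ℝ)
    (a : EuclideanSpace ℝ (Idx S₁ S₂)) :
    frame f S₁ S₂ x t a = ∑ i : S₁, a (Sum.inl i) • f i x t
      + ∑ p : S₂, a (Sum.inr p) • bracket f p.1.1 p.1.2 x t := by
  simp [frame]

/-- For each pair `(j₁, j₂)` the integrals contribute `a` at `(k, l) = (j₂, j₁)` and `-a` at `(j₁,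
j₂)`, so the two Lie derivatives combine to the bracket. The steady part supplies the columns from
`S₁`. -/
lemma sum_integral_smul_lieDeriv (hκ : ∀ p ∈ S₂, 0 < κ p)
    (hκi : Set.InjOn κ (S₂ : Set (Fin m × Fin m))) {ε : ℝ} (hε : 0 < ε)
    (a : EuclideanSpace ℝ (Idx S₁ S₂)) (f : Fin m → E n → ℝ → E n) (x : E n) (T : ℝ) :
    ε • ∑ k, steadyControl a k • f k x T
      + ∑ k, ∑ l, (∫ s in T..T + ε, oscControl κ ε a k s * oscPrimitive κ ε a l s) •
        lieDeriv (fun y => f l y T) (fun y => f k y T) x = ε • frame f S₁ S₂ x T a := by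
  rw [frame_apply, smul_add]
  congr 1
  · congr 1
    unfold steadyControl
    simp_rw [Finset.sum_smul]
    rw [Finset.sum_comm]
    simp
  · simp_rw [integral_oscControl_mul_oscPrimitive hκ hκi hε, mul_smul, Finset.sum_smul,
      ← Finset.smul_sum]
    congr 1
    have h1 : ∀ k : Fin m, ∑ l, ∑ p : S₂, (a (Sum.inr p) *
        ((if k = (p : Fin m × Fin m).2 then 1 else 0) * (if l = (p : Fin m × Fin m).1 then 1 else 0)
        - (if k = (p : Fin m × Fin m).1 then 1 else 0)
          * (if l = (p : Fin m × Fin m).2 then (1 : ℝ) else 0))) •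
          lieDeriv (fun y => f l y T) (fun y => f k y T) x
        = ∑ p : S₂, ((a (Sum.inr p) * (if k = (p : Fin m × Fin m).2 then 1 else 0)) •
            lieDeriv (fun y => f (p : Fin m × Fin m).1 y T) (fun y => f k y T) x
          - (a (Sum.inr p) * (if k = (p : Fin m × Fin m).1 then 1 else 0)) •
            lieDeriv (fun y => f (p : Fin m × Fin m).2 y T) (fun y => f k y T) x) := by
      intro k
      rw [Finset.sum_comm]
      refine Finset.sum_congr rfl fun p _ => ?_
      simp [mul_sub, sub_smul, Finset.sum_sub_distrib]
    simp_rw [h1]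
    rw [Finset.sum_comm]
    refine Finset.sum_congr rfl fun p _ => ?_
    simp [bracket, smul_sub, Finset.sum_sub_distrib]

/-- Over one period, the controls realise the motion along the frame up to order `ε ^ (3/2)`. -/
lemma norm_period_sub_frame_le {f : Fin m → E n → ℝ → E n} {O : Set (E n)} {T ε C A : ℝ}
    (hκ : ∀ p ∈ S₂, 0 < κ p) (hκi : Set.InjOn κ (S₂ : Set (Fin m × Fin m)))
    (hε : 0 < ε) (hε1 : ε ≤ 1) (hC : 0 ≤ C)
    (hf : LocalFieldBounds f O T (T + ε) C) {a : EuclideanSpace ℝ (Idx S₁ S₂)} (ha : ‖a‖ ≤ A)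
    {x : ℝ → E n} (hx : ContinuousOn x (Icc T (T + ε))) (hxO : ∀ s ∈ Icc T (T + ε), x s ∈ O)
    (hx' : ∀ s ∈ Ico T (T + ε),
      HasDerivWithinAt x (controlSystem f (x s) (control S₁ S₂ κ ε a s) s) (Ici s) s) :
    ‖x (T + ε) - x T - ε • frame f S₁ S₂ (x T) T a‖
      ≤ expansionConst m C (controlConst S₁ S₂ κ A) * (ε * √ε) := by
  have h := norm_expansion_le hε hε1 hC
    (controlConst_nonneg (S₁ := S₁) (S₂ := S₂) (κ := κ) ((norm_nonneg _).trans ha)) hf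
    (b := steadyControl a) (W := oscPrimitive κ ε a) (W' := oscControl κ ε a)
    (fun l s => hasDerivAt_oscPrimitive hκ hε a l s) (continuous_oscControl ε a)
    (abs_steadyControl_le ha) (abs_oscControl_le ha hε) (abs_oscPrimitive_le hκ ha hε)
    (fun l => oscPrimitive_periodic hε a l T) hx hxO hx'
  rwa [sub_sub _ (ε • _), sum_integral_smul_lieDeriv hκ hκi hε] at h

end Controls

/-! ### One sampling period of the closed loop -/

section Period

variable {n m : ℕ} {S₁ : Finset (Fin m)} {S₂ : Finset (Fin m × Fin m)} {κ : Fin m × Fin m → ℕ}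
  {f : Fin m → E n → ℝ → E n} {P : E n → ℝ → ℝ}

/-- `ContinuousLinearMap.inverse` is a genuine inverse only for invertible maps. The columns span,
and their number equals `n`, so the frame is bijective. -/
lemma frame_inverse_apply {x : E n} {t : ℝ} (hcard : S₁.card + S₂.card = n)
    (hspan : Submodule.span ℝ ({v | ∃ i ∈ S₁, v = f i x t} ∪
      {v | ∃ p ∈ S₂, v = bracket f p.1 p.2 x t}) = ⊤) (v : E n) :
    frame f S₁ S₂ x t ((frame f S₁ S₂ x t).inverse v) = v := by
  have hrange : (frame f S₁ S₂ x t : EuclideanSpace ℝ (Idx S₁ S₂) →ₗ[ℝ] E n).range = ⊤ := by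
    rw [eq_top_iff, ← hspan, Submodule.span_le]
    rintro w (⟨i, hi, rfl⟩ | ⟨p, hp, rfl⟩)
    · refine ⟨EuclideanSpace.single (Sum.inl ⟨i, hi⟩) 1, ?_⟩
      change frame f S₁ S₂ x t _ = _
      rw [frame_apply]
      simp
    · refine ⟨EuclideanSpace.single (Sum.inr ⟨p, hp⟩) 1, ?_⟩
      change frame f S₁ S₂ x t _ = _
      rw [frame_apply]
      simp
  have hdim : Module.finrank ℝ (EuclideanSpace ℝ (Idx S₁ S₂)) = Module.finrank ℝ (E n) := by
    simp [hcard]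
  have hker : (frame f S₁ S₂ x t : EuclideanSpace ℝ (Idx S₁ S₂) →ₗ[ℝ] E n).ker = ⊥ :=
    LinearMap.ker_eq_bot.2 ((LinearMap.injective_iff_surjective_of_finrank_eq_finrank hdim).2
      (LinearMap.range_eq_top.1 hrange))
  have h := ContinuousLinearEquiv.coe_ofBijective (frame f S₁ S₂ x t) hker hrange
  rw [← h, ContinuousLinearMap.inverse_equiv]
  simp

/-- The bound for the distance covered within a period, divided by `√ε`. -/
def travelConst (m : ℕ) (C Q : ℝ) : ℝ := m * (2 * Q * C)

lemma norm_controlSystem_le {O : Set (E n)} {T T' C A ε : ℝ}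
    (hf : LocalFieldBounds f O T T' C) {a : EuclideanSpace ℝ (Idx S₁ S₂)} (ha : ‖a‖ ≤ A)
    (hε : 0 < ε) (hε1 : ε ≤ 1) {s : ℝ} (hs : s ∈ Icc T T') {y : E n} (hy : y ∈ O) :
    ‖controlSystem f y (control S₁ S₂ κ ε a s) s‖
      ≤ travelConst m C (controlConst S₁ S₂ κ A) / √ε := by
  unfold controlSystem travelConst
  rw [mul_div_assoc]
  refine norm_sum_fin_le fun k => ?_
  rw [norm_smul, mul_div_right_comm]
  have := controlConst_nonneg (S₁ := S₁) (S₂ := S₂) (κ := κ) ((norm_nonneg _).trans ha)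
  gcongr
  · exact abs_control_le ha hε hε1 k s
  · exact hf.norm_le k s hs y hy

lemma lipschitzOnWith_controlSystem {O : Set (E n)} {T T' C A ε : ℝ} (hC : 0 ≤ C)
    (hf : LocalFieldBounds f O T T' C) {a : EuclideanSpace ℝ (Idx S₁ S₂)} (ha : ‖a‖ ≤ A)
    (hε : 0 < ε) (hε1 : ε ≤ 1) {s : ℝ} (hs : s ∈ Icc T T') :
    LipschitzOnWith (Real.toNNReal (m * (2 * controlConst S₁ S₂ κ A / √ε * C)))
      (fun y => controlSystem f y (control S₁ S₂ κ ε a s) s) O := by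
  have hQ := controlConst_nonneg (S₁ := S₁) (S₂ := S₂) (κ := κ) ((norm_nonneg _).trans ha)
  refine LipschitzOnWith.of_dist_le_mul fun y hy z hz => ?_
  rw [dist_eq_norm, dist_eq_norm, Real.coe_toNNReal _ (by positivity)]
  simp only [controlSystem]
  rw [← Finset.sum_sub_distrib, mul_assoc]
  refine norm_sum_fin_le fun k => ?_
  rw [← smul_sub, norm_smul, mul_assoc]
  gcongr
  · exact abs_control_le ha hε hε1 k s
  · exact hf.lip k s hs y hy z hz

lemma travelConst_nonneg {C A : ℝ} (hC : 0 ≤ C) (hA : 0 ≤ A) :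
    0 ≤ travelConst m C (controlConst S₁ S₂ κ A) := by
  have := controlConst_nonneg (S₁ := S₁) (S₂ := S₂) (κ := κ) hA
  unfold travelConst
  positivity

lemma div_sqrt_mul_self {M ε : ℝ} (hε : 0 < ε) : M / √ε * ε = M * √ε := by
  have h6 : √ε ≠ 0 := (Real.sqrt_pos.2 hε).ne'
  nth_rw 2 [← Real.mul_self_sqrt hε.le]
  field_simp

/-- Solutions stay close to the initial position during one period. -/
lemma period_confined {ξ : E n} {T C A ε r : ℝ} (hC : 0 ≤ C)
    (hf : LocalFieldBounds f (Metric.ball ξ r) T (T + ε) C)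
    {a : EuclideanSpace ℝ (Idx S₁ S₂)} (ha : ‖a‖ ≤ A) (hε : 0 < ε) (hε1 : ε ≤ 1)
    (hr : travelConst m C (controlConst S₁ S₂ κ A) * √ε < r)
    {x : ℝ → E n} (hxT : x T = ξ) (hx : ContinuousOn x (Icc T (T + ε)))
    (hx' : ∀ s ∈ Ico T (T + ε),
      HasDerivWithinAt x (controlSystem f (x s) (control S₁ S₂ κ ε a s) s) (Ici s) s) :
    ∀ s ∈ Icc T (T + ε),
      ‖x s - ξ‖ ≤ travelConst m C (controlConst S₁ S₂ κ A) * √ε := by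
  intro s hs
  have hM := travelConst_nonneg (m := m) (S₁ := S₁) (S₂ := S₂) (κ := κ) hC
    ((norm_nonneg _).trans ha)
  have h := norm_sub_le_of_speed_le (M := travelConst m C (controlConst S₁ S₂ κ A) / √ε)
    (r := r) (T := T) (T' := T + ε) (x := x)
    (by rw [add_sub_cancel_left, div_sqrt_mul_self hε]; exact hr) (by positivity) hx hx'
    (fun s hs hsr => norm_controlSystem_le hf ha hε hε1 ⟨hs.1, hs.2.le⟩
      (by rwa [mem_ball_iff_norm, ← hxT])) s hs
  rw [hxT] at h
  refine h.trans ?_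
  rw [← div_sqrt_mul_self hε]
  have : s - T ≤ ε := by linarith [hs.2]
  gcongr

/-- A speed `M / √ε` during a time `ε` covers `M √ε ≤ r / 2`. Picard–Lindelöf therefore applies on
the closed half ball, inside the open ball where the field bounds hold. -/
lemma period_exists {ξ : E n} {T C A ε r : ℝ} (hC : 0 ≤ C) (hr0 : 0 < r)
    (hf : LocalFieldBounds f (Metric.ball ξ r) T (T + ε) C)
    {a : EuclideanSpace ℝ (Idx S₁ S₂)} (ha : ‖a‖ ≤ A) (hε : 0 < ε) (hε1 : ε ≤ 1)
    (hr : travelConst m C (controlConst S₁ S₂ κ A) * √ε ≤ r / 2) :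
    ∃ x : ℝ → E n, x T = ξ ∧ ∀ s ∈ Icc T (T + ε),
      HasDerivWithinAt x (controlSystem f (x s) (control S₁ S₂ κ ε a s) s) (Icc T (T + ε)) s := by
  have hA : 0 ≤ A := (norm_nonneg _).trans ha
  have hM := travelConst_nonneg (m := m) (S₁ := S₁) (S₂ := S₂) (κ := κ) hC hA
  have hQ := controlConst_nonneg (S₁ := S₁) (S₂ := S₂) (κ := κ) hA
  have hsub : Metric.closedBall ξ (r / 2) ⊆ Metric.ball ξ r :=
    Metric.closedBall_subset_ball (by linarith)
  have hPL : IsPicardLindelof (fun s y => controlSystem f y (control S₁ S₂ κ ε a s) s)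
      (tmin := T) (tmax := T + ε) ⟨T, le_rfl, by linarith⟩ ξ
      (Real.toNNReal (r / 2)) 0
      (Real.toNNReal (travelConst m C (controlConst S₁ S₂ κ A) / √ε))
      (Real.toNNReal (m * (2 * controlConst S₁ S₂ κ A / √ε * C))) := by
    have hr2 : ((Real.toNNReal (r / 2) : NNReal) : ℝ) = r / 2 :=
      Real.coe_toNNReal _ (by positivity)
    refine ⟨?_, ?_, ?_, ?_⟩
    · intro s hs
      refine (lipschitzOnWith_controlSystem hC hf ha hε hε1 hs).mono ?_
      rw [hr2]
      exact hsub
    · intro y hy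
      rw [hr2] at hy
      unfold controlSystem
      refine continuousOn_finsetSum _ fun k _ => ContinuousOn.fun_smul ?_ ?_
      · have := continuous_oscControl (κ := κ) ε a k
        simp_rw [control_eq]
        fun_prop
      · have : LipschitzOnWith ⟨C, hC⟩ (fun s => f k y s) (Icc T (T + ε)) :=
          LipschitzOnWith.of_dist_le_mul fun s hs s' hs' => by
            rw [dist_eq_norm, Real.dist_eq]
            exact hf.time k y (hsub hy) s hs s' hs'
        exact this.continuousOn
    · intro s hs y hy
      rw [hr2] at hy
      rw [Real.coe_toNNReal _ (by positivity)]
      exact norm_controlSystem_le hf ha hε hε1 hs (hsub hy)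
    · simp only [add_sub_cancel_left, sub_self, NNReal.coe_zero, sub_zero]
      rw [hr2, Real.coe_toNNReal _ (by positivity), max_eq_left hε.le, div_sqrt_mul_self hε]
      exact hr
  obtain ⟨x, hx0, hx⟩ := hPL.exists_eq_forall_mem_Icc_hasDerivWithinAt
    (x := ξ) (by simp)
  exact ⟨x, hx0, hx⟩

/-- Both curves are confined to the ball, where the right-hand side is Lipschitz, so Grönwall
uniqueness applies; no a priori bound on the curves is assumed. -/
lemma period_unique {ξ : E n} {T C A ε r : ℝ} (hC : 0 ≤ C)
    (hf : LocalFieldBounds f (Metric.ball ξ r) T (T + ε) C)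
    {a : EuclideanSpace ℝ (Idx S₁ S₂)} (ha : ‖a‖ ≤ A) (hε : 0 < ε) (hε1 : ε ≤ 1)
    (hr : travelConst m C (controlConst S₁ S₂ κ A) * √ε < r)
    {x y : ℝ → E n} (hxT : x T = ξ) (hx : ContinuousOn x (Icc T (T + ε)))
    (hx' : ∀ s ∈ Ico T (T + ε),
      HasDerivWithinAt x (controlSystem f (x s) (control S₁ S₂ κ ε a s) s) (Ici s) s)
    (hyT : y T = ξ) (hy : ContinuousOn y (Icc T (T + ε)))
    (hy' : ∀ s ∈ Ico T (T + ε),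
      HasDerivWithinAt y (controlSystem f (y s) (control S₁ S₂ κ ε a s) s) (Ici s) s) :
    EqOn x y (Icc T (T + ε)) := by
  have hA : 0 ≤ A := (norm_nonneg _).trans ha
  have hQ := controlConst_nonneg (S₁ := S₁) (S₂ := S₂) (κ := κ) hA
  refine ODE_solution_unique_of_mem_Icc_right
    (v := fun s y => controlSystem f y (control S₁ S₂ κ ε a s) s)
    (s := fun _ => Metric.ball ξ r)
    (K := Real.toNNReal (m * (2 * controlConst S₁ S₂ κ A / √ε * C))) ?_ hx hx' ?_ hy hy' ?_
    (hxT.trans hyT.symm)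
  · intro s hs
    exact lipschitzOnWith_controlSystem hC hf ha hε hε1 ⟨hs.1, hs.2.le⟩
  · intro s hs
    rw [mem_ball_iff_norm]
    exact (period_confined hC hf ha hε hε1 hr hxT hx hx' s ⟨hs.1, hs.2.le⟩).trans_lt hr
  · intro s hs
    rw [mem_ball_iff_norm]
    exact (period_confined hC hf ha hε hε1 hr hyT hy hy' s ⟨hs.1, hs.2.le⟩).trans_lt hr

/-- Bounds on the potential, uniform on a set `O` of positions during a time window. -/
structure LocalPotentialBounds (P : E n → ℝ → ℝ) (O : Set (E n)) (T T' C : ℝ) : Prop where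
  diff : ∀ x ∈ O, DifferentiableAt ℝ (fun y => P y T) x
  grad_le : ∀ x ∈ O, ‖gradX P x T‖ ≤ C
  lip : ∀ x ∈ O, ∀ y ∈ O, ∀ s ∈ Icc T T', |P x s - P y T| ≤ C * ‖x - y‖ + C * |s - T|
  grad_lip : ∀ x ∈ O, ∀ y ∈ O, ‖gradX P x T - gradX P y T‖ ≤ C * ‖x - y‖

/-- The constant of the error term in the descent of the potential over one period. -/
def descentConst (C E γ : ℝ) : ℝ := C * E + C * (γ * C + E) ^ 2

/-- A gradient step with a perturbation of order `ε ^ (3/2)`: the Lipschitz gradient gives a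
quadratic Taylor remainder `O(ε ^ 2)`. Evaluating `P` at the later time costs `C ε`, the one error
that does not become small relative to `ε`. -/
lemma potential_descent {ξ x₁ : E n} {T C K γ ε r : ℝ} (hC : 0 ≤ C) (hγ : 0 ≤ γ) (hK : 0 ≤ K)
    (hε : 0 < ε) (hε1 : ε ≤ 1)
    (hP : LocalPotentialBounds P (Metric.ball ξ r) T (T + ε) C) (hx₁ : x₁ ∈ Metric.ball ξ r)
    (h : ‖x₁ - ξ + (ε * γ) • gradX P ξ T‖ ≤ K * (ε * √ε)) :
    P x₁ (T + ε) ≤ P ξ T - ε * γ * ‖gradX P ξ T‖ ^ 2 + ε * (C + descentConst C K γ * √ε) := by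
  have hr : 0 < r := Metric.pos_of_mem_ball hx₁
  have hξ : ξ ∈ Metric.ball ξ r := Metric.mem_ball_self hr
  set g := gradX P ξ T with hg
  have hgC : ‖g‖ ≤ C := hP.grad_le ξ hξ
  have hα : √ε ≤ 1 := Real.sqrt_le_one.2 hε1
  have hα0 : 0 ≤ √ε := Real.sqrt_nonneg _
  have h1 : P x₁ (T + ε) ≤ P x₁ T + C * ε := by
    have := hP.lip x₁ hx₁ x₁ hx₁ (T + ε) ⟨by linarith, le_rfl⟩
    rw [sub_self, norm_zero, mul_zero, zero_add, add_sub_cancel_left, abs_of_pos hε] at this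
    linarith [le_abs_self (P x₁ (T + ε) - P x₁ T)]
  have hseg : segment ℝ ξ x₁ ⊆ Metric.ball ξ r := (convex_ball ξ r).segment_subset hξ hx₁
  -- Mean value inequality for `P` minus its linear part on the segment, where the gradient differs
  -- from `g` by at most `C * ‖x₁ - ξ‖`.
  have h2 : |P x₁ T - P ξ T - inner ℝ g (x₁ - ξ)| ≤ C * ‖x₁ - ξ‖ * ‖x₁ - ξ‖ := by
    refine Convex.norm_image_sub_le_of_norm_hasFDerivWithin_le' (f := fun y => P y T)
      (s := segment ℝ ξ x₁) (φ := InnerProductSpace.toDual ℝ (E n) g)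
      (f' := fun y => InnerProductSpace.toDual ℝ (E n) (gradX P y T)) ?_ ?_
      (convex_segment ξ x₁) (left_mem_segment ℝ ξ x₁) (right_mem_segment ℝ ξ x₁)
    · intro y hy
      exact ((hP.diff y (hseg hy)).hasGradientAt).hasFDerivAt.hasFDerivWithinAt
    · intro y hy
      rw [← map_sub, LinearIsometryEquiv.norm_map]
      refine (hP.grad_lip y (hseg hy) ξ hξ).trans ?_
      gcongr
      rw [← dist_eq_norm, ← dist_eq_norm, dist_comm y, dist_comm x₁]
      have := dist_add_dist_of_mem_segment hy
      linarith [dist_nonneg (x := y) (y := x₁)]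
  set R := x₁ - ξ + (ε * γ) • g with hR
  have h3 : x₁ - ξ = R - (ε * γ) • g := by rw [hR]; abel
  have h4 : inner ℝ g (x₁ - ξ) ≤ C * (K * (ε * √ε)) - ε * γ * ‖g‖ ^ 2 := by
    rw [h3, inner_sub_right, inner_smul_right, real_inner_self_eq_norm_sq]
    have := (real_inner_le_norm g R).trans (mul_le_mul hgC h (norm_nonneg _) hC)
    linarith
  have h5 : ‖x₁ - ξ‖ ≤ ε * (γ * C + K) := by
    rw [h3]
    refine (norm_sub_le _ _).trans ?_
    rw [norm_smul, Real.norm_of_nonneg (by positivity)]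
    have e1 : ε * γ * ‖g‖ ≤ ε * γ * C := by gcongr
    have e2 : K * (ε * √ε) ≤ K * (ε * 1) := by gcongr
    linarith
  have h6 : C * ‖x₁ - ξ‖ * ‖x₁ - ξ‖ ≤ ε * (C * (γ * C + K) ^ 2 * √ε) := by
    calc C * ‖x₁ - ξ‖ * ‖x₁ - ξ‖ ≤ C * (ε * (γ * C + K)) * (ε * (γ * C + K)) := by gcongr
      _ = ε * (C * (γ * C + K) ^ 2 * ε) := by ring
      _ ≤ _ := by
        gcongr
        nth_rw 1 [← Real.mul_self_sqrt hε.le]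
        nlinarith
  have h7 := le_abs_self (P x₁ T - P ξ T - inner ℝ g (x₁ - ξ))
  unfold descentConst
  nlinarith

/-- The descent of the potential over one period of the closed-loop system. -/
lemma period_descent (hκ : ∀ p ∈ S₂, 0 < κ p) (hκi : Set.InjOn κ (S₂ : Set (Fin m × Fin m)))
    (hcard : S₁.card + S₂.card = n) {ξ : E n} {T C A γ ε r : ℝ}
    (hspan : Submodule.span ℝ ({v | ∃ i ∈ S₁, v = f i ξ T} ∪
      {v | ∃ p ∈ S₂, v = bracket f p.1 p.2 ξ T}) = ⊤)
    (hC : 0 ≤ C) (hγ : 0 ≤ γ)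
    (hf : LocalFieldBounds f (Metric.ball ξ r) T (T + ε) C)
    (hP : LocalPotentialBounds P (Metric.ball ξ r) T (T + ε) C)
    (ha : ‖coeff f S₁ S₂ P γ ξ T‖ ≤ A) (hε : 0 < ε) (hε1 : ε ≤ 1)
    (hr : travelConst m C (controlConst S₁ S₂ κ A) * √ε < r)
    {x : ℝ → E n} (hxT : x T = ξ) (hx : ContinuousOn x (Icc T (T + ε)))
    (hx' : ∀ s ∈ Ico T (T + ε), HasDerivWithinAt x
      (controlSystem f (x s) (control S₁ S₂ κ ε (coeff f S₁ S₂ P γ ξ T) s) s) (Ici s) s) :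
    P (x (T + ε)) (T + ε) ≤ P ξ T - ε * γ * ‖gradX P ξ T‖ ^ 2
      + ε * (C + descentConst C (expansionConst m C (controlConst S₁ S₂ κ A)) γ * √ε) := by
  have hA : 0 ≤ A := (norm_nonneg _).trans ha
  have hQ := controlConst_nonneg (S₁ := S₁) (S₂ := S₂) (κ := κ) hA
  have hxO : ∀ s ∈ Icc T (T + ε), x s ∈ Metric.ball ξ r := by
    intro s hs
    rw [mem_ball_iff_norm]
    exact (period_confined hC hf ha hε hε1 hr hxT hx hx' s hs).trans_lt hr
  have h1 := norm_period_sub_frame_le hκ hκi hε hε1 hC hf ha hx hxO hx'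
  refine potential_descent hC hγ ?_ hε hε1 hP (hxO _ ⟨by linarith, le_rfl⟩) ?_
  · unfold expansionConst
    positivity
  · rw [hxT] at h1
    have h2 : frame f S₁ S₂ ξ T (coeff f S₁ S₂ P γ ξ T) = -(γ • gradX P ξ T) := by
      unfold coeff
      rw [map_neg, map_smul, frame_inverse_apply hcard hspan]
    rwa [h2, smul_neg, sub_neg_eq_add, smul_smul] at h1

end Period

/-! ### Moving compact sets with uniform constants -/

section Families

variable {n : ℕ} {D : Set (E n)} {xs : ℝ → E n} {P : E n → ℝ → ℝ}

/-- If the gradient is bounded on a compact sublevel set, then this set contains a uniform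
neighbourhood of every smaller sublevel set. -/
lemma thickening_sublevel_subset (hD : IsOpen D) {t c c' L : ℝ} (hL : 0 ≤ L) (hcc : c < c')
    (hdiff : ∀ x ∈ D, DifferentiableAt ℝ (fun y => P y t) x)
    (hcomp : IsCompact (sublevel D P t c'))
    (hgrad : ∀ x ∈ sublevel D P t c', ‖gradX P x t‖ ≤ L) :
    Metric.thickening ((c' - c) / (L + 1)) (sublevel D P t c) ⊆ sublevel D P t c' := by
  intro w hw
  obtain ⟨z, hz, hwz⟩ := Metric.mem_thickening_iff.1 hw
  rw [dist_eq_norm] at hwz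
  rcases eq_or_ne w z with rfl | hne
  · exact ⟨hz.1, hz.2.trans hcc.le⟩
  have hd : 0 < ‖w - z‖ := norm_pos_iff.2 (sub_ne_zero.2 hne)
  set d := ‖w - z‖ with hd_def
  have hLd : (L + 1) * d < c' - c := by
    rw [lt_div_iff₀ (by positivity)] at hwz; linarith
  set g : ℝ → E n := fun s => z + s • (w - z) with hg
  have hgc : Continuous g := by fun_prop
  -- Continuous induction along the segment from `z` to `w`. Growth at rate at most `(L + 1) d`
  -- keeps `P` strictly below `c'`, so the path can be prolonged, while compactness of the
  -- `c'`-sublevel prevents escape from `D` in the limit.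
  set B : Set ℝ := g ⁻¹' (sublevel D P t c') ∩
    (fun s => P (g s) t - (L + 1) * s * d) ⁻¹' (Iic (P z t)) with hB
  have hBcl : IsClosed B := by
    refine ContinuousOn.preimage_isClosed_of_isClosed ?_ (hcomp.isClosed.preimage hgc) isClosed_Iic
    intro s hs
    have h1 : ContinuousAt (fun s => P (g s) t) s :=
      ContinuousAt.comp (f := g) (g := fun y => P y t) (hdiff _ hs.1).continuousAt hgc.continuousAt
    exact (h1.sub (by fun_prop)).continuousWithinAt
  have hsub : Icc (0 : ℝ) 1 ⊆ B := by
    refine IsClosed.Icc_subset_of_forall_exists_gt (hBcl.inter isClosed_Icc) ?_ ?_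
    · refine ⟨?_, ?_⟩
      · simpa [hg] using ⟨hz.1, hz.2.trans hcc.le⟩
      · simp [hg]
    · rintro s ⟨⟨hs1, hs2⟩, hs0, hs1'⟩ y hy
      have hs2' : P (g s) t ≤ P z t + (L + 1) * s * d := by
        simp only [mem_preimage, mem_Iic] at hs2; linarith
      have hlt : P (g s) t < c' := by
        have h1 : (L + 1) * s * d ≤ (L + 1) * d := by
          have : 0 ≤ (L + 1) * d := by positivity
          nlinarith
        linarith [hz.2]
      have hder : HasDerivAt (fun s => P (g s) t) (inner ℝ (gradX P (g s) t) (w - z)) s := by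
        have h1 : HasDerivAt g (w - z) s := by
          have h2 := ((hasDerivAt_id' s).smul_const (w - z)).const_add z
          rwa [one_smul] at h2
        exact (hdiff _ hs1.1).hasGradientAt.hasFDerivAt.comp_hasDerivAt s h1
      have hlt' : inner ℝ (gradX P (g s) t) (w - z) < (L + 1) * d := by
        refine (real_inner_le_norm _ _).trans_lt ?_
        have := hgrad _ hs1
        nlinarith
      have e1 := (hder.hasDerivWithinAt (s := Ioi s)).limsup_slope_le' (by simp) hlt'
      have e2 : ∀ᶠ s' in 𝓝[>] s, P (g s') t < c' :=
        (hder.continuousAt.eventually (gt_mem_nhds hlt)).filter_mono nhdsWithin_le_nhds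
      have e3 : ∀ᶠ s' in 𝓝[>] s, g s' ∈ D :=
        (hgc.continuousAt.eventually (hD.mem_nhds hs1.1)).filter_mono nhdsWithin_le_nhds
      have e4 : ∀ᶠ s' in 𝓝[>] s, s' ∈ Ioc s y := Ioc_mem_nhdsGT hy
      obtain ⟨s', h1, h2, h3, h4⟩ := (e1.and (e2.and (e3.and e4))).exists
      refine ⟨s', ⟨⟨h3, h2.le⟩, ?_⟩, h4⟩
      rw [slope_def_field, div_lt_iff₀ (sub_pos.2 h4.1)] at h1
      simp only [mem_preimage, mem_Iic]
      nlinarith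
  have := (hsub (right_mem_Icc.2 zero_le_one)).1
  simpa [hg] using this

/-- The largest value of the potential on the tubes up to time `t`. -/
def peak (D : Set (E n)) (xs : ℝ → E n) (P : E n → ℝ → ℝ) (ρ t : ℝ) : ℝ :=
  sSup {c | ∃ t0 x0, 0 ≤ t0 ∧ t0 ≤ t ∧ x0 ∈ tube D xs ρ t0 ∧ c = P x0 t0}

variable {mP ω₁₁ ω₁₂ v₁ v₂ ρ lam : ℝ}

lemma potential_le_of_mem_tube (hω₁₂ : 0 < ω₁₂) (hv₂ : 0 < v₂)
    (hP : ∀ t, 0 ≤ t → ∀ x ∈ D, P x t - mP ≤ ω₁₂ * ‖x - xs t‖ ^ v₂)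
    {t : ℝ} (ht : 0 ≤ t) {x : E n} (hx : x ∈ tube D xs ρ t) : P x t ≤ mP + ω₁₂ * ρ ^ v₂ := by
  have h1 := hP t ht x hx.1
  have h2 : ‖x - xs t‖ ^ v₂ ≤ ρ ^ v₂ := Real.rpow_le_rpow (norm_nonneg _) hx.2 hv₂.le
  nlinarith

lemma bddAbove_tube_values (hω₁₂ : 0 < ω₁₂) (hv₂ : 0 < v₂)
    (hP : ∀ t, 0 ≤ t → ∀ x ∈ D, P x t - mP ≤ ω₁₂ * ‖x - xs t‖ ^ v₂) (t : ℝ) :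
    BddAbove {c | ∃ t0 x0, 0 ≤ t0 ∧ t0 ≤ t ∧ x0 ∈ tube D xs ρ t0 ∧ c = P x0 t0} := by
  refine ⟨mP + ω₁₂ * ρ ^ v₂, ?_⟩
  rintro c ⟨t0, x0, h0, -, hx0, rfl⟩
  exact potential_le_of_mem_tube hω₁₂ hv₂ hP h0 hx0

lemma le_peak (hω₁₂ : 0 < ω₁₂) (hv₂ : 0 < v₂)
    (hP : ∀ t, 0 ≤ t → ∀ x ∈ D, P x t - mP ≤ ω₁₂ * ‖x - xs t‖ ^ v₂) {t0 t : ℝ} (h0 : 0 ≤ t0)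
    (h0t : t0 ≤ t) {x0 : E n} (hx0 : x0 ∈ tube D xs ρ t0) : P x0 t0 ≤ peak D xs P ρ t :=
  le_csSup (bddAbove_tube_values hω₁₂ hv₂ hP t) ⟨t0, x0, h0, h0t, hx0, rfl⟩

lemma tube_values_nonempty (hρ : 0 < ρ) (hxsD : ∀ t, 0 ≤ t → xs t ∈ D) {t : ℝ} (ht : 0 ≤ t) :
    {c | ∃ t0 x0, 0 ≤ t0 ∧ t0 ≤ t ∧ x0 ∈ tube D xs ρ t0 ∧ c = P x0 t0}.Nonempty :=
  ⟨P (xs t) t, t, xs t, ht, le_rfl, ⟨hxsD t ht, by simpa using hρ.le⟩, rfl⟩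

lemma peak_le (hω₁₂ : 0 < ω₁₂) (hv₂ : 0 < v₂) (hρ : 0 < ρ) (hxsD : ∀ t, 0 ≤ t → xs t ∈ D)
    (hP : ∀ t, 0 ≤ t → ∀ x ∈ D, P x t - mP ≤ ω₁₂ * ‖x - xs t‖ ^ v₂) {t : ℝ} (ht : 0 ≤ t) :
    peak D xs P ρ t ≤ mP + ω₁₂ * ρ ^ v₂ := by
  refine csSup_le (tube_values_nonempty hρ hxsD ht) ?_
  rintro c ⟨t0, x0, h0, -, hx0, rfl⟩
  exact potential_le_of_mem_tube hω₁₂ hv₂ hP h0 hx0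

/-- Since `c - lam` is below the supremum `peak`, some tube value at a time up to `t` exceeds it.
The sublevel is then a closed part of one that is compact by hypothesis. -/
lemma isCompact_sublevel (hρ : 0 < ρ)
    (hxsD : ∀ t, 0 ≤ t → xs t ∈ D)
    (hcont : ∀ t, 0 ≤ t → ContinuousOn (fun x => P x t) D)
    (hρD : ∀ t0 t, 0 ≤ t0 → t0 ≤ t → ∀ x0 ∈ tube D xs ρ t0,
        IsCompact (sublevel D P t (P x0 t0 + lam)))
    {t c : ℝ} (ht : 0 ≤ t) (hc : c < peak D xs P ρ t + lam) : IsCompact (sublevel D P t c) := by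
  obtain ⟨-, ⟨t0, x0, h0, h1, hx0, rfl⟩, h2⟩ := exists_lt_of_lt_csSup
    (tube_values_nonempty (P := P) hρ hxsD ht) (show c - lam < peak D xs P ρ t by linarith)
  have hK := hρD t0 t h0 h1 x0 hx0
  have : sublevel D P t c = sublevel D P t (P x0 t0 + lam) ∩ (fun x => P x t) ⁻¹' (Iic c) := by
    ext x
    simp only [sublevel, mem_ofPred_eq, mem_inter_iff, mem_preimage, mem_Iic]
    constructor
    · rintro ⟨h3, h4⟩; exact ⟨⟨h3, by linarith⟩, h4⟩
    · rintro ⟨⟨h3, -⟩, h4⟩; exact ⟨h3, h4⟩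
  rw [this]
  refine hK.of_isClosed_subset ?_ inter_subset_left
  exact ((hcont t ht).mono fun x hx => hx.1).preimage_isClosed_of_isClosed hK.isClosed isClosed_Iic

lemma le_rpow_inv_of_mul_rpow_le {a b ω v : ℝ} (hω : 0 < ω) (hv : 0 < v) (ha : 0 ≤ a)
    (h : ω * a ^ v ≤ b) : a ≤ (b / ω) ^ (1 / v) := by
  have h1 : a ^ v ≤ b / ω := by rw [le_div_iff₀ hω]; linarith
  calc a = (a ^ v) ^ (1 / v) := by
        rw [← Real.rpow_mul ha, mul_one_div_cancel hv.ne', Real.rpow_one]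
    _ ≤ _ := Real.rpow_le_rpow (by positivity) h1 (by positivity)

/-- The sublevel sets of the potential slightly above the peak form a compact family. -/
lemma isCompactFamily_sublevel (hDo : IsOpen D) (hω₁₁ : 0 < ω₁₁) (hω₁₂ : 0 < ω₁₂) (hv₁ : 0 < v₁)
    (hv₂ : 0 < v₂) (hρ : 0 < ρ) (hxsD : ∀ t, 0 ≤ t → xs t ∈ D)
    (hP₁ : ∀ t, 0 ≤ t → ∀ x ∈ D, ω₁₁ * ‖x - xs t‖ ^ v₁ ≤ P x t - mP)
    (hP : ∀ t, 0 ≤ t → ∀ x ∈ D, P x t - mP ≤ ω₁₂ * ‖x - xs t‖ ^ v₂)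
    (hdiff : ∀ t, 0 ≤ t → ∀ x ∈ D, DifferentiableAt ℝ (fun y => P y t) x)
    {μ₂ ν₂ : ℝ} (hμ₂ : 0 < μ₂) (hν₂ : 1 ≤ ν₂)
    (hgrad : ∀ t, 0 ≤ t → ∀ x ∈ D, ‖gradX P x t‖ ^ 2 ≤ μ₂ * (P x t - mP) ^ ν₂)
    (hlam : 0 < lam)
    (hρD : ∀ t0 t, 0 ≤ t0 → t0 ≤ t → ∀ x0 ∈ tube D xs ρ t0,
        IsCompact (sublevel D P t (P x0 t0 + lam))) :
    IsCompactFamily D xs (fun t => sublevel D P t (peak D xs P ρ t + lam / 2)) := by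
  have hcont : ∀ t, 0 ≤ t → ContinuousOn (fun x => P x t) D := fun t ht x hx =>
    (hdiff t ht x hx).continuousAt.continuousWithinAt
  set Vm := ω₁₂ * ρ ^ v₂ + lam with hVm
  have hVm0 : 0 < Vm := by positivity
  have hV0 : ∀ t, 0 ≤ t → ∀ x ∈ D, 0 ≤ P x t - mP := fun t ht x hx =>
    le_trans (by positivity) (hP₁ t ht x hx)
  set L := √(μ₂ * Vm ^ ν₂) with hL
  refine ⟨fun t ht => ⟨isCompact_sublevel hρ hxsD hcont hρD ht (by linarith),
    fun x hx => hx.1⟩, (Vm / ω₁₁) ^ (1 / v₁), (lam / 4) / (L + 1), by positivity,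
    fun t ht => ⟨?_, ?_⟩⟩
  · intro x hx
    rw [mem_closedBall_iff_norm]
    refine le_rpow_inv_of_mul_rpow_le hω₁₁ hv₁ (norm_nonneg _) ((hP₁ t ht x hx.1).trans ?_)
    have h1 := hx.2
    have h2 := peak_le hω₁₂ hv₂ hρ hxsD hP ht
    linarith
  -- The intermediate level `peak + 3 lam / 4` is still below `peak + lam`, hence compact, and
  -- leaves a gap of `lam / 4` for the thickening radius.
  · have h := thickening_sublevel_subset (P := P) hDo (t := t) (c := peak D xs P ρ t + lam / 2)
      (c' := peak D xs P ρ t + 3 * lam / 4) (L := L) (by positivity) (by linarith) (hdiff t ht)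
      (isCompact_sublevel hρ hxsD hcont hρD ht (by linarith)) ?_
    · refine Subset.trans ?_ (h.trans fun x hx => hx.1)
      apply subset_of_eq
      congr 2
      ring
    · intro x hx
      refine Real.le_sqrt_of_sq_le ((hgrad t ht x hx.1).trans ?_)
      have h1 := hx.2
      have h2 := peak_le hω₁₂ hv₂ hρ hxsD hP ht
      have h3 := hV0 t ht x hx.1
      gcongr
      linarith

/-- The target curve is uniformly continuous. -/
lemma exists_target_modulus (hxs : ContinuousOn xs (Ici 0)) (hω₁₁ : 0 < ω₁₁)
    (hv₂ : 0 < v₂) (hxsD : ∀ t, 0 ≤ t → xs t ∈ D)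
    (hP₁ : ∀ t, 0 ≤ t → ∀ x ∈ D, ω₁₁ * ‖x - xs t‖ ^ v₁ ≤ P x t - mP)
    (hP : ∀ t, 0 ≤ t → ∀ x ∈ D, P x t - mP ≤ ω₁₂ * ‖x - xs t‖ ^ v₂)
    (hA3 : PotentialRegularity D xs P) {δ : ℝ} (hδ : 0 < δ)
    (hball : ∀ t, 0 ≤ t → Metric.ball (xs t) δ ⊆ D) :
    ∃ h > 0, ∀ s t, 0 ≤ s → s ≤ t → t ≤ s + h → ‖xs t - xs s‖ ≤ δ / 2 := by
  have hfam : IsCompactFamily D xs (fun t => Metric.closedBall (xs t) (δ / 2)) := by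
    refine ⟨fun t ht => ⟨isCompact_closedBall _ _,
      (Metric.closedBall_subset_ball (by linarith)).trans (hball t ht)⟩, δ / 2, δ / 2,
      by positivity, fun t ht => ⟨Subset.rfl, ?_⟩⟩
    intro y hy
    obtain ⟨z, hz, hyz⟩ := Metric.mem_thickening_iff.1 hy
    refine hball t ht ?_
    rw [Metric.mem_ball]
    rw [Metric.mem_closedBall] at hz
    linarith [dist_triangle y z (xs t)]
  obtain ⟨mP', LPx, L2Px, L2Pt, LPt, HPx, -, -, -, hLPt, -, hb⟩ := hA3.bounds _ hfam
  have hval : ∀ t, 0 ≤ t → P (xs t) t ≤ mP := by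
    intro t ht
    have := hP t ht (xs t) (hxsD t ht)
    rw [sub_self, norm_zero, Real.zero_rpow hv₂.ne', mul_zero] at this
    linarith
  have hq : 0 < ω₁₁ * (δ / 2) ^ v₁ := by positivity
  -- Within this time `P` at a fixed point changes by less than `ω₁₁ (δ / 2) ^ v₁`; the `+ 1` covers
  -- `LPt = 0`.
  refine ⟨ω₁₁ * (δ / 2) ^ v₁ / (2 * (LPt + 1)), by positivity, fun s t hs hst hth => ?_⟩
  by_contra! hcon
  have hcont : ContinuousOn (fun τ => ‖xs τ - xs s‖) (Icc s t) :=
    ((hxs.mono fun τ hτ => hs.trans hτ.1).sub continuousOn_const).norm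
  -- At a time when the distance is exactly `δ / 2`, the point `xs s` still lies in the family, so
  -- the time Lipschitz bound applies. But `P (xs s)` was at most `mP` at time `s` and is at least
  -- `mP + ω₁₁ (δ / 2) ^ v₁` at time `τ`.
  obtain ⟨τ, hτ, hτe⟩ := intermediate_value_Icc hst hcont
    (show δ / 2 ∈ Icc _ _ from ⟨by simp; positivity, hcon.le⟩)
  have hτ0 : 0 ≤ τ := hs.trans hτ.1
  simp only at hτe
  have h1 := (hb s hs τ hτ0 (xs s) (Metric.mem_closedBall_self (by positivity)) (xs s)
    (by rw [mem_closedBall_iff_norm, norm_sub_rev, hτe])).2.2.1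
  rw [sub_self, norm_zero, mul_zero, zero_add, abs_sub_comm s τ,
    abs_of_nonneg (sub_nonneg.2 hτ.1)] at h1
  have h2 := hP₁ τ hτ0 (xs s) (hxsD s hs)
  rw [norm_sub_rev, hτe] at h2
  have h3 := neg_abs_le (P (xs s) s - P (xs s) τ)
  have h4 : τ - s ≤ ω₁₁ * (δ / 2) ^ v₁ / (2 * (LPt + 1)) := by linarith [hτ.2]
  rw [le_div_iff₀ (by positivity)] at h4
  have h5 := hval s hs
  have h6 : 0 ≤ τ - s := sub_nonneg.2 hτ.1
  nlinarith

/-- Every compact family can be enlarged so that it contains a uniform neighbourhood of the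
members at nearby times. -/
lemma IsCompactFamily.exists_enlarge {𝒦 : ℝ → Set (E n)} (h𝒦 : IsCompactFamily D xs 𝒦)
    {h c : ℝ} (hmod : ∀ s t, 0 ≤ s → s ≤ t → t ≤ s + h → ‖xs t - xs s‖ ≤ c) :
    ∃ 𝒦' : ℝ → Set (E n), IsCompactFamily D xs 𝒦' ∧ ∃ r > 0,
      ∀ T, 0 ≤ T → ∀ ξ ∈ 𝒦 T, ∀ s, T ≤ s → s ≤ T + h → Metric.ball ξ r ⊆ 𝒦' s := by
  obtain ⟨-, R, δ, hδ, hRδ⟩ := h𝒦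
  -- Everything near the members at times in `[t - h, t]`. Half of `δ` is spent on the
  -- neighbourhoods and half is kept as distance to the complement of `D`; the modulus of `xs`
  -- bounds the union.
  set U : ℝ → Set (E n) := fun t =>
    ⋃ s ∈ {s : ℝ | 0 ≤ s ∧ s ≤ t ∧ t ≤ s + h}, Metric.thickening (δ / 2) (𝒦 s) with hU
  have hUball : ∀ t, U t ⊆ Metric.closedBall (xs t) (R + δ / 2 + c) := by
    intro t y hy
    simp only [hU, mem_iUnion] at hy
    obtain ⟨s, ⟨hs0, hst, hts⟩, hy⟩ := hy
    obtain ⟨z, hz, hyz⟩ := Metric.mem_thickening_iff.1 hy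
    have h1 := (hRδ s hs0).1 hz
    rw [Metric.mem_closedBall] at h1 ⊢
    have h2 := hmod s t hs0 hst hts
    rw [← dist_eq_norm, dist_comm] at h2
    linarith [dist_triangle y z (xs s), dist_triangle y (xs s) (xs t)]
  have hUthick : ∀ t, Metric.thickening (δ / 2) (U t) ⊆ D := by
    intro t w hw
    obtain ⟨y, hy, hwy⟩ := Metric.mem_thickening_iff.1 hw
    simp only [hU, mem_iUnion] at hy
    obtain ⟨s, ⟨hs0, -, -⟩, hy⟩ := hy
    obtain ⟨z, hz, hyz⟩ := Metric.mem_thickening_iff.1 hy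
    refine (hRδ s hs0).2 (Metric.mem_thickening_iff.2 ⟨z, hz, ?_⟩)
    linarith [dist_triangle w y z]
  refine ⟨fun t => closure (U t), ⟨fun t _ => ⟨?_, ?_⟩, R + δ / 2 + c, δ / 2, by positivity,
    fun t _ => ⟨closure_minimal (hUball t) Metric.isClosed_closedBall, ?_⟩⟩, δ / 2, by positivity, ?_⟩
  · exact (Metric.isBounded_closedBall.subset (hUball t)).isCompact_closure
  · exact (Metric.closure_subset_thickening (by positivity) _).trans (hUthick t)
  · rw [Metric.thickening_closure]
    exact hUthick t
  · intro T hT ξ hξ s hTs hsT y hy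
    refine subset_closure ?_
    simp only [hU, mem_iUnion]
    exact ⟨T, ⟨hT, hTs, hsT⟩, Metric.mem_thickening_iff.2 ⟨ξ, hξ, hy⟩⟩

lemma norm_time_sub_le {F : Type*} [NormedAddCommGroup F] [NormedSpace ℝ F] {g : ℝ → F}
    {T T' C : ℝ} (hT : 0 ≤ T) (hg : ContDiffOn ℝ 1 g (Ici 0))
    (hC : ∀ s ∈ Icc T T', ‖derivWithin g (Ici 0) s‖ ≤ C) :
    ∀ s ∈ Icc T T', ∀ s' ∈ Icc T T', ‖g s - g s'‖ ≤ C * |s - s'| := by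
  intro s hs s' hs'
  have hsub : Icc T T' ⊆ Ici 0 := fun τ hτ => hT.trans hτ.1
  exact Convex.norm_image_sub_le_of_norm_hasDerivWithin_le (s := Icc T T')
    (fun τ hτ => ((hg.differentiableOn one_ne_zero τ (hsub hτ)).hasDerivWithinAt).mono hsub)
    hC (convex_Icc T T') hs' hs

/-- Uniform constants for the closed-loop system near a compact family. -/
lemma exists_uniform_constants {m : ℕ} {f : Fin m → E n → ℝ → E n} {S₁ : Finset (Fin m)}
    {S₂ : Finset (Fin m × Fin m)} (hDo : IsOpen D) (hA1 : FieldRegularity D xs f)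
    (hA2 : BracketGenerating D xs f S₁ S₂) (hA3 : PotentialRegularity D xs P)
    {𝒦 𝒦' : ℝ → Set (E n)} (h𝒦' : IsCompactFamily D xs 𝒦') {r h : ℝ} (hr : 0 < r)
    (hsub : ∀ T, 0 ≤ T → ∀ ξ ∈ 𝒦 T, ∀ s, T ≤ s → s ≤ T + h → Metric.ball ξ r ⊆ 𝒦' s) :
    ∃ C > 0, ∀ T, 0 ≤ T → ∀ ξ ∈ 𝒦 T, ∀ ε, 0 < ε → ε ≤ h →
      Metric.ball ξ r ⊆ D ∧ LocalFieldBounds f (Metric.ball ξ r) T (T + ε) C ∧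
      LocalPotentialBounds P (Metric.ball ξ r) T (T + ε) C ∧
      ∀ γ, 0 ≤ γ → ‖coeff f S₁ S₂ P γ ξ T‖ ≤ γ * C := by
  obtain ⟨Mf, Lfx, L2f, Lft, Hfx, Hft, h1, h2, h3, h4, h5, h6, hf⟩ := hA1.bounds 𝒦' h𝒦'
  obtain ⟨MF, h7, hF⟩ := hA2.inverse_bound 𝒦' h𝒦'
  obtain ⟨mP', LPx, L2Px, L2Pt, LPt, HPx, h8, h9, h10, h11, h12, hPb⟩ := hA3.bounds 𝒦' h𝒦'
  have h13 : 0 < MF * LPx := by positivity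
  -- One sum serves for all bounds; it contains no gain, which is essential for choosing `γ` after
  -- `C`.
  refine ⟨Mf + Lfx + L2f + Lft + Hfx + Hft + LPx + L2Px + LPt + MF * LPx, by positivity,
    fun T hT ξ hξ ε hε hεh => ?_⟩
  set C := Mf + Lfx + L2f + Lft + Hfx + Hft + LPx + L2Px + LPt + MF * LPx with hC
  have hO : ∀ s ∈ Icc T (T + ε), Metric.ball ξ r ⊆ 𝒦' s := fun s hs =>
    hsub T hT ξ hξ s hs.1 (by linarith [hs.2])
  have h0 : ∀ s ∈ Icc T (T + ε), 0 ≤ s := fun s hs => hT.trans hs.1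
  have hTI : T ∈ Icc T (T + ε) := ⟨le_rfl, by linarith⟩
  have hD : ∀ s ∈ Icc T (T + ε), Metric.ball ξ r ⊆ D := fun s hs =>
    (hO s hs).trans (h𝒦'.1 s (h0 s hs)).2
  have hξr : ξ ∈ Metric.ball ξ r := Metric.mem_ball_self hr
  have hdiffD : ∀ k s, 0 ≤ s → ∀ x ∈ D, DifferentiableAt ℝ (fun y => f k y s) x :=
    fun k s hs x hx => ((hA1.contDiff_space k s hs).contDiffAt (hDo.mem_nhds hx)).differentiableAt
      two_ne_zero
  refine ⟨hD T hTI, ⟨?_, ?_, ?_, ?_, ?_, ?_, ?_, ?_⟩, ⟨?_, ?_, ?_, ?_⟩, ?_⟩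
  · exact fun k s hs x hx => hdiffD k s (h0 s hs) x (hD s hs hx)
  · intro j k s hs x hx
    have e1 : ContDiffOn ℝ 1 (fderiv ℝ (fun y => f k y s)) D :=
      (hA1.contDiff_space k s (h0 s hs)).fderiv_of_isOpen hDo (by norm_num)
    have e2 : DifferentiableAt ℝ (fderiv ℝ (fun y => f k y s)) x :=
      (e1.contDiffAt (hDo.mem_nhds (hD s hs hx))).differentiableAt one_ne_zero
    exact e2.clm_apply (hdiffD j s (h0 s hs) x (hD s hs hx))
  · intro k s hs x hx
    linarith [(hf s (h0 s hs) x (hO s hs hx) x (hO s hs hx) k k k).1]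
  · intro k s hs x hx y hy
    refine (hf s (h0 s hs) x (hO s hs hx) y (hO s hs hy) k k k).2.1.trans ?_
    gcongr
    linarith
  · intro j k s hs x hx
    linarith [(hf s (h0 s hs) x (hO s hs hx) x (hO s hs hx) j k k).2.2.2.1]
  · intro l j k s hs x hx
    exact (hf s (h0 s hs) x (hO s hs hx) x (hO s hs hx) j k l).2.2.2.2.1.trans (by linarith)
  · intro k x hx
    refine norm_time_sub_le hT (hA1.contDiff_time k x (hD T hTI hx)) fun s hs => ?_
    exact (hf s (h0 s hs) x (hO s hs hx) x (hO s hs hx) k k k).2.2.1.trans (by linarith)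
  · intro j k x hx
    refine norm_time_sub_le (g := fun s => lieDeriv (fun y => f j y s) (fun y => f k y s) x) hT
      (hA1.contDiff_time_lie j k x (hD T hTI hx)) fun s hs => ?_
    exact (hf s (h0 s hs) x (hO s hs hx) x (hO s hs hx) j k k).2.2.2.2.2.trans (by linarith)
  · intro x hx
    exact ((hA3.contDiff_space T hT).contDiffAt (hDo.mem_nhds (hD T hTI hx))).differentiableAt
      two_ne_zero
  · intro x hx
    linarith [(hPb T hT T hT x (hO T hTI hx) x (hO T hTI hx)).2.1]
  · intro x hx y hy s hs
    refine (hPb s (h0 s hs) T hT x (hO s hs hx) y (hO T hTI hy)).2.2.1.trans ?_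
    gcongr <;> linarith
  · intro x hx y hy
    have := (hPb T hT T hT x (hO T hTI hx) y (hO T hTI hy)).2.2.2.1
    rw [sub_self, abs_zero, mul_zero, add_zero] at this
    refine this.trans ?_
    gcongr
    linarith
  · intro γ hγ
    unfold coeff
    rw [norm_neg, norm_smul, Real.norm_of_nonneg hγ]
    gcongr
    refine (ContinuousLinearMap.le_opNorm _ _).trans ?_
    have e1 := hF T hT ξ (hO T hTI hξr)
    have e2 := (hPb T hT T hT ξ (hO T hTI hξr) ξ (hO T hTI hξr)).2.1
    calc _ ≤ MF * LPx := by gcongr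
      _ ≤ C := by linarith

end Families

/-! ### Gluing over the sampling intervals -/

lemma mem_Ico_sampling {t0 ε t : ℝ} (hε : 0 < ε) (ht : t0 ≤ t) :
    t ∈ Ico (t0 + ε * ⌊(t - t0) / ε⌋₊) (t0 + ε * (⌊(t - t0) / ε⌋₊ + 1)) := by
  have h0 : 0 ≤ (t - t0) / ε := div_nonneg (sub_nonneg.2 ht) hε.le
  have h1 := Nat.floor_le h0
  have h2 := Nat.lt_floor_add_one ((t - t0) / ε)
  rw [le_div_iff₀ hε] at h1
  rw [div_lt_iff₀ hε] at h2
  constructor <;> linarith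

lemma floor_sampling {t0 ε t : ℝ} (hε : 0 < ε) {j : ℕ}
    (ht : t ∈ Ico (t0 + ε * j) (t0 + ε * (j + 1))) : ⌊(t - t0) / ε⌋₊ = j := by
  have h0 : 0 ≤ ε * j := by positivity
  rw [Nat.floor_eq_iff (div_nonneg (by linarith [ht.1]) hε.le), le_div_iff₀ hε, div_lt_iff₀ hε]
  constructor <;> linarith [ht.1, ht.2]

/-- Gluing solutions on consecutive sampling intervals. -/
lemma exists_glued_curve {E : Type*} [NormedAddCommGroup E] [NormedSpace ℝ E] {D : Set E}
    {G : ℕ → Set E} {F : ℕ → E → E → ℝ → E} {t0 ε M : ℝ} (hε : 0 < ε) (hM : 0 ≤ M) {x0 : E}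
    (hx0 : x0 ∈ G 0)
    (step : ∀ j : ℕ, ∀ ξ ∈ G j, ∃ x : ℝ → E, x (t0 + ε * j) = ξ ∧
      (∀ s ∈ Icc (t0 + ε * j) (t0 + ε * (j + 1)), x s ∈ D ∧ ‖F j ξ (x s) s‖ ≤ M ∧
        HasDerivWithinAt x (F j ξ (x s) s) (Icc (t0 + ε * j) (t0 + ε * (j + 1))) s) ∧
      x (t0 + ε * (j + 1)) ∈ G (j + 1)) :
    ∃ x : ℝ → E, x t0 = x0 ∧ (∀ t, t0 ≤ t → x t ∈ D) ∧
      LipschitzOnWith (Real.toNNReal M) x (Ici t0) ∧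
      ∀ j : ℕ, ∀ t ∈ Ico (t0 + ε * j) (t0 + ε * (j + 1)),
        HasDerivWithinAt x (F j (x (t0 + ε * j)) (x t) t)
          (Ico (t0 + ε * j) (t0 + ε * (j + 1))) t := by
  choose! y hy0 hy hyG using step
  -- The sampled states, with membership in `G j` carried along so that the next period can be
  -- started.
  let z : (j : ℕ) → {ξ // ξ ∈ G j} := fun j =>
    Nat.rec (motive := fun j => {ξ // ξ ∈ G j}) ⟨x0, hx0⟩
    (fun j ξ => ⟨y j ξ.1 (t0 + ε * (j + 1)), hyG j ξ.1 ξ.2⟩) j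
  have hz : ∀ j : ℕ, (z (j + 1)).1 = y j (z j).1 (t0 + ε * (j + 1)) := fun j => rfl
  set x : ℝ → E := fun t => y ⌊(t - t0) / ε⌋₊ (z ⌊(t - t0) / ε⌋₊) t with hx
  have hIco : ∀ j : ℕ, EqOn x (y j (z j)) (Ico (t0 + ε * j) (t0 + ε * (j + 1))) := by
    intro j t ht
    simp only [hx]
    rw [floor_sampling hε ht]
  have hlt : ∀ j : ℕ, t0 + ε * j < t0 + ε * (j + 1) := fun j => by nlinarith
  have hstart : ∀ j : ℕ, x (t0 + ε * j) = z j := fun j => by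
    rw [hIco j ⟨le_rfl, hlt j⟩, hy0 j _ (z j).2]
  -- The agreement extends to the right endpoint because the next piece starts where this one ends.
  have hIcc : ∀ j : ℕ, EqOn x (y j (z j)) (Icc (t0 + ε * j) (t0 + ε * (j + 1))) := by
    intro j t ht
    rcases ht.2.eq_or_lt with h | h
    · rw [h, ← hz j, ← hstart (j + 1)]
      push_cast
      rfl
    · exact hIco j ⟨ht.1, h⟩
  have hder : ∀ j : ℕ, ∀ t ∈ Icc (t0 + ε * j) (t0 + ε * (j + 1)),
      HasDerivWithinAt x (F j (z j) (x t) t) (Icc (t0 + ε * j) (t0 + ε * (j + 1))) t := by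
    intro j t ht
    have h1 := (hy j _ (z j).2 t ht).2.2
    rw [← hIcc j ht] at h1
    exact h1.congr (hIcc j) (hIcc j ht)
  have hcontN : ∀ N : ℕ, ContinuousOn x (Icc t0 (t0 + ε * N)) := by
    intro N
    induction N with
    | zero => simp
    | succ N ih =>
      have h0 : t0 ≤ t0 + ε * N := by have : 0 ≤ ε * N := by positivity
                                      linarith
      have h1 : ContinuousOn x (Icc (t0 + ε * N) (t0 + ε * (N + 1))) := fun t ht =>
        (hder N t ht).continuousWithinAt
      have h2 := ih.union_of_isClosed h1 isClosed_Icc isClosed_Icc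
      rwa [Icc_union_Icc_eq_Icc h0 (hlt N).le, ← Nat.cast_add_one] at h2
  have hcont : ContinuousOn x (Ici t0) := by
    intro t ht
    obtain ⟨h1, h2⟩ := mem_Ico_sampling hε ht
    set j := ⌊(t - t0) / ε⌋₊
    have h3 := hcontN (j + 1)
    push_cast at h3
    refine (h3 t ⟨ht, h2.le⟩).mono_of_mem_nhdsWithin ?_
    rw [← Ici_inter_Iic]
    exact inter_mem self_mem_nhdsWithin (mem_nhdsWithin_of_mem_nhds (Iic_mem_nhds h2))
  refine ⟨x, ?_, ?_, ?_, ?_⟩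
  · have := hstart 0
    rwa [Nat.cast_zero, mul_zero, add_zero] at this
  · intro t ht
    have h1 := mem_Ico_sampling hε ht
    set j := ⌊(t - t0) / ε⌋₊
    rw [hIco j h1]
    exact (hy j _ (z j).2 t ⟨h1.1, h1.2.le⟩).1
  · have key : ∀ s t, t0 ≤ s → s ≤ t → ‖x t - x s‖ ≤ M * (t - s) := by
      intro s t hs hst
      refine norm_image_sub_le_of_norm_deriv_right_le_segment
        (f' := fun u => F ⌊(u - t0) / ε⌋₊ (z ⌊(u - t0) / ε⌋₊) (x u) u)
        (hcont.mono fun u hu => hs.trans hu.1) ?_ ?_ t ⟨hst, le_rfl⟩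
      · intro u hu
        have h1 := mem_Ico_sampling hε (hs.trans hu.1)
        exact (hder _ u ⟨h1.1, h1.2.le⟩).mono_of_mem_nhdsWithin (Icc_mem_nhdsGE_of_mem h1)
      · intro u hu
        have h1 := mem_Ico_sampling hε (hs.trans hu.1)
        have h2 := (hy _ _ (z _).2 u ⟨h1.1, h1.2.le⟩).2.1
        rwa [← hIco _ h1] at h2
    refine LipschitzOnWith.of_dist_le_mul fun s hs t ht => ?_
    rw [Real.coe_toNNReal _ hM, Real.dist_eq]
    rcases le_total s t with h | h
    · rw [dist_comm, dist_eq_norm, abs_sub_comm, abs_of_nonneg (sub_nonneg.2 h)]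
      exact key s t hs h
    · rw [dist_eq_norm, abs_of_nonneg (sub_nonneg.2 h)]
      exact key t s ht h
  · intro j t ht
    rw [hstart j]
    exact (hder j t ⟨ht.1, ht.2.le⟩).mono Ico_subset_Icc_self

/-! ### Small steps and the discrete comparison principle -/

section ClosedLoop

variable {n m : ℕ} {D : Set (E n)} {f : Fin m → E n → ℝ → E n} {S₁ : Finset (Fin m)}
  {S₂ : Finset (Fin m × Fin m)} {κ : Fin m × Fin m → ℕ} {P : E n → ℝ → ℝ} {𝒦 : ℝ → Set (E n)}
  {C r γ ε mP μ₁ ν₁ η Vmax : ℝ}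

/-- The sampling period `ε` is small enough for the gain `γ`. -/
structure SmallStep (D : Set (E n)) (f : Fin m → E n → ℝ → E n) (S₁ : Finset (Fin m))
    (S₂ : Finset (Fin m × Fin m)) (κ : Fin m × Fin m → ℕ) (P : E n → ℝ → ℝ) (𝒦 : ℝ → Set (E n))
    (C r γ ε μ₁ ν₁ η Vmax : ℝ) : Prop where
  C_pos : 0 < C
  r_pos : 0 < r
  γ_pos : 0 < γ
  ε_pos : 0 < ε
  ε_le : ε ≤ 1
  near : ∀ T, 0 ≤ T → ∀ ξ ∈ 𝒦 T, Metric.ball ξ r ⊆ D ∧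
    LocalFieldBounds f (Metric.ball ξ r) T (T + ε) C ∧
    LocalPotentialBounds P (Metric.ball ξ r) T (T + ε) C ∧ ‖coeff f S₁ S₂ P γ ξ T‖ ≤ γ * C
  travel : travelConst m C (controlConst S₁ S₂ κ (γ * C)) * √ε ≤ r / 2
  error : descentConst C (expansionConst m C (controlConst S₁ S₂ κ (γ * C))) γ * √ε ≤ 1
  drift : C * (travelConst m C (controlConst S₁ S₂ κ (γ * C)) * √ε) + C * ε ≤ η
  monotone : ε * (γ * μ₁) * (ν₁ * Vmax ^ (ν₁ - 1)) ≤ 1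
  bracket_pos : ε * (γ * μ₁ * (ν₁ - 1)) < Vmax ^ (1 - ν₁)

/-- `x` solves the closed-loop system on one sampling period. -/
structure IsPeriodSolution (f : Fin m → E n → ℝ → E n) (S₁ : Finset (Fin m))
    (S₂ : Finset (Fin m × Fin m)) (κ : Fin m × Fin m → ℕ) (P : E n → ℝ → ℝ) (γ ε T : ℝ) (ξ : E n)
    (x : ℝ → E n) : Prop where
  init : x T = ξ
  cont : ContinuousOn x (Icc T (T + ε))
  ode : ∀ s ∈ Ico T (T + ε), HasDerivWithinAt x
      (controlSystem f (x s) (control S₁ S₂ κ ε (coeff f S₁ S₂ P γ ξ T) s) s) (Ici s) s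

namespace SmallStep

lemma confined
    (hs : SmallStep D f S₁ S₂ κ P 𝒦 C r γ ε μ₁ ν₁ η Vmax)
    {T : ℝ} (hT : 0 ≤ T) {ξ : E n} (hξ : ξ ∈ 𝒦 T) {x : ℝ → E n}
    (hx : IsPeriodSolution f S₁ S₂ κ P γ ε T ξ x) :
    ∀ s ∈ Icc T (T + ε),
      ‖x s - ξ‖ ≤ travelConst m C (controlConst S₁ S₂ κ (γ * C)) * √ε ∧ x s ∈ Metric.ball ξ r := by
  intro s hsI
  obtain ⟨-, h2, -, h4⟩ := hs.near T hT ξ hξ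
  have hr := hs.r_pos
  have := period_confined hs.C_pos.le h2 h4 hs.ε_pos hs.ε_le (by linarith [hs.travel]) hx.init
    hx.cont hx.ode s hsI
  exact ⟨this, by rw [mem_ball_iff_norm]; linarith [hs.travel]⟩

lemma potential_le
    (hs : SmallStep D f S₁ S₂ κ P 𝒦 C r γ ε μ₁ ν₁ η Vmax)
    {T : ℝ} (hT : 0 ≤ T) {ξ : E n} (hξ : ξ ∈ 𝒦 T) {x : ℝ → E n}
    (hx : IsPeriodSolution f S₁ S₂ κ P γ ε T ξ x) :
    ∀ s ∈ Icc T (T + ε), x s ∈ D ∧ P (x s) s ≤ P ξ T + η := by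
  intro s hsI
  obtain ⟨h1, -, h3, -⟩ := hs.near T hT ξ hξ
  obtain ⟨h5, h6⟩ := hs.confined hT hξ hx s hsI
  refine ⟨h1 h6, ?_⟩
  have h7 := h3.lip (x s) h6 ξ (Metric.mem_ball_self hs.r_pos) s hsI
  rw [abs_of_nonneg (sub_nonneg.2 hsI.1)] at h7
  have h8 : C * ‖x s - ξ‖ ≤ C * (travelConst m C (controlConst S₁ S₂ κ (γ * C)) * √ε) :=
    mul_le_mul_of_nonneg_left h5 hs.C_pos.le
  have h9 : C * (s - T) ≤ C * ε := mul_le_mul_of_nonneg_left (by linarith [hsI.2]) hs.C_pos.le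
  linarith [hs.drift, le_abs_self (P (x s) s - P ξ T)]

/-- The lower gradient bound turns the descent into a recursion in `V`. The condition `error`
reduces the `γ`-dependent expansion error to `1`. -/
lemma potential_step
    (hs : SmallStep D f S₁ S₂ κ P 𝒦 C r γ ε μ₁ ν₁ η Vmax)
    (hκ : ∀ p ∈ S₂, 0 < κ p) (hκi : Set.InjOn κ (S₂ : Set (Fin m × Fin m)))
    (hcard : S₁.card + S₂.card = n)
    (hspan : ∀ t, 0 ≤ t → ∀ x ∈ D, Submodule.span ℝ ({v | ∃ i ∈ S₁, v = f i x t} ∪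
      {v | ∃ p ∈ S₂, v = bracket f p.1 p.2 x t}) = ⊤)
    (hgrad : ∀ t, 0 ≤ t → ∀ x ∈ D, μ₁ * (P x t - mP) ^ ν₁ ≤ ‖gradX P x t‖ ^ 2)
    {T : ℝ} (hT : 0 ≤ T) {ξ : E n} (hξ : ξ ∈ 𝒦 T) {x : ℝ → E n}
    (hx : IsPeriodSolution f S₁ S₂ κ P γ ε T ξ x) :
    P (x (T + ε)) (T + ε) - mP
      ≤ P ξ T - mP - ε * (γ * μ₁) * (P ξ T - mP) ^ ν₁ + ε * (C + 1) := by
  obtain ⟨h1, h2, h3, h4⟩ := hs.near T hT ξ hξ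
  have hr := hs.r_pos
  have hε := hs.ε_pos
  have hξD : ξ ∈ D := h1 (Metric.mem_ball_self hr)
  have h5 := period_descent hκ hκi hcard (hspan T hT ξ hξD) hs.C_pos.le hs.γ_pos.le h2 h3 h4 hε
    hs.ε_le (by linarith [hs.travel]) hx.init hx.cont hx.ode
  have h6 : ε * γ * (μ₁ * (P ξ T - mP) ^ ν₁) ≤ ε * γ * ‖gradX P ξ T‖ ^ 2 :=
    mul_le_mul_of_nonneg_left (hgrad T hT ξ hξD) (mul_nonneg hε.le hs.γ_pos.le)
  have h7 := mul_le_mul_of_nonneg_left hs.error hε.le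
  nlinarith

lemma exists_period
    (hs : SmallStep D f S₁ S₂ κ P 𝒦 C r γ ε μ₁ ν₁ η Vmax)
    {T : ℝ} (hT : 0 ≤ T) {ξ : E n} (hξ : ξ ∈ 𝒦 T) :
    ∃ x, IsPeriodSolution f S₁ S₂ κ P γ ε T ξ x ∧ ∀ s ∈ Icc T (T + ε), HasDerivWithinAt x
      (controlSystem f (x s) (control S₁ S₂ κ ε (coeff f S₁ S₂ P γ ξ T) s) s)
      (Icc T (T + ε)) s := by
  obtain ⟨-, h2, -, h4⟩ := hs.near T hT ξ hξ
  obtain ⟨x, hx0, hx⟩ := period_exists (κ := κ) hs.C_pos.le hs.r_pos h2 h4 hs.ε_pos hs.ε_le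
    hs.travel
  exact ⟨x, ⟨hx0, fun s hsI => (hx s hsI).continuousWithinAt, fun s hsI =>
    (hx s ⟨hsI.1, hsI.2.le⟩).mono_of_mem_nhdsWithin (Icc_mem_nhdsGE_of_mem hsI)⟩, hx⟩

end SmallStep

lemma IsPiSolution.continuousOn {n : ℕ} {U A : Type*} {D : Set (E n)} {F : E n → U → ℝ → E n}
    {a : E n → ℝ → A} {h : A → ℝ → U} {ε t0 : ℝ} {x0 : E n} {x : ℝ → E n}
    (hx : IsPiSolution D F a h ε t0 x0 x) (T : ℝ) : ContinuousOn x (Icc t0 T) := by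
  rcases le_total t0 T with hT | hT
  · have := (hx.absCont T hT).continuousOn
    rwa [uIcc_of_le hT] at this
  · intro t ht
    have : t0 = T := le_antisymm (ht.1.trans ht.2) hT
    subst this
    rw [Icc_self] at ht ⊢
    rw [ht]
    exact continuousWithinAt_singleton

lemma sampling_succ (t0 ε : ℝ) (j : ℕ) : t0 + ε * (j + 1) = t0 + ε * j + ε := by ring

lemma IsClosedLoopSolution.isPeriodSolution {t0 : ℝ} {x0 : E n} {x : ℝ → E n}
    (hε : 0 < ε) (hx : IsClosedLoopSolution D f S₁ S₂ κ P γ ε t0 x0 x) (j : ℕ) :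
    IsPeriodSolution f S₁ S₂ κ P γ ε (t0 + ε * j) (x (t0 + ε * j)) x := by
  have h0 : 0 ≤ ε * j := by positivity
  refine ⟨rfl, (IsPiSolution.continuousOn hx _).mono (Icc_subset_Icc_left (by linarith)),
    fun s hsI => ?_⟩
  have h1 := hx.ode j s (by rwa [sampling_succ])
  refine h1.mono_of_mem_nhdsWithin (Ico_mem_nhdsGE_of_mem ?_)
  rwa [sampling_succ]

/-- Discrete comparison principle for the values of the potential at the sampling times. -/
def ComparisonProperty (f : Fin m → E n → ℝ → E n) (S₁ : Finset (Fin m))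
    (S₂ : Finset (Fin m × Fin m)) (κ : Fin m × Fin m → ℕ) (P : E n → ℝ → ℝ) (𝒦 : ℝ → Set (E n))
    (C γ ε mP μ₁ ν₁ η Vmax : ℝ) : Prop :=
  ∀ γs y y' : ℝ, 0 ≤ γs → γs ≤ γ → C + 1 ≤ γs * μ₁ * η ^ ν₁ → 0 ≤ y → y + η ≤ Vmax →
    y - ε * (γs * μ₁) * y ^ ν₁ ≤ y' → ∀ T, 0 ≤ T → ∀ ξ ∈ 𝒦 T, P ξ T - mP ≤ y + η →
    ∀ x, IsPeriodSolution f S₁ S₂ κ P γ ε T ξ x → P (x (T + ε)) (T + ε) - mP ≤ y' + η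

/-- As `V ^ ν₁ ≥ 0`, the gain may be lowered from `γ` to `γs`, the gain appearing in the decay rate.
The sequence `y` is left free: a constant gives invariance of the family, the scalar solution gives
the rate. -/
lemma SmallStep.comparison
    (hs : SmallStep D f S₁ S₂ κ P 𝒦 C r γ ε μ₁ ν₁ η Vmax)
    (hκ : ∀ p ∈ S₂, 0 < κ p) (hκi : Set.InjOn κ (S₂ : Set (Fin m × Fin m)))
    (hcard : S₁.card + S₂.card = n)
    (hspan : ∀ t, 0 ≤ t → ∀ x ∈ D, Submodule.span ℝ ({v | ∃ i ∈ S₁, v = f i x t} ∪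
      {v | ∃ p ∈ S₂, v = bracket f p.1 p.2 x t}) = ⊤)
    (hgrad : ∀ t, 0 ≤ t → ∀ x ∈ D, μ₁ * (P x t - mP) ^ ν₁ ≤ ‖gradX P x t‖ ^ 2)
    (hμ₁ : 0 < μ₁) (hν₁ : 1 ≤ ν₁) (hη : 0 ≤ η)
    (hV : ∀ t, 0 ≤ t → ∀ x ∈ D, 0 ≤ P x t - mP) :
    ComparisonProperty f S₁ S₂ κ P 𝒦 C γ ε mP μ₁ ν₁ η Vmax := by
  intro γs y y' hγs hγsγ hB hy hymax hy' T hT ξ hξ hVy x hx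
  have hε := hs.ε_pos
  have hξD : ξ ∈ D := (hs.near T hT ξ hξ).1 (Metric.mem_ball_self hs.r_pos)
  have h1 := hs.potential_step hκ hκi hcard hspan hgrad hT hξ hx
  have hV0 := hV T hT ξ hξD
  have hVm : 0 ≤ Vmax := by linarith
  have hk : γs * μ₁ ≤ γ * μ₁ := by gcongr
  have hk0 : 0 ≤ γs * μ₁ := by positivity
  refine comparison_step hν₁ hk0 hε.le hη hV0 hy hymax (le_trans ?_ hs.monotone) hB
    (h1.trans ?_) hVy hy'
  · gcongr
  · have : ε * (γs * μ₁) * (P ξ T - mP) ^ ν₁ ≤ ε * (γ * μ₁) * (P ξ T - mP) ^ ν₁ := by gcongr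
    linarith

end ClosedLoop

/-! ### Solutions on the half line -/

section ClosedLoop

variable {n m : ℕ} {D : Set (E n)} {f : Fin m → E n → ℝ → E n} {S₁ : Finset (Fin m)}
  {S₂ : Finset (Fin m × Fin m)} {κ : Fin m × Fin m → ℕ} {P : E n → ℝ → ℝ} {𝒦 : ℝ → Set (E n)}
  {C r γ ε mP μ₁ ν₁ η Vmax t0 : ℝ} {x0 : E n} {x : ℝ → E n}

lemma sampling_nonneg (ht0 : 0 ≤ t0) (hε : 0 < ε) (j : ℕ) : t0 ≤ t0 + ε * j ∧ 0 ≤ t0 + ε * j := by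
  have : 0 ≤ ε * j := by positivity
  constructor <;> linarith

/-- The set `P ≤ P x0 t0 + η` is reproduced at every sampling time, so each period starts in `𝒦` and
another can be attached. The uniform speed bound makes the glued curve Lipschitz, hence absolutely
continuous. -/
lemma SmallStep.exists_solution (hs : SmallStep D f S₁ S₂ κ P 𝒦 C r γ ε μ₁ ν₁ η Vmax)
    (hcmp : ComparisonProperty f S₁ S₂ κ P 𝒦 C γ ε mP μ₁ ν₁ η Vmax) (hμ₁ : 0 < μ₁) (hη : 0 ≤ η)
    (hV : ∀ t, 0 ≤ t → ∀ x ∈ D, 0 ≤ P x t - mP) (hB : C + 1 ≤ γ * μ₁ * η ^ ν₁)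
    (ht0 : 0 ≤ t0) (hx0 : x0 ∈ D) (hV0 : P x0 t0 - mP + η ≤ Vmax)
    (h𝒦 : ∀ t, t0 ≤ t → ∀ ξ ∈ D, P ξ t ≤ P x0 t0 + η → ξ ∈ 𝒦 t) :
    ∃ x, IsClosedLoopSolution D f S₁ S₂ κ P γ ε t0 x0 x := by
  have hε := hs.ε_pos
  have hV0' := hV t0 ht0 x0 hx0
  have step : ∀ j : ℕ, ∀ ξ ∈ {ξ | ξ ∈ D ∧ P ξ (t0 + ε * j) ≤ P x0 t0 + η}, ∃ x : ℝ → E n,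
      x (t0 + ε * j) = ξ ∧ (∀ s ∈ Icc (t0 + ε * j) (t0 + ε * (j + 1)), x s ∈ D ∧
        ‖controlSystem f (x s) (control S₁ S₂ κ ε (coeff f S₁ S₂ P γ ξ (t0 + ε * j)) s) s‖
          ≤ travelConst m C (controlConst S₁ S₂ κ (γ * C)) / √ε ∧
        HasDerivWithinAt x
          (controlSystem f (x s) (control S₁ S₂ κ ε (coeff f S₁ S₂ P γ ξ (t0 + ε * j)) s) s)
          (Icc (t0 + ε * j) (t0 + ε * (j + 1))) s) ∧
      x (t0 + ε * (j + 1)) ∈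
        {ξ | ξ ∈ D ∧ P ξ (t0 + ε * ((j + 1 : ℕ) : ℝ)) ≤ P x0 t0 + η} := by
    rintro j ξ ⟨hξD, hξ⟩
    obtain ⟨hT0, hT⟩ := sampling_nonneg ht0 hε j
    have hξ𝒦 := h𝒦 _ hT0 ξ hξD hξ
    obtain ⟨x, hx, hxder⟩ := hs.exists_period hT hξ𝒦
    simp only [sampling_succ, Nat.cast_add, Nat.cast_one]
    obtain ⟨-, h2, -, h4⟩ := hs.near _ hT ξ hξ𝒦
    refine ⟨x, hx.init, fun s hsI => ⟨(hs.potential_le hT hξ𝒦 hx s hsI).1, ?_, hxder s hsI⟩, ?_, ?_⟩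
    · exact norm_controlSystem_le h2 h4 hε hs.ε_le hsI (hs.confined hT hξ𝒦 hx s hsI).2
    · exact (hs.potential_le hT hξ𝒦 hx _ ⟨by linarith, le_rfl⟩).1
    -- The constant comparison sequence is admissible, since the decay term is nonnegative.
    · have := hcmp γ (P x0 t0 - mP) (P x0 t0 - mP) hs.γ_pos.le le_rfl hB hV0' hV0
        (by have := hs.γ_pos; linarith [show 0 ≤ ε * (γ * μ₁) * (P x0 t0 - mP) ^ ν₁ by positivity])
        _ hT ξ hξ𝒦 (by linarith) x hx
      linarith
  obtain ⟨x, hxi, hxD, hxL, hxo⟩ := exists_glued_curve (t0 := t0) (ε := ε) (D := D) (x0 := x0)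
    (M := travelConst m C (controlConst S₁ S₂ κ (γ * C)) / √ε)
    (G := fun j => {ξ | ξ ∈ D ∧ P ξ (t0 + ε * j) ≤ P x0 t0 + η})
    (F := fun j ξ y s => controlSystem f y
      (control S₁ S₂ κ ε (coeff f S₁ S₂ P γ ξ (t0 + ε * j)) s) s) hε
    (div_nonneg (travelConst_nonneg hs.C_pos.le (mul_pos hs.γ_pos hs.C_pos).le)
      (Real.sqrt_nonneg _)) ⟨hx0, by simpa using hη⟩ step
  refine ⟨x, hxD, hxi, fun T hT => ?_, hxo⟩
  refine LipschitzOnWith.absolutelyContinuousOnInterval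
    (K := Real.toNNReal (travelConst m C (controlConst S₁ S₂ κ (γ * C)) / √ε)) (hxL.mono ?_)
  rw [uIcc_of_le hT]
  exact fun t ht => ht.1

/-- The same invariance for an arbitrary solution, which is what uniqueness and the decay estimates
require. -/
lemma SmallStep.mem_of_solution (hs : SmallStep D f S₁ S₂ κ P 𝒦 C r γ ε μ₁ ν₁ η Vmax)
    (hcmp : ComparisonProperty f S₁ S₂ κ P 𝒦 C γ ε mP μ₁ ν₁ η Vmax) (hμ₁ : 0 < μ₁) (hη : 0 ≤ η)
    (hV : ∀ t, 0 ≤ t → ∀ x ∈ D, 0 ≤ P x t - mP) (hB : C + 1 ≤ γ * μ₁ * η ^ ν₁)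
    (ht0 : 0 ≤ t0) (hx0 : x0 ∈ D) (hV0 : P x0 t0 - mP + η ≤ Vmax)
    (h𝒦 : ∀ t, t0 ≤ t → ∀ ξ ∈ D, P ξ t ≤ P x0 t0 + η → ξ ∈ 𝒦 t)
    (hx : IsClosedLoopSolution D f S₁ S₂ κ P γ ε t0 x0 x) (j : ℕ) :
    x (t0 + ε * j) ∈ 𝒦 (t0 + ε * j) := by
  have hε := hs.ε_pos
  have hV0' := hV t0 ht0 x0 hx0
  have hxi : x t0 = x0 := hx.init
  have hxD : ∀ t, t0 ≤ t → x t ∈ D := hx.mem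
  suffices h : P (x (t0 + ε * j)) (t0 + ε * j) ≤ P x0 t0 + η from
    h𝒦 _ (sampling_nonneg ht0 hε j).1 _ (hxD _ (sampling_nonneg ht0 hε j).1) h
  induction j with
  | zero => simpa [hxi] using hη
  | succ j ih =>
    obtain ⟨hT0, hT⟩ := sampling_nonneg ht0 hε j
    have := hcmp γ (P x0 t0 - mP) (P x0 t0 - mP) hs.γ_pos.le le_rfl hB hV0' hV0
      (by have := hs.γ_pos; linarith [show 0 ≤ ε * (γ * μ₁) * (P x0 t0 - mP) ^ ν₁ by positivity])
      _ hT _ (h𝒦 _ hT0 _ (hxD _ hT0) ih) (by linarith) x (hx.isPeriodSolution hε j)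
    rw [Nat.cast_add, Nat.cast_one, sampling_succ]
    linarith

lemma SmallStep.eqOn_of_solutions (hs : SmallStep D f S₁ S₂ κ P 𝒦 C r γ ε μ₁ ν₁ η Vmax)
    (ht0 : 0 ≤ t0) {y : ℝ → E n}
    (hx : IsClosedLoopSolution D f S₁ S₂ κ P γ ε t0 x0 x)
    (hy : IsClosedLoopSolution D f S₁ S₂ κ P γ ε t0 x0 y)
    (hmem : ∀ j : ℕ, x (t0 + ε * j) ∈ 𝒦 (t0 + ε * j)) : EqOn x y (Ici t0) := by
  have hε := hs.ε_pos
  have step : ∀ j : ℕ, x (t0 + ε * j) = y (t0 + ε * j) →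
      EqOn x y (Icc (t0 + ε * j) (t0 + ε * j + ε)) := by
    intro j hj
    obtain ⟨hT0, hT⟩ := sampling_nonneg ht0 hε j
    obtain ⟨-, h2, -, h4⟩ := hs.near _ hT _ (hmem j)
    have px := hx.isPeriodSolution hε j
    have py := hy.isPeriodSolution hε j
    rw [← hj] at py
    have hr := hs.r_pos
    exact period_unique hs.C_pos.le h2 h4 hε hs.ε_le (by linarith [hs.travel])
      px.init px.cont px.ode py.init py.cont py.ode
  have hall : ∀ j : ℕ, x (t0 + ε * j) = y (t0 + ε * j) := by
    intro j
    induction j with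
    | zero =>
      have h1 : x t0 = x0 := hx.init
      have h2 : y t0 = x0 := hy.init
      simp [h1, h2]
    | succ j ih =>
      rw [Nat.cast_add, Nat.cast_one, sampling_succ]
      exact step j ih ⟨by linarith, le_rfl⟩
  intro t ht
  have h := mem_Ico_sampling hε ht
  rw [sampling_succ] at h
  exact step _ (hall _) ⟨h.1, h.2.le⟩

/-- The potential along the closed-loop solutions is dominated by the solution of a scalar
equation, up to the margin `2η`. -/
lemma SmallStep.potential_le_decay (hs : SmallStep D f S₁ S₂ κ P 𝒦 C r γ ε μ₁ ν₁ η Vmax)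
    (hcmp : ComparisonProperty f S₁ S₂ κ P 𝒦 C γ ε mP μ₁ ν₁ η Vmax) (hμ₁ : 0 < μ₁) (hν₁ : 1 ≤ ν₁)
    (hη : 0 ≤ η) {γs Y : ℝ} (hγs : 0 < γs) (hγsγ : γs ≤ γ) (hB : C + 1 ≤ γs * μ₁ * η ^ ν₁)
    (hY : 0 ≤ Y) (hYmax : Y + η ≤ Vmax) (hVY : P x0 t0 - mP ≤ Y)
    (ht0 : 0 ≤ t0) (hx : IsClosedLoopSolution D f S₁ S₂ κ P γ ε t0 x0 x)
    (hmem : ∀ j : ℕ, x (t0 + ε * j) ∈ 𝒦 (t0 + ε * j)) {t : ℝ} (ht : t0 ≤ t) :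
    (ν₁ ≠ 1 → Y ≠ 0 → 0 < Y ^ (1 - ν₁) + γs * μ₁ * (ν₁ - 1) * (t - t0 - ε)) ∧
    ∃ d, 0 ≤ d ∧ d ≤ Y ∧ d ≤ decay ν₁ (γs * μ₁) Y (t - t0 - ε) ∧
      P (x t) t - mP ≤ d + 2 * η := by
  have hε := hs.ε_pos
  have hc : 0 ≤ γs * μ₁ := by positivity
  have hxi : x t0 = x0 := hx.init
  have hdY : ∀ j : ℕ, decay ν₁ (γs * μ₁) Y (ε * j) ≤ Y := by
    intro j
    have := decay_antitone hν₁ hc hY (s := 0) (s' := ε * j)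
      (fun _ h => by have : 0 < Y := lt_of_le_of_ne hY h.symm
                     rw [mul_zero, add_zero]; positivity) (by positivity)
    rwa [decay_zero hY] at this
  have hdisc : ∀ j : ℕ, P (x (t0 + ε * j)) (t0 + ε * j) - mP
      ≤ decay ν₁ (γs * μ₁) Y (ε * j) + η := by
    intro j
    induction j with
    | zero => simp only [Nat.cast_zero, mul_zero, add_zero, hxi, decay_zero hY]; linarith
    | succ j ih =>
      obtain ⟨-, hT⟩ := sampling_nonneg ht0 hε j
      rw [Nat.cast_add, Nat.cast_one, sampling_succ, mul_add_one]
      exact hcmp γs _ _ hγs.le hγsγ hB (decay_nonneg hν₁ hc hY (by positivity))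
        (by linarith [hdY j]) (decay_step hν₁ hc hY (by positivity) hε.le) _ hT _ (hmem j) ih x
        (hx.isPeriodSolution hε j)
  -- The argument may be as low as `-ε`; `bracket_pos` ensures that the bracket survives this, as `Y
  -- ≤ Vmax`.
  have hpos : ν₁ ≠ 1 → Y ≠ 0 → 0 < Y ^ (1 - ν₁) + γs * μ₁ * (ν₁ - 1) * (t - t0 - ε) := by
    intro h1 h2
    have h3 : 0 < ν₁ - 1 := lt_of_le_of_ne (by linarith) (sub_ne_zero.2 h1).symm
    have h4 : 0 < Y := lt_of_le_of_ne hY h2.symm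
    have h5 : Vmax ^ (1 - ν₁) ≤ Y ^ (1 - ν₁) :=
      Real.rpow_le_rpow_of_nonpos h4 (by linarith) (by linarith)
    have h6 : γs * μ₁ * (ν₁ - 1) * (-ε) ≤ γs * μ₁ * (ν₁ - 1) * (t - t0 - ε) := by
      apply mul_le_mul_of_nonneg_left _ (by positivity)
      linarith
    have h7 : ε * (γs * μ₁ * (ν₁ - 1)) ≤ ε * (γ * μ₁ * (ν₁ - 1)) := by gcongr
    linarith [hs.bracket_pos]
  refine ⟨hpos, ?_⟩
  have hI := mem_Ico_sampling hε ht
  set j := ⌊(t - t0) / ε⌋₊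
  rw [sampling_succ] at hI
  -- The last sampling time is later than `t - ε`, which is the origin of the delay `ε`. Bounding
  -- `d` also by `Y` keeps it in a fixed compact range.
  refine ⟨decay ν₁ (γs * μ₁) Y (ε * j), decay_nonneg hν₁ hc hY (by positivity), hdY j,
    decay_antitone hν₁ hc hY hpos (by linarith [hI.2]), ?_⟩
  have := (hs.potential_le (sampling_nonneg ht0 hε j).2 (hmem j) (hx.isPeriodSolution hε j) t
    ⟨hI.1, hI.2.le⟩).2
  linarith [hdisc j]

lemma eventually_mul_sqrt_le (c : ℝ) {b : ℝ} (hb : 0 < b) : ∀ᶠ ε in 𝓝[>] (0 : ℝ), c * √ε ≤ b := by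
  have h : Continuous fun ε : ℝ => c * √ε := by fun_prop
  have h1 := h.tendsto 0
  rw [Real.sqrt_zero, mul_zero] at h1
  exact ((h1.eventually (gt_mem_nhds hb)).filter_mono nhdsWithin_le_nhds).mono fun _ h => h.le

lemma eventually_mul_lt (c : ℝ) {b : ℝ} (hb : 0 < b) : ∀ᶠ ε in 𝓝[>] (0 : ℝ), ε * c < b := by
  have h : Continuous fun ε : ℝ => ε * c := by fun_prop
  have h1 := h.tendsto 0
  rw [zero_mul] at h1
  exact (h1.eventually (gt_mem_nhds hb)).filter_mono nhdsWithin_le_nhds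

/-- For every gain, all sufficiently small sampling periods are admissible. -/
lemma exists_smallStep {h : ℝ} (hh : 0 < h) (hC : 0 < C) (hr : 0 < r) (hγ : 0 < γ) (hη : 0 < η)
    (hVmax : 0 < Vmax)
    (hnear : ∀ T, 0 ≤ T → ∀ ξ ∈ 𝒦 T, ∀ ε, 0 < ε → ε ≤ h →
      Metric.ball ξ r ⊆ D ∧ LocalFieldBounds f (Metric.ball ξ r) T (T + ε) C ∧
      LocalPotentialBounds P (Metric.ball ξ r) T (T + ε) C ∧
      ∀ γ, 0 ≤ γ → ‖coeff f S₁ S₂ P γ ξ T‖ ≤ γ * C) :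
    ∃ e > 0, ∀ ε ∈ Ioc 0 e, SmallStep D f S₁ S₂ κ P 𝒦 C r γ ε μ₁ ν₁ η Vmax := by
  have hev : ∀ᶠ ε in 𝓝[>] (0 : ℝ), SmallStep D f S₁ S₂ κ P 𝒦 C r γ ε μ₁ ν₁ η Vmax := by
    filter_upwards [self_mem_nhdsWithin, eventually_mul_lt 1 one_pos, eventually_mul_lt 1 hh,
      eventually_mul_sqrt_le (travelConst m C (controlConst S₁ S₂ κ (γ * C))) (half_pos hr),
      eventually_mul_sqrt_le
        (descentConst C (expansionConst m C (controlConst S₁ S₂ κ (γ * C))) γ) one_pos,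
      eventually_mul_sqrt_le (C * travelConst m C (controlConst S₁ S₂ κ (γ * C))) (half_pos hη),
      eventually_mul_lt C (half_pos hη),
      eventually_mul_lt (γ * μ₁ * (ν₁ * Vmax ^ (ν₁ - 1))) one_pos,
      eventually_mul_lt (γ * μ₁ * (ν₁ - 1)) (Real.rpow_pos_of_pos hVmax (1 - ν₁))]
      with ε h1 h2 h3 h4 h5 h6 h7 h8 h9
    refine ⟨hC, hr, hγ, h1, by linarith, fun T hT ξ hξ => ?_, h4, h5, by linarith, by linarith, h9⟩
    obtain ⟨e1, e2, e3, e4⟩ := hnear T hT ξ hξ ε h1 (by linarith)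
    exact ⟨e1, e2, e3, e4 γ hγ.le⟩
  obtain ⟨e, he, hsub⟩ := mem_nhdsGT_iff_exists_Ioc_subset.1 hev
  exact ⟨e, he, fun ε hε => hsub hε⟩

end ClosedLoop

/-! ### From the potential to the distance -/

/-- Uniform continuity on a compact interval, so that a margin in `P` costs only an additive `b` in
the distance, whether `p` is below or above `1`. -/
lemma exists_rpow_margin {p A b : ℝ} (hp : 0 < p) (hb : 0 < b) :
    ∃ δ > 0, ∀ a, 0 ≤ a → a ≤ A → (a + δ) ^ p ≤ a ^ p + b := by
  have hc : ContinuousOn (fun s : ℝ => s ^ p) (Icc 0 (A + 1)) :=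
    (Real.continuous_rpow_const hp.le).continuousOn
  have hu := isCompact_Icc.uniformContinuousOn_of_continuous hc
  obtain ⟨δ, hδ, h⟩ := Metric.uniformContinuousOn_iff.1 hu b hb
  have hδ1 : 0 < min (δ / 2) 1 := by positivity
  refine ⟨min (δ / 2) 1, hδ1, fun a ha haA => ?_⟩
  have h1 := h (a + min (δ / 2) 1) ⟨by positivity, by linarith [min_le_right (δ / 2) 1]⟩ a
    ⟨ha, by linarith⟩ (by
      rw [Real.dist_eq, add_sub_cancel_left, abs_of_pos hδ1]
      linarith [min_le_left (δ / 2) 1])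
  rw [Real.dist_eq] at h1
  linarith [le_abs_self ((a + min (δ / 2) 1) ^ p - a ^ p)]

lemma decay_div_rpow_of_eq_one {ω₁₁ ω₁₂ v₁ v₂ c R s : ℝ} (hω₁₁ : 0 < ω₁₁) (hω₁₂ : 0 < ω₁₂)
    (hR : 0 ≤ R) :
    (decay 1 c (ω₁₂ * R ^ v₂) s / ω₁₁) ^ (1 / v₁)
      = (ω₁₂ / ω₁₁) ^ (1 / v₁) * R ^ (v₂ / v₁) * Real.exp (-(c / v₁) * s) := by
  have h1 : decay 1 c (ω₁₂ * R ^ v₂) s / ω₁₁ = ω₁₂ / ω₁₁ * R ^ v₂ * Real.exp (-(c * s)) := by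
    unfold decay
    rw [if_pos rfl]
    ring
  rw [h1, Real.mul_rpow (by positivity) (by positivity),
    Real.mul_rpow (by positivity) (by positivity), ← Real.rpow_mul hR, ← Real.exp_mul]
  congr 2 <;> ring_nf

lemma bracket_eq {ω₁₁ ω₁₂ v₂ ν c R s : ℝ} (hω₁₁ : 0 < ω₁₁) (hω₁₂ : 0 < ω₁₂) (hR : 0 ≤ R) :
    (ω₁₂ / ω₁₁) ^ (1 - ν) * R ^ (v₂ * (1 - ν)) + c * (ν - 1) / ω₁₁ ^ (1 - ν) * s
      = ((ω₁₂ * R ^ v₂) ^ (1 - ν) + c * (ν - 1) * s) / ω₁₁ ^ (1 - ν) := by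
  rw [Real.div_rpow hω₁₂.le hω₁₁.le, Real.mul_rpow hω₁₂.le (by positivity), ← Real.rpow_mul hR]
  ring

lemma decay_div_rpow_of_one_lt {ω₁₁ v₁ ν c Y s : ℝ} (hω₁₁ : 0 < ω₁₁) (hν : 1 < ν) (hY : Y ≠ 0)
    (hb : 0 < Y ^ (1 - ν) + c * (ν - 1) * s) :
    (decay ν c Y s / ω₁₁) ^ (1 / v₁)
      = ((Y ^ (1 - ν) + c * (ν - 1) * s) / ω₁₁ ^ (1 - ν)) ^ (1 / (v₁ * (1 - ν))) := by
  unfold decay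
  rw [if_neg hν.ne', if_neg hY]
  have h1 : 1 - ν ≠ 0 := by linarith
  have h2 : (1 : ℝ) / (v₁ * (1 - ν)) = 1 / (1 - ν) * (1 / v₁) := by
    rw [one_div_mul_one_div, mul_comm]
  rw [h2, Real.rpow_mul (by positivity), Real.div_rpow hb.le (by positivity),
    ← Real.rpow_mul hω₁₁.le, mul_one_div_cancel h1, Real.rpow_one]

end NonholonomicTracking

end

/-! ### Choice of the constants and conclusion -/

open NonholonomicTracking

theorem mainTheorem6 {n m : ℕ} (D : Set (NonholonomicTracking.E n))
    (hDo : IsOpen D) (hDc : IsConnected D)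
    (f : Fin m → NonholonomicTracking.E n → ℝ → NonholonomicTracking.E n)
    (S₁ : Finset (Fin m)) (S₂ : Finset (Fin m × Fin m))
    (κ : Fin m × Fin m → ℕ) (hκpos : ∀ p ∈ S₂, 0 < κ p) (hκ : Set.InjOn κ (S₂ : Set (Fin m × Fin m)))
    (xs : ℝ → NonholonomicTracking.E n) (hxs : ContinuousOn xs (Set.Ici 0))
    (hxsD : ∀ t, 0 ≤ t → xs t ∈ D)
    (P : NonholonomicTracking.E n → ℝ → ℝ)
    (hA1 : NonholonomicTracking.FieldRegularity D xs f)
    (hA2 : NonholonomicTracking.BracketGenerating D xs f S₁ S₂)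
    (hA3 : NonholonomicTracking.PotentialRegularity D xs P)
    (hA4 : NonholonomicTracking.LevelSetAssumption D P)
    (mP ω₁₁ ω₁₂ v₁ v₂ : ℝ) (hω₁₁ : 0 < ω₁₁) (hω₁₂ : 0 < ω₁₂) (hv₁ : 0 < v₁) (hv₂ : 0 < v₂)
    (hP : ∀ t, 0 ≤ t → ∀ x ∈ D,
      ω₁₁ * ‖x - xs t‖ ^ v₁ ≤ P x t - mP ∧ P x t - mP ≤ ω₁₂ * ‖x - xs t‖ ^ v₂)
    (μ₁ μ₂ ν₁ ν₂ : ℝ) (hμ₁ : 0 < μ₁) (hμ₂ : 0 < μ₂) (hν₁ : 1 ≤ ν₁) (hν₂ : 1 ≤ ν₂)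
    (hgrad : ∀ t, 0 ≤ t → ∀ x ∈ D,
      μ₁ * (P x t - mP) ^ ν₁ ≤ ‖NonholonomicTracking.gradX P x t‖ ^ 2 ∧
      ‖NonholonomicTracking.gradX P x t‖ ^ 2 ≤ μ₂ * (P x t - mP) ^ ν₂)
    (ρ : ℝ) (hρ : 0 < ρ)
    (hρD : ∃ lam : ℝ, 0 < lam ∧ ∀ t0 t, 0 ≤ t0 → t0 ≤ t →
      ∀ x0 ∈ NonholonomicTracking.tube D xs ρ t0,
        IsCompact (NonholonomicTracking.sublevel D P t (P x0 t0 + lam))) :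
    ∃ (Δ γbar : ℝ) (εbar : ℝ → ℝ),
      NonholonomicTracking.IsAttractingWith D f S₁ S₂ κ P xs ρ Δ γbar εbar ∧
      ∀ γs, γbar ≤ γs → ∀ γ, γs < γ → ∀ ε ∈ Set.Ioc 0 (εbar γ), ∀ t0, 0 ≤ t0 →
      ∀ x0 ∈ Metric.thickening Δ (NonholonomicTracking.tube D xs ρ t0) ∩ D,
      ∀ x : ℝ → NonholonomicTracking.E n,
        NonholonomicTracking.IsClosedLoopSolution D f S₁ S₂ κ P γ ε t0 x0 x →
        (ν₁ = 1 → ∀ t, t0 ≤ t →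
          ‖x t - xs t‖ ≤ (ω₁₂ / ω₁₁) ^ (1 / v₁) * ‖x0 - xs t0‖ ^ (v₂ / v₁)
              * Real.exp (-(μ₁ * γs / v₁) * (t - t0 - ε)) + ρ) ∧
        (1 < ν₁ → ∀ t, t0 ≤ t →
          (x0 = xs t0 → ‖x t - xs t‖ ≤ ρ) ∧
          (x0 ≠ xs t0 →
            0 < (ω₁₂ / ω₁₁) ^ (1 - ν₁) * ‖x0 - xs t0‖ ^ (v₂ * (1 - ν₁))
                + μ₁ * γs * (ν₁ - 1) / ω₁₁ ^ (1 - ν₁) * (t - t0 - ε) ∧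
            ‖x t - xs t‖ ≤
              ((ω₁₂ / ω₁₁) ^ (1 - ν₁) * ‖x0 - xs t0‖ ^ (v₂ * (1 - ν₁))
                + μ₁ * γs * (ν₁ - 1) / ω₁₁ ^ (1 - ν₁) * (t - t0 - ε)) ^ (1 / (v₁ * (1 - ν₁)))
              + ρ)) := by
  have hE : ∀ t, 0 ≤ t → ∀ x ∈ D, DifferentiableAt ℝ (fun y => P y t) x := fun t ht x hx =>
    ((hA3.contDiff_space t ht).contDiffAt (hDo.mem_nhds hx)).differentiableAt two_ne_zero
  obtain ⟨lam, hlam, hρD⟩ := hρD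
  have hP₁ : ∀ t, 0 ≤ t → ∀ x ∈ D, ω₁₁ * ‖x - xs t‖ ^ v₁ ≤ P x t - mP :=
    fun t ht x hx => (hP t ht x hx).1
  have hP₂ : ∀ t, 0 ≤ t → ∀ x ∈ D, P x t - mP ≤ ω₁₂ * ‖x - xs t‖ ^ v₂ :=
    fun t ht x hx => (hP t ht x hx).2
  have hV : ∀ t, 0 ≤ t → ∀ x ∈ D, 0 ≤ P x t - mP := fun t ht x hx =>
    le_trans (by positivity) (hP₁ t ht x hx)
  have hg₁ : ∀ t, 0 ≤ t → ∀ x ∈ D, μ₁ * (P x t - mP) ^ ν₁ ≤ ‖gradX P x t‖ ^ 2 :=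
    fun t ht x hx => (hgrad t ht x hx).1
  set 𝒦 : ℝ → Set (E n) := fun t => sublevel D P t (peak D xs P ρ t + lam / 2) with h𝒦def
  have hfam : IsCompactFamily D xs 𝒦 := isCompactFamily_sublevel hDo hω₁₁ hω₁₂ hv₁ hv₂ hρ hxsD
    hP₁ hP₂ hE hμ₂ hν₂ (fun t ht x hx => (hgrad t ht x hx).2) hlam hρD
  have htube : ∀ t, 0 ≤ t → tube D xs ρ t ⊆ 𝒦 t := fun t ht z hz =>
    ⟨hz.1, by linarith [le_peak hω₁₂ hv₂ hP₂ ht le_rfl hz]⟩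
  have hxstube : ∀ t, 0 ≤ t → xs t ∈ tube D xs ρ t := fun t ht =>
    ⟨hxsD t ht, by simpa using hρ.le⟩
  obtain ⟨h, hh, 𝒦', h𝒦', r, hr, hsub⟩ : ∃ h > 0, ∃ 𝒦' : ℝ → Set (E n),
      IsCompactFamily D xs 𝒦' ∧ ∃ r > 0, ∀ T, 0 ≤ T → ∀ ξ ∈ 𝒦 T, ∀ s, T ≤ s → s ≤ T + h →
        Metric.ball ξ r ⊆ 𝒦' s := by
    obtain ⟨-, R, δ, hδ, hRδ⟩ := id hfam
    obtain ⟨h, hh, hmod⟩ := exists_target_modulus hxs hω₁₁ hv₂ hxsD hP₁ hP₂ hA3 hδ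
      (fun t ht => (Metric.ball_subset_thickening (htube t ht (hxstube t ht)) δ).trans
        (hRδ t ht).2)
    exact ⟨h, hh, hfam.exists_enlarge hmod⟩
  obtain ⟨C, hC, hnear⟩ := exists_uniform_constants hDo hA1 hA2 hA3 h𝒦' hr hsub
  -- The bound `1` limits the initial potential by `Ymax`; `r` puts `x0` in a ball around a tube
  -- point where `P` is Lipschitz; the last bound makes `P x0 t0` exceed the value at that point by
  -- at most `lam / 4`.
  set Δ := min (min 1 r) (lam / (4 * C)) with hΔ
  have hΔ0 : 0 < Δ := by positivity
  have hΔ1 : Δ ≤ 1 := (min_le_left _ _).trans (min_le_left _ _)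
  have hΔr : Δ ≤ r := (min_le_left _ _).trans (min_le_right _ _)
  have hΔlam : C * Δ ≤ lam / 4 := by
    have : Δ ≤ lam / (4 * C) := min_le_right _ _
    rw [le_div_iff₀ (by positivity)] at this
    linarith
  set Ymax := ω₁₂ * (ρ + 1) ^ v₂ with hYmax
  have hYmax0 : 0 < Ymax := by positivity
  obtain ⟨δ, hδ, hmargin⟩ := exists_rpow_margin (p := 1 / v₁) (A := Ymax / ω₁₁) (b := ρ)
    (by positivity) hρ
  -- In turn: `Ymax + η` stays below `Ymax + 1`; together with `Δ` the level stays below `peak + lam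
  -- / 2`; `V ≤ 3η` implies membership in the tube; `2η` costs at most `ρ` in the distance.
  set η := min (min 1 (lam / 4)) (min (ω₁₁ * ρ ^ v₁ / 3) (δ * ω₁₁ / 2)) with hη
  have hη0 : 0 < η := by positivity
  have hη1 : η ≤ 1 := (min_le_left _ _).trans (min_le_left _ _)
  have hηlam : η ≤ lam / 4 := (min_le_left _ _).trans (min_le_right _ _)
  have hηρ : 3 * η ≤ ω₁₁ * ρ ^ v₁ := by
    have : η ≤ ω₁₁ * ρ ^ v₁ / 3 := (min_le_right _ _).trans (min_le_left _ _)
    linarith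
  have hηδ : 2 * η / ω₁₁ ≤ δ := by
    have : η ≤ δ * ω₁₁ / 2 := (min_le_right _ _).trans (min_le_right _ _)
    rw [div_le_iff₀ hω₁₁]
    linarith
  -- The least gain for which the margin `η` absorbs the perturbation `C + 1`.
  set γbar := (C + 1) / (μ₁ * η ^ ν₁) with hγbar
  have hγbar0 : 0 < γbar := by positivity
  have hB : ∀ γs, γbar ≤ γs → C + 1 ≤ γs * μ₁ * η ^ ν₁ := by
    intro γs hγs
    rw [hγbar, div_le_iff₀ (by positivity)] at hγs
    linarith
  have hexε : ∀ γ, ∃ e, γbar ≤ γ → 0 < e ∧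
      ∀ ε ∈ Ioc 0 e, SmallStep D f S₁ S₂ κ P 𝒦 C r γ ε μ₁ ν₁ η (Ymax + 1) := by
    intro γ
    by_cases hγ : γbar ≤ γ
    · obtain ⟨e, he, hes⟩ := exists_smallStep (κ := κ) (μ₁ := μ₁) (ν₁ := ν₁) (Vmax := Ymax + 1)
        hh hC hr (hγbar0.trans_le hγ) hη0 (by positivity) hnear
      exact ⟨e, fun _ => ⟨he, hes⟩⟩
    · exact ⟨0, fun h => absurd h hγ⟩
  choose εbar hεbar using hexε
  have hcmp : ∀ γ ε, SmallStep D f S₁ S₂ κ P 𝒦 C r γ ε μ₁ ν₁ η (Ymax + 1) →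
      ComparisonProperty f S₁ S₂ κ P 𝒦 C γ ε mP μ₁ ν₁ η (Ymax + 1) := fun γ ε hs =>
    hs.comparison hκpos hκ hA2.card hA2.span hg₁ hμ₁ hν₁ hη0.le hV
  have hinit : ∀ t0, 0 ≤ t0 → ∀ x0 ∈ Metric.thickening Δ (tube D xs ρ t0) ∩ D,
      P x0 t0 - mP ≤ ω₁₂ * ‖x0 - xs t0‖ ^ v₂ ∧ ω₁₂ * ‖x0 - xs t0‖ ^ v₂ ≤ Ymax ∧
      ∀ t, t0 ≤ t → ∀ ξ ∈ D, P ξ t ≤ P x0 t0 + η → ξ ∈ 𝒦 t := by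
    rintro t0 ht0 x0 ⟨hx0, hx0D⟩
    obtain ⟨z, hz, hzx⟩ := Metric.mem_thickening_iff.1 hx0
    rw [dist_eq_norm] at hzx
    refine ⟨hP₂ t0 ht0 x0 hx0D, ?_, fun t ht ξ hξ hPξ => ⟨hξ, ?_⟩⟩
    · have h1 : ‖x0 - xs t0‖ ≤ ρ + 1 := by
        have h2 := norm_sub_le_norm_sub_add_norm_sub x0 z (xs t0)
        linarith [hz.2]
      rw [hYmax]
      gcongr
    -- The level is compared with a tube point at time `t0`; since `peak` at a later `t` includes
    -- that value, the conclusion holds for all `t ≥ t0`.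
    · obtain ⟨-, -, h3, -⟩ := hnear t0 ht0 z (htube t0 ht0 hz) h hh le_rfl
      have h4 := h3.lip x0 (by rw [mem_ball_iff_norm]; linarith) z (Metric.mem_ball_self hr) t0
        ⟨le_rfl, by linarith⟩
      rw [sub_self, abs_zero, mul_zero, add_zero] at h4
      have h5 : C * ‖x0 - z‖ ≤ C * Δ := by gcongr
      have h6 := le_peak hω₁₂ hv₂ hP₂ ht0 ht hz
      linarith [le_abs_self (P x0 t0 - P z t0)]
  have hest : ∀ γs, γbar ≤ γs → ∀ γ, γs ≤ γ → ∀ ε ∈ Ioc 0 (εbar γ), ∀ t0, 0 ≤ t0 →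
      ∀ x0 ∈ Metric.thickening Δ (tube D xs ρ t0) ∩ D, ∀ x : ℝ → E n,
      IsClosedLoopSolution D f S₁ S₂ κ P γ ε t0 x0 x → ∀ t, t0 ≤ t →
      (ν₁ ≠ 1 → ω₁₂ * ‖x0 - xs t0‖ ^ v₂ ≠ 0 → 0 < (ω₁₂ * ‖x0 - xs t0‖ ^ v₂) ^ (1 - ν₁)
        + γs * μ₁ * (ν₁ - 1) * (t - t0 - ε)) ∧
      ∃ d, 0 ≤ d ∧ d ≤ ω₁₂ * ‖x0 - xs t0‖ ^ v₂ ∧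
        d ≤ decay ν₁ (γs * μ₁) (ω₁₂ * ‖x0 - xs t0‖ ^ v₂) (t - t0 - ε) ∧
        P (x t) t - mP ≤ d + 2 * η := by
    intro γs hγs γ hγ ε hε t0 ht0 x0 hx0 x hx t ht
    obtain ⟨h1, h2, h3⟩ := hinit t0 ht0 x0 hx0
    have hs := (hεbar γ (hγs.trans hγ)).2 ε hε
    exact hs.potential_le_decay (hcmp γ ε hs) hμ₁ hν₁ hη0.le (hγbar0.trans_le hγs) hγ (hB γs hγs)
      (by positivity) (by linarith) h1 ht0 hx
      (hs.mem_of_solution (hcmp γ ε hs) hμ₁ hη0.le hV (hB γ (hγs.trans hγ)) ht0 hx0.2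
        (by linarith) h3 hx) ht
  have hbound : ∀ γs, γbar ≤ γs → ∀ γ, γs ≤ γ → ∀ ε ∈ Ioc 0 (εbar γ), ∀ t0, 0 ≤ t0 →
      ∀ x0 ∈ Metric.thickening Δ (tube D xs ρ t0) ∩ D, ∀ x : ℝ → E n,
      IsClosedLoopSolution D f S₁ S₂ κ P γ ε t0 x0 x → ∀ t, t0 ≤ t →
      ‖x t - xs t‖ ≤ (decay ν₁ (γs * μ₁) (ω₁₂ * ‖x0 - xs t0‖ ^ v₂) (t - t0 - ε) / ω₁₁) ^ (1 / v₁)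
        + ρ := by
    intro γs hγs γ hγ ε hε t0 ht0 x0 hx0 x hx t ht
    obtain ⟨-, d, hd0, hdY, hd, hPd⟩ := hest γs hγs γ hγ ε hε t0 ht0 x0 hx0 x hx t ht
    have h2 := (hinit t0 ht0 x0 hx0).2.1
    have hxD : x t ∈ D := hx.mem t ht
    have ht' : 0 ≤ t := ht0.trans ht
    have h3 := le_rpow_inv_of_mul_rpow_le hω₁₁ hv₁ (norm_nonneg _)
      ((hP₁ t ht' _ hxD).trans hPd)
    have h4 : d / ω₁₁ ≤ Ymax / ω₁₁ := by gcongr; linarith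
    calc ‖x t - xs t‖ ≤ ((d + 2 * η) / ω₁₁) ^ (1 / v₁) := h3
      _ ≤ (d / ω₁₁ + δ) ^ (1 / v₁) := by
        rw [add_div]
        gcongr
      _ ≤ (d / ω₁₁) ^ (1 / v₁) + ρ := hmargin _ (by positivity) h4
      _ ≤ _ := by gcongr
  refine ⟨Δ, γbar, εbar, ⟨hΔ0, hγbar0, fun γ hγ => (hεbar γ hγ).1, ?_, ?_, ?_⟩, ?_⟩
  · intro t0 ht0 x0 hx0 γ hγ ε hε
    obtain ⟨h1, h2, h3⟩ := hinit t0 ht0 x0 hx0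
    have hs := (hεbar γ hγ).2 ε hε
    exact hs.exists_solution (hcmp γ ε hs) hμ₁ hη0.le hV (hB γ hγ) ht0 hx0.2 (by linarith) h3
  · intro t0 ht0 x0 hx0 γ hγ ε hε x y hx hy
    obtain ⟨h1, h2, h3⟩ := hinit t0 ht0 x0 hx0
    have hs := (hεbar γ hγ).2 ε hε
    exact hs.eqOn_of_solutions ht0 hx hy (hs.mem_of_solution (hcmp γ ε hs) hμ₁ hη0.le hV
      (hB γ hγ) ht0 hx0.2 (by linarith) h3 hx)
  · intro t0 ht0 x0 hx0 γ hγ ε hε x hx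
    have hlim : Tendsto (fun t => decay ν₁ (γ * μ₁) (ω₁₂ * ‖x0 - xs t0‖ ^ v₂) (t - t0 - ε))
        atTop (𝓝 0) := by
      refine (tendsto_decay hν₁ (mul_pos (hγbar0.trans_le hγ) hμ₁)).comp ?_
      exact tendsto_atTop_add_const_right _ (-ε)
        (tendsto_atTop_add_const_right _ (-t0) tendsto_id)
    -- The distance is eventually equal to zero: once the decay term is below `η`, the total `d +
    -- 2η` is below `3η ≤ ω₁₁ ρ ^ v₁`.
    refine Tendsto.congr' (f₁ := fun _ => (0 : ℝ)) ?_ tendsto_const_nhds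
    filter_upwards [hlim.eventually (gt_mem_nhds hη0), eventually_ge_atTop t0] with t h1 ht
    obtain ⟨-, d, hd0, hdY, hd, hPd⟩ := hest γ hγ γ le_rfl ε hε t0 ht0 x0 hx0 x hx t ht
    have hxD : x t ∈ D := hx.mem t ht
    have h2 := hP₁ t (ht0.trans ht) _ hxD
    have h3 : ω₁₁ * ‖x t - xs t‖ ^ v₁ ≤ ω₁₁ * ρ ^ v₁ := by linarith
    have h4 := (Real.rpow_le_rpow_iff (norm_nonneg _) hρ.le hv₁).1
      (le_of_mul_le_mul_left h3 hω₁₁)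
    exact (Metric.infDist_zero_of_mem (show x t ∈ tube D xs ρ t from ⟨hxD, h4⟩)).symm
  · intro γs hγs γ hγ ε hε t0 ht0 x0 hx0 x hx
    refine ⟨fun hν t ht => ?_, fun hν t ht => ⟨fun hx0s => ?_, fun hx0s => ?_⟩⟩
    · have h1 := hbound γs hγs γ hγ.le ε hε t0 ht0 x0 hx0 x hx t ht
      rwa [hν, decay_div_rpow_of_eq_one hω₁₁ hω₁₂ (norm_nonneg _), mul_comm γs μ₁] at h1
    · have h1 := hbound γs hγs γ hγ.le ε hε t0 ht0 x0 hx0 x hx t ht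
      have h2 : decay ν₁ (γs * μ₁) (ω₁₂ * ‖x0 - xs t0‖ ^ v₂) (t - t0 - ε) = 0 := by
        unfold decay
        rw [if_neg hν.ne', if_pos]
        rw [hx0s, sub_self, norm_zero, Real.zero_rpow hv₂.ne', mul_zero]
      rwa [h2, zero_div, Real.zero_rpow (by positivity), zero_add] at h1
    · have h1 := hbound γs hγs γ hγ.le ε hε t0 ht0 x0 hx0 x hx t ht
      have h0 : 0 < ‖x0 - xs t0‖ := norm_pos_iff.2 (sub_ne_zero.2 hx0s)
      have hY : ω₁₂ * ‖x0 - xs t0‖ ^ v₂ ≠ 0 := by positivity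
      have h2 := (hest γs hγs γ hγ.le ε hε t0 ht0 x0 hx0 x hx t ht).1 hν.ne' hY
      rw [mul_comm μ₁ γs, bracket_eq hω₁₁ hω₁₂ (norm_nonneg _)]
      refine ⟨by positivity, ?_⟩
      rwa [decay_div_rpow_of_one_lt hω₁₁ hν hY h2] at h1
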